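/- **Setting.** Security parameters are $\lambda\in\mathbb N$; "$f\le \mathrm{poly}(g)$" means $f(\lambda)=O(g(\lambda)^c)$ for some constant $c$; a function $\mathrm{negl}$ is negligible if $x^c\,\mathrm{negl}(x)\to 0$ as $x\to\infty$ for every $c\in\mathbb N$. Algorithms are probabilistic machines with a step count (programs over finitely many binary stacks, polynomially equivalent to Turing machines), possibly with an oracle; "efficient" means time $\mathrm{poly}(\lambda)$. A uniform adversary is a single machine, which gets $1^\lambda$ as an additional input; a non-uniform one is a sequence $(\mathcal B_\lambda)_\lambda$ of machines whose descriptions have length $\mathrm{poly}(\Gamma(\lambda))$. An adversary is $\mathrm{poly}(\Gamma(\lambda))$-time if it halts within that many steps on all inputs of the right lengths and for all oracles with answers no longer than ciphertexts. *Encryption schemes.* An encryption scheme $\Pi'=(\mathrm{Gen}',\mathrm{Enc}',\mathrm{Dec}')$ consists of efficient algorithms: $\mathrm{Gen}'(1^\lambda)$ outputs a key $x\in\{0,1\}^\lambda$; $\mathrm{Enc}'(x,m)$, for $m\in\{0,1\}$, outputs a ciphertext in $\{0,1\}^{\mathrm{poly}(\lambda)}$; $\mathrm{Dec}'$ is deterministic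 with $\mathrm{Dec}'(x,\mathrm{Enc}'(x,m))=m$ always. It is $\Gamma$-secure against uniform (resp. non-uniform) adversaries if for every such $\mathrm{poly}(\Gamma(\lambda))$-time adversary $\mathcal B$ there is a negligible function with $|\Pr[\mathcal B^{\mathcal E_0(x,\cdot)}=1]-\Pr[\mathcal B^{\mathcal E_1(x,\cdot)}=1]|\le\mathrm{negl}(\Gamma(\lambda))$, where $x\leftarrow\mathrm{Gen}'(1^\lambda)$, $\mathcal E_1(x,m)$ returns $\mathrm{Enc}'(x,m)$ and $\mathcal E_0(x,m)$ returns $\mathrm{Enc}'(x,0)$. *MILR schemes.* A multi-instance leakage-resilient (MILR) scheme $\Pi=(\mathrm{Gen},\mathrm{Param},\mathrm{Enc},\mathrm{Dec})$ consists of efficient algorithms: $\mathrm{Gen}(1^\lambda)$ outputs a key $x\in\{0,1\}^\lambda$; $\mathrm{Param}(1^\lambda)$ outputs a public parameter $p\in\{0,1\}^{\mathrm{poly}(\lambda)}$; $\mathrm{Enc}(x,p,m)$, for $m\in\{0,1\}$, outputs a ciphertext in $\{0,1\}^{\mathrm{poly}(\lambda)}$; $\mathrm{Dec}$ is deterministic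 with $\mathrm{Dec}(x,p,\mathrm{Enc}(x,p,m))=m$ always. For keys $\vec x=(x_1,\dots,x_n)$, parameters $\vec p=(p_1,\dots,p_n)$ and $J\subseteq[n]$, the oracle $\mathcal E_1(\vec x,\vec p,J,\cdot,\cdot)$ returns $\mathrm{Enc}(x_j,p_j,m)$ on query $(j,m)$; $\mathcal E_0(\vec x,\vec p,J,\cdot,\cdot)$ returns $\mathrm{Enc}(x_j,p_j,0)$ if $j\in J$ and $\mathrm{Enc}(x_j,p_j,m)$ otherwise. Below, $x_1,\dots,x_n$ and $p_1,\dots,p_n$ are independent samples of $\mathrm{Gen}(1^\lambda)$ and $\mathrm{Param}(1^\lambda)$. - $\Pi$ has *$\Gamma$-multi semantic security* if for every $n=n(\lambda)\le\mathrm{poly}(\Gamma(\lambda))$ (in the uniform case: computable, in unary, in time $\mathrm{poly}(\Gamma(\lambda))$) and every $\mathrm{poly}(\Gamma(\lambda))$-time adversary $\mathcal B$ there is a negligible function with $$\bigl|\Pr[\mathcal B^{\mathcal E_0(\vec x,\vec p,[n],\cdot,\cdot)}(\vec p)=1]-\Pr[\mathcal B^{\mathcal E_1(\vec x,\vec p,[n],\cdot,\cdot)}(\vec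 p)=1]\bigr|\le\mathrm{negl}(\Gamma(\lambda)).$$ - $\Pi$ is *$(\Gamma,\bar\tau)$-secure against space-bounded non-uniform preprocessing adversaries* if it has $\Gamma$-multi semantic security against non-uniform adversaries and, for every $n=n(\lambda)\le\mathrm{poly}(\Gamma(\lambda))$, every $s=s(\lambda)\le n\lambda$ and every (arbitrary, possibly randomized) $F:(\{0,1\}^\lambda)^n\to\{0,1\}^s$, there is a random function $J=J(F,\vec x,z,\vec p)\subseteq[n]$ with $|J|\ge n-\bar\tau(\lambda,s)$ such that for every non-uniform $\mathrm{poly}(\Gamma(\lambda))$-time $\mathcal B$ there is a negligible function with $$\bigl|\Pr[\mathcal B^{\mathcal E_0(\vec x,\vec p,J,\cdot,\cdot)}(z,\vec p)=1]-\Pr[\mathcal B^{\mathcal E_1(\vec x,\vec p,J,\cdot,\cdot)}(z,\vec p)=1]\bigr|\le\mathrm{negl}(\Gamma(\lambda)),$$ where $z\leftarrow F(\vec x)$ and $J\leftarrow J(F,\vec x,z,\vec p)$. **Construction.** Put $\lambda'=\lfloor 0.1\lambda\rfloor$. Let $\mathcal G$ be an efficient universal hash family: for each $\lambda$, functions $g:\{0,1\}^\lambda\to\{0,1\}^{\lambda'}$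 given by seeds in $\{0,1\}^{\mathrm{poly}(\lambda)}$ (uniform seeds being efficiently sampleable, and $g(x)$ computable in deterministic polynomial time from $x$ and the seed) with $\Pr_g[g(x)=g(y)]\le 2^{-\lambda'}$ for all $x\ne y$. Given $\Pi'$ with uniformly distributed keys, let $\Pi=\Pi(\Pi',\mathcal G)$ be: $\mathrm{Gen}(1^\lambda)$ returns a uniform $x\in\{0,1\}^\lambda$, $\mathrm{Param}(1^\lambda)$ returns a uniformly random $g$, $\mathrm{Enc}(x,g,m)=\mathrm{Enc}'(g(x),m)$ and $\mathrm{Dec}(x,g,c)=\mathrm{Dec}'(g(x),c)$. **Theorem.** Let $\Gamma:\mathbb N\to\mathbb R$ satisfy $\Omega(\lambda)\le\Gamma(\lambda)\le 2^{o(\lambda)}$ and $\Gamma(\lambda)\le\mathrm{poly}(\Gamma(\lfloor 0.1\lambda\rfloor))$, and let $\bar\tau(\lambda,s)=\frac{2s}{\lambda}+4$. 1. An efficient universal hash family $\mathcal G$ as above exists. 2. For every such $\mathcal G$ and every encryption scheme $\Pi'$ with uniformly distributed keys, $\Pi=\Pi(\Pi',\mathcal G)$ is an MILR scheme. If $\Pi'$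 is $\Gamma$-secure against uniform (resp. non-uniform) adversaries, then $\Pi$ has $\Gamma$-multi semantic security against uniform (resp. non-uniform) adversaries. If $\Pi'$ is $\Gamma$-secure against non-uniform adversaries, then $\Pi$ is $(\Gamma,\bar\tau)$-secure against space-bounded non-uniform preprocessing adversaries. 3. Consequently, if there is an encryption scheme with uniformly distributed keys that is $\Gamma$-secure against non-uniform adversaries, then there is an MILR scheme that is $(\Gamma,\bar\tau)$-secure against space-bounded non-uniform preprocessing adversaries. -/

import Mathlib

open Filter Asymptotics

noncomputable section

namespace MILR

/-! ### Bit strings and independent samples -/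

/-- The set `{0,1}^k`. -/
abbrev BitStr (k : ℕ) : Type := Fin k → Bool

/-- The uniform distribution on `{0,1}^k`. -/
def uniformBits (k : ℕ) : PMF (BitStr k) := PMF.uniformOfFintype (BitStr k)

/-- `n` independent samples of `μ`. -/
def iid {α : Type} (μ : PMF α) : (n : ℕ) → PMF (Fin n → α)
  | 0 => PMF.pure Fin.elim0
  | n + 1 => μ.bind fun a => (iid μ n).map fun v => Fin.cons a v

/-- The unary string `1^k`. -/
def unary (k : ℕ) : List Bool := List.replicate k true

/-- A self-delimiting encoding of a sequence of strings as one string: each bit `b` becomes `1b`,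
and each string is terminated by a `0`. -/
def encodeSeq {n l : ℕ} (p : Fin n → BitStr l) : List Bool :=
  (List.ofFn p).flatMap fun w => ((List.ofFn w).flatMap fun b => [true, b]) ++ [false]

/-! ### Probabilistic oracle machines

A machine is a structured program that acts on a finite number of binary stacks. It can flip coins
and query an oracle. Every basic instruction and every test takes one step. Such machines and
multi-tape Turing machines simulate each other with polynomial overhead. -/

/-- Programs over binary stacks, which are numbered by natural numbers. -/
inductive Prog : Type
  /-- do nothing -/
  | skip : Prog
  /-- push the bit `b` on stack `r` -/
  | push (r : ℕ) (b : Bool) : Prog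
  /-- remove the top of stack `r` (no effect on an empty stack) -/
  | pop (r : ℕ) : Prog
  /-- push a fresh uniformly random bit on stack `r` -/
  | coin (r : ℕ) : Prog
  /-- query the oracle on the content of stack `q`; its answer replaces the content of `a` -/
  | query (q a : ℕ) : Prog
  /-- first `P`, then `Q` -/
  | seq (P Q : Prog) : Prog
  /-- continue with `E`, `P` or `Q` if stack `r` is empty, has top `0`, has top `1` -/
  | branch (r : ℕ) (E P Q : Prog) : Prog
  /-- repeat `P` as long as stack `r` is not empty -/
  | loop (r : ℕ) (P : Prog) : Prog

namespace Prog

/-- The length of the description of a program (stack numbers are written in unary). -/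
def size : Prog → ℕ
  | skip => 1
  | push r _ => r + 1
  | pop r => r + 1
  | coin r => r + 1
  | query q a => q + a + 1
  | seq P Q => P.size + Q.size + 1
  | branch r E P Q => r + E.size + P.size + Q.size + 1
  | loop r P => r + P.size + 1

/-- The program never queries the oracle. -/
def QueryFree : Prog → Prop
  | query _ _ => False
  | seq P Q => P.QueryFree ∧ Q.QueryFree
  | branch _ E P Q => E.QueryFree ∧ P.QueryFree ∧ Q.QueryFree
  | loop _ P => P.QueryFree
  | _ => True

/-- The program is deterministic: it never flips a coin. -/
def CoinFree : Prog → Prop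
  | coin _ => False
  | seq P Q => P.CoinFree ∧ Q.CoinFree
  | branch _ E P Q => E.CoinFree ∧ P.CoinFree ∧ Q.CoinFree
  | loop _ P => P.CoinFree
  | _ => True

end Prog

/-- The contents of all stacks. -/
abbrev Store : Type := ℕ → List Bool

/-- A (randomized, stateless) oracle. -/
abbrev Oracle : Type := List Bool → PMF (List Bool)

/-- A configuration: the programs still to be executed, in order, and the contents of the stacks.
The machine has halted when the list is empty. -/
abbrev Config : Type := List Prog × Store

/-- One step of computation. -/
def step (O : Oracle) : Config → PMF Config
  | ([], s) => PMF.pure ([], s)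
  | (Prog.skip :: K, s) => PMF.pure (K, s)
  | (Prog.push r b :: K, s) => PMF.pure (K, Function.update s r (b :: s r))
  | (Prog.pop r :: K, s) => PMF.pure (K, Function.update s r (s r).tail)
  | (Prog.coin r :: K, s) =>
      (PMF.uniformOfFintype Bool).map fun b => (K, Function.update s r (b :: s r))
  | (Prog.query q a :: K, s) => (O (s q)).map fun c => (K, Function.update s a c)
  | (Prog.seq P Q :: K, s) => PMF.pure (P :: Q :: K, s)
  | (Prog.branch r E P Q :: K, s) =>
      PMF.pure (match s r with
        | [] => (E :: K, s)
        | false :: _ => (P :: K, s)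
        | true :: _ => (Q :: K, s))
  | (Prog.loop r P :: K, s) =>
      PMF.pure (match s r with
        | [] => (K, s)
        | _ :: _ => (P :: Prog.loop r P :: K, s))

/-- The configuration after `t` steps. -/
def steps (O : Oracle) : ℕ → Config → PMF Config
  | 0, c => PMF.pure c
  | t + 1, c => (step O c).bind (steps O t)

/-- Initially the inputs are on stacks `0, 1, 2, …` (first letter on top); all other stacks are
empty. -/
def load (inputs : List (List Bool)) : Store := fun r => inputs.getD r []

/-- On the given inputs, `P` halts within `t` steps, whatever its coins and the oracle's are. -/
def HaltsWithin (O : Oracle) (P : Prog) (inputs : List (List Bool)) (t : ℕ) : Prop :=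
  ∀ c ∈ (steps O t ([P], load inputs)).support, c.1 = []

/-- The distribution of the content of stack `0`, the output, after `t` steps. -/
def output (O : Oracle) (P : Prog) (inputs : List (List Bool)) (t : ℕ) : PMF (List Bool) :=
  (steps O t ([P], load inputs)).map fun c => c.2 0

/-- The oracle that is used for algorithms without an oracle. -/
def noOracle : Oracle := fun _ => PMF.pure []

/-! ### Asymptotics and efficient algorithms -/

/-- `f(λ) ≤ poly(Γ(λ))`. -/
def PolyIn (Γ : ℕ → ℝ) (f : ℕ → ℕ) : Prop :=
  ∃ c : ℕ, (fun k => (f k : ℝ)) =O[atTop] fun k => Γ k ^ c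

/-- `f(λ) ≤ poly(λ)`. -/
def IsPoly (f : ℕ → ℕ) : Prop := PolyIn (fun k => (k : ℝ)) f

/-- `ν(x)` tends to `0` faster than every inverse polynomial as `x → ∞`. -/
def Negligible (ν : ℝ → ℝ) : Prop := SuperpolynomialDecay atTop id ν

/-- A single program without an oracle computes, for every `k` and every `i`, a sample of `f k i`
from the inputs `inp k i`, in at most `t k` steps. -/
def RunsInTime (t : ℕ → ℕ) (P : Prog) {ι : ℕ → Type} (inp : ∀ k, ι k → List (List Bool))
    (f : ∀ k, ι k → PMF (List Bool)) : Prop :=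
  P.QueryFree ∧ ∀ k i, HaltsWithin noOracle P (inp k i) (t k) ∧
    output noOracle P (inp k i) (t k) = f k i

/-- `f` is computed by a randomized polynomial-time algorithm. -/
def Efficient {ι : ℕ → Type} (inp : ∀ k, ι k → List (List Bool))
    (f : ∀ k, ι k → PMF (List Bool)) : Prop :=
  ∃ (P : Prog) (t : ℕ → ℕ), IsPoly t ∧ RunsInTime t P inp f

/-- `f` is computed by a deterministic polynomial-time algorithm. -/
def DetEfficient {ι : ℕ → Type} (inp : ∀ k, ι k → List (List Bool))
    (f : ∀ k, ι k → List Bool) : Prop :=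
  ∃ (P : Prog) (t : ℕ → ℕ), P.CoinFree ∧ IsPoly t ∧
    RunsInTime t P inp fun k i => PMF.pure (f k i)

/-- `n(λ)` is computable, in unary, by a deterministic algorithm in time `poly(Γ(λ))`. -/
def Constructible (Γ : ℕ → ℝ) (n : ℕ → ℕ) : Prop :=
  ∃ (P : Prog) (t : ℕ → ℕ), P.CoinFree ∧ PolyIn Γ t ∧
    RunsInTime t P (ι := fun _ => Unit) (fun k _ => [unary k])
      fun k _ => PMF.pure (unary (n k))

/-! ### Adversaries -/

/-- Uniform or non-uniform adversaries. -/
inductive AdvKind : Type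
  | uniform
  | nonuniform

/-- A uniform adversary is a single program; a non-uniform adversary is a sequence of programs whose
descriptions have length `poly(Γ(λ))`. -/
def AdvKind.Allows (Γ : ℕ → ℝ) : AdvKind → (ℕ → Prog) → Prop
  | uniform, B => ∃ P, ∀ k, B k = P
  | nonuniform, B => PolyIn Γ fun k => (B k).size

/-- The numbers of instances `n = poly(Γ(λ))` that are considered. Uniform security is about numbers
that a uniform algorithm can compute in time `poly(Γ(λ))`. -/
def AdvKind.Count (Γ : ℕ → ℝ) : AdvKind → (ℕ → ℕ) → Prop
  | uniform, n => PolyIn Γ n ∧ Constructible Γ n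
  | nonuniform, n => PolyIn Γ n

/-- `B` halts within `t` steps on the given inputs, with every oracle whose answers have length at
most `l`. -/
def TimeBounded (B : Prog) (inputs : List (List Bool)) (l t : ℕ) : Prop :=
  ∀ O : Oracle, (∀ q, ∀ c ∈ (O q).support, c.length ≤ l) → HaltsWithin O B inputs t

/-- The probability that the bit `1` is output. -/
def prOne (μ : PMF (List Bool)) : ℝ := (μ [true]).toReal

/-- The two families of experiments, with outcome `μ false k` and `μ true k`, are distinguished
with advantage at most `negl(Γ(λ))`. -/
def NegligibleAdvantage (Γ : ℕ → ℝ) (μ : Bool → ℕ → PMF (List Bool)) : Prop :=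
  ∃ ν : ℝ → ℝ, Negligible ν ∧ ∀ k, |prOne (μ false k) - prOne (μ true k)| ≤ ν (Γ k)

/-! ### Encryption schemes -/

/-- The syntax of a (private-key, one-bit) encryption scheme. Keys of security parameter `k` have
`k` bits, ciphertexts have `ctLen k` bits. -/
structure EncScheme where
  ctLen : ℕ → ℕ
  gen : (k : ℕ) → PMF (BitStr k)
  enc : (k : ℕ) → BitStr k → Bool → PMF (BitStr (ctLen k))
  dec : (k : ℕ) → BitStr k → BitStr (ctLen k) → Bool

namespace EncScheme

variable (S : EncScheme)

/-- All algorithms run in polynomial time (decryption deterministically), ciphertexts have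
polynomial length, and decryption is always correct. -/
structure IsValid : Prop where
  ctLen_poly : IsPoly S.ctLen
  gen_eff : Efficient (ι := fun _ => Unit) (fun k _ => [unary k])
    fun k _ => (S.gen k).map fun x => List.ofFn x
  enc_eff : Efficient (ι := fun k => BitStr k × Bool) (fun _ i => [List.ofFn i.1, [i.2]])
    fun k i => (S.enc k i.1 i.2).map fun c => List.ofFn c
  dec_eff : DetEfficient (ι := fun k => BitStr k × BitStr (S.ctLen k))
    (fun _ i => [List.ofFn i.1, List.ofFn i.2]) fun k i => [S.dec k i.1 i.2]
  correct : ∀ k x m, ∀ c ∈ (S.enc k x m).support, S.dec k x c = m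

/-- Keys are uniformly distributed. -/
def UniformKeys : Prop := ∀ k, S.gen k = uniformBits k

/-- The oracles `E_1(x,·)` (for `b = true`), which encrypts the queried message, and `E_0(x,·)` (for
`b = false`), which encrypts `0`. Anything but a one-bit message is answered by the empty string. -/
def oracle (k : ℕ) (x : BitStr k) (b : Bool) : Oracle
  | [m] => (S.enc k x (b && m)).map fun c => List.ofFn c
  | _ => PMF.pure []

/-- The output of an adversary, run for `t` steps, that interacts with `E_b(x,·)` for a random
key `x`. -/
def experiment (k : ℕ) (B : Prog) (t : ℕ) (b : Bool) : PMF (List Bool) :=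
  (S.gen k).bind fun x => output (S.oracle k x b) B [unary k] t

/-- `Γ`-security against adversaries of the given kind. -/
def Secure (kind : AdvKind) (Γ : ℕ → ℝ) : Prop :=
  ∀ (B : ℕ → Prog) (t : ℕ → ℕ), kind.Allows Γ B → PolyIn Γ t →
    (∀ k, TimeBounded (B k) [unary k] (S.ctLen k) (t k)) →
    NegligibleAdvantage Γ fun b k => S.experiment k (B k) (t k) b

end EncScheme

/-! ### Multi-instance leakage-resilient schemes -/

/-- The syntax of a multi-instance leakage-resilient scheme. -/
structure Scheme where
  pLen : ℕ → ℕ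
  ctLen : ℕ → ℕ
  gen : (k : ℕ) → PMF (BitStr k)
  param : (k : ℕ) → PMF (BitStr (pLen k))
  enc : (k : ℕ) → BitStr k → BitStr (pLen k) → Bool → PMF (BitStr (ctLen k))
  dec : (k : ℕ) → BitStr k → BitStr (pLen k) → BitStr (ctLen k) → Bool

namespace Scheme

variable (M : Scheme)

/-- All algorithms run in polynomial time (decryption deterministically), parameters and
ciphertexts have polynomial length, and decryption is always correct. -/
structure IsValid : Prop where
  pLen_poly : IsPoly M.pLen
  ctLen_poly : IsPoly M.ctLen
  gen_eff : Efficient (ι := fun _ => Unit) (fun k _ => [unary k])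
    fun k _ => (M.gen k).map fun x => List.ofFn x
  param_eff : Efficient (ι := fun _ => Unit) (fun k _ => [unary k])
    fun k _ => (M.param k).map fun p => List.ofFn p
  enc_eff : Efficient (ι := fun k => BitStr k × BitStr (M.pLen k) × Bool)
    (fun _ i => [List.ofFn i.1, List.ofFn i.2.1, [i.2.2]])
    fun k i => (M.enc k i.1 i.2.1 i.2.2).map fun c => List.ofFn c
  dec_eff : DetEfficient (ι := fun k => BitStr k × BitStr (M.pLen k) × BitStr (M.ctLen k))
    (fun _ i => [List.ofFn i.1, List.ofFn i.2.1, List.ofFn i.2.2])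
    fun k i => [M.dec k i.1 i.2.1 i.2.2]
  correct : ∀ k x p m, ∀ c ∈ (M.enc k x p m).support, M.dec k x p c = m

variable {k n : ℕ}

/-- The oracles `E_1(x,p,J,·,·)` (for `b = true`) and `E_0(x,p,J,·,·)` (for `b = false`). The query
`(j, m)` is written as the bit `m` followed by a string of length `j` (the index in unary, counted
from `0`). Both oracles encrypt `m` under the `j`-th key and parameter, except that `E_0`
encrypts `0` if `j` belongs to the set `J` of hidden coordinates. Malformed queries are answered by
the empty string. -/
def oracle (x : Fin n → BitStr k) (p : Fin n → BitStr (M.pLen k)) (J : Finset (Fin n)) (b : Bool) :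
    Oracle
  | [] => PMF.pure []
  | m :: u =>
    if h : u.length < n then
      let j : Fin n := ⟨u.length, h⟩
      (M.enc k (x j) (p j) (if j ∈ J then b && m else m)).map fun c => List.ofFn c
    else PMF.pure []

/-- The output of an adversary, run for `t` steps, that gets the public parameters of `n` instances
and interacts with `E_b(x,p,[n],·,·)`. -/
def multiExperiment (k n : ℕ) (B : Prog) (t : ℕ) (b : Bool) : PMF (List Bool) :=
  (iid (M.gen k) n).bind fun x => (iid (M.param k) n).bind fun p =>
    output (M.oracle x p Finset.univ b) B [unary k, encodeSeq p] t

/-- Multi semantic security. -/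
def MultiSemanticSecure (kind : AdvKind) (Γ : ℕ → ℝ) : Prop :=
  ∀ n : ℕ → ℕ, kind.Count Γ n →
  ∀ (B : ℕ → Prog) (t : ℕ → ℕ), kind.Allows Γ B → PolyIn Γ t →
    (∀ k (p : Fin (n k) → BitStr (M.pLen k)),
      TimeBounded (B k) [unary k, encodeSeq p] (M.ctLen k) (t k)) →
    NegligibleAdvantage Γ fun b k => M.multiExperiment k (n k) (B k) (t k) b

/-- The output of an adversary, run for `t` steps, that gets the leakage `z` computed by `F` from
the keys and the public parameters, and interacts with `E_b(x,p,J,·,·)`, where the set of hidden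
coordinates is chosen by `J`. -/
def leakExperiment {s : ℕ} (F : (Fin n → BitStr k) → PMF (BitStr s))
    (J : (Fin n → BitStr k) → BitStr s → (Fin n → BitStr (M.pLen k)) → PMF (Finset (Fin n)))
    (B : Prog) (t : ℕ) (b : Bool) : PMF (List Bool) :=
  (iid (M.gen k) n).bind fun x => (iid (M.param k) n).bind fun p =>
    (F x).bind fun z => (J x z p).bind fun J' =>
      output (M.oracle x p J' b) B [unary k, List.ofFn z, encodeSeq p] t

/-- Multi-security against a bounded preprocessing adversary. The preprocessing `F` is an arbitrary
randomized function, and the choice of `J` may depend on everything but the adversary `B`. -/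
def PreprocessingSecure (kind : AdvKind) (Γ : ℕ → ℝ) (τ : ℝ → ℝ → ℝ) : Prop :=
  ∀ n : ℕ → ℕ, kind.Count Γ n → ∀ s : ℕ → ℕ, (∀ k, s k ≤ n k * k) →
  ∀ F : (k : ℕ) → (Fin (n k) → BitStr k) → PMF (BitStr (s k)),
  ∃ J : (k : ℕ) → (Fin (n k) → BitStr k) → BitStr (s k) → (Fin (n k) → BitStr (M.pLen k)) →
      PMF (Finset (Fin (n k))),
    (∀ k x z p, ∀ J' ∈ (J k x z p).support,
      (n k : ℝ) - τ (k : ℝ) (s k : ℝ) ≤ (J'.card : ℝ)) ∧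
    ∀ (B : ℕ → Prog) (t : ℕ → ℕ), kind.Allows Γ B → PolyIn Γ t →
      (∀ k (z : BitStr (s k)) (p : Fin (n k) → BitStr (M.pLen k)),
        TimeBounded (B k) [unary k, List.ofFn z, encodeSeq p] (M.ctLen k) (t k)) →
      NegligibleAdvantage Γ fun b k => M.leakExperiment (F k) (J k) (B k) (t k) b

/-- `(Γ, τ)`-security against space bounded preprocessing adversaries of the given kind. -/
def Secure (kind : AdvKind) (Γ : ℕ → ℝ) (τ : ℝ → ℝ → ℝ) : Prop :=
  M.MultiSemanticSecure kind Γ ∧ M.PreprocessingSecure kind Γ τ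

end Scheme

/-! ### The construction -/

/-- The syntax of a family of hash functions from `{0,1}^k` to `{0,1}^(outLen k)`, described by
seeds of `seedLen k` bits. -/
structure HashFamily (outLen : ℕ → ℕ) where
  seedLen : ℕ → ℕ
  hash : (k : ℕ) → BitStr (seedLen k) → BitStr k → BitStr (outLen k)

/-- Random seeds can be drawn and hash values computed in polynomial time, and any two distinct
points collide with probability at most `2^(-outLen k)` over the choice of the seed. -/
structure HashFamily.IsUniversal {outLen : ℕ → ℕ} (H : HashFamily outLen) : Prop where
  seedLen_poly : IsPoly H.seedLen
  sample_eff : Efficient (ι := fun _ => Unit) (fun k _ => [unary k])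
    fun k _ => (uniformBits (H.seedLen k)).map fun g => List.ofFn g
  hash_eff : DetEfficient (ι := fun k => BitStr (H.seedLen k) × BitStr k)
    (fun _ i => [List.ofFn i.1, List.ofFn i.2]) fun k i => List.ofFn (H.hash k i.1 i.2)
  universal : ∀ k (x y : BitStr k), x ≠ y →
    (uniformBits (H.seedLen k)).toOuterMeasure {g | H.hash k g x = H.hash k g y}
      ≤ ((2 : ENNReal) ^ outLen k)⁻¹

/-- The scheme with uniform `λ`-bit keys whose public parameter is a random hash function and which
uses `S` with the key hashed to `λ' = ⌊0.1 λ⌋` bits. -/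
def hashedScheme (S : EncScheme) (H : HashFamily fun k => k / 10) : Scheme where
  pLen := H.seedLen
  ctLen k := S.ctLen (k / 10)
  gen k := uniformBits k
  param k := uniformBits (H.seedLen k)
  enc k x g m := S.enc (k / 10) (H.hash k g x) m
  dec k x g c := S.dec (k / 10) (H.hash k g x) c

end MILR

end

noncomputable section

namespace MILR

theorem bind_congr_support {α β : Type*} (p : PMF α) {f g : α → PMF β}
    (h : ∀ a ∈ p.support, f a = g a) : p.bind f = p.bind g := by
  ext b
  simp only [PMF.bind_apply]
  refine tsum_congr fun a => ?_
  by_cases ha : a ∈ p.support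
  · rw [h a ha]
  · rw [PMF.mem_support_iff, not_not] at ha
    simp [ha]

/-! ### Runs of programs -/

theorem steps_nil (O : Oracle) (t : ℕ) (s : Store) : steps O t ([], s) = PMF.pure ([], s) := by
  induction t with
  | zero => rfl
  | succ t ih => simp [steps, step, ih]

theorem steps_add (O : Oracle) (t t' : ℕ) (c : Config) :
    steps O (t + t') c = (steps O t c).bind (steps O t') := by
  induction t generalizing c with
  | zero => simp [steps]
  | succ t ih =>
    rw [Nat.succ_add_eq_add_succ, Nat.add_succ, steps, steps, PMF.bind_bind]
    congr 1
    funext c'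
    exact ih c'

theorem step_append (O : Oracle) (P : Prog) (K K' : List Prog) (s : Store) :
    step O (P :: K ++ K', s) = (step O (P :: K, s)).map fun c => (c.1 ++ K', c.2) := by
  cases P <;> simp [step, PMF.pure_map, PMF.map_comp, Function.comp_def]
  all_goals split <;> simp

/-- All computations from `c` have halted after `t` steps. -/
def Halts (O : Oracle) (c : Config) (t : ℕ) : Prop := ∀ c' ∈ (steps O t c).support, c'.1 = []

theorem Halts.of_step {O : Oracle} {c : Config} {t : ℕ} (h : Halts O c (t + 1)) {c' : Config}
    (hc : c' ∈ (step O c).support) : Halts O c' t := fun d hd =>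
  h d (by rw [steps, PMF.mem_support_bind_iff]; exact ⟨c', hc, hd⟩)

theorem Halts.steps_add {O : Oracle} {c : Config} {t : ℕ} (h : Halts O c t) (d : ℕ) :
    steps O (t + d) c = steps O t c := by
  rw [MILR.steps_add]
  conv_rhs => rw [← PMF.bind_pure (steps O t c)]
  refine bind_congr_support _ fun c' hc' => ?_
  obtain ⟨K, s⟩ := c'
  obtain rfl : K = [] := h _ hc'
  exact steps_nil O d s

theorem steps_append (O : Oracle) (K' : List Prog) (t' t : ℕ) (K : List Prog) (s : Store)
    (h : Halts O (K, s) t) (h' : ∀ c ∈ (steps O t (K, s)).support, Halts O (K', c.2) t') :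
    steps O (t + t') (K ++ K', s) = (steps O t (K, s)).bind fun c => steps O t' (K', c.2) := by
  induction t generalizing K s with
  | zero =>
    have hK : K = [] := h (K, s) (by simp [steps])
    subst hK
    simp [steps]
  | succ t ih =>
    cases K with
    | nil =>
      rw [steps_nil, PMF.pure_bind, List.nil_append, add_comm, Halts.steps_add]
      exact h' ([], s) (by simp [steps_nil])
    | cons P K =>
      rw [show t + 1 + t' = (t + t') + 1 by omega, steps, step_append, PMF.bind_map, steps,
        PMF.bind_bind]
      refine bind_congr_support _ fun c hc => ?_
      refine ih c.1 c.2 (h.of_step hc) fun d hd => h' d ?_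
      rw [steps, PMF.mem_support_bind_iff]
      exact ⟨c, hc, hd⟩

/-- The programs `K`, started in the store `s`, halt within `t` steps, and the final store has the
distribution `μ`. -/
def Runs (O : Oracle) (K : List Prog) (s : Store) (t : ℕ) (μ : PMF Store) : Prop :=
  steps O t (K, s) = μ.map fun s' => ([], s')

/-- The program `P`, started in the store `s`, halts within `t` steps in the store `s'`. -/
def Exec (O : Oracle) (P : Prog) (s : Store) (t : ℕ) (s' : Store) : Prop :=
  Runs O [P] s t (PMF.pure s')

variable {O : Oracle} {K K' : List Prog} {P Q : Prog} {s s' s'' : Store} {t t' : ℕ}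
  {μ μ' : PMF Store} {α β : Type}

theorem Runs.halts (h : Runs O K s t μ) : Halts O (K, s) t := by
  intro c hc
  rw [h] at hc
  simp only [PMF.mem_support_map_iff] at hc
  obtain ⟨_, _, rfl⟩ := hc
  rfl

theorem Halts.runs (h : Halts O (K, s) t) :
    Runs O K s t ((steps O t (K, s)).map fun c => c.2) := by
  rw [Runs, PMF.map_comp]
  conv_lhs => rw [← PMF.map_id (steps O t (K, s))]
  rw [PMF.map, PMF.map]
  refine bind_congr_support _ fun c hc => ?_
  obtain ⟨K', s'⟩ := c
  obtain rfl : K' = [] := h _ hc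
  rfl

theorem Runs.mono (h : Runs O K s t μ) (ht : t ≤ t') : Runs O K s t' μ := by
  obtain ⟨d, rfl⟩ := Nat.exists_eq_add_of_le ht
  rw [Runs, h.halts.steps_add, h]

theorem Runs.of_eq (h : Runs O K s t μ) (ht : t ≤ t') (hμ : μ = μ') : Runs O K s t' μ' :=
  hμ ▸ h.mono ht

theorem Exec.of_eq (h : Exec O P s t s') (ht : t ≤ t') (hs : s' = s'') : Exec O P s t' s'' :=
  hs ▸ Runs.mono h ht

theorem Runs.nil : Runs O [] s t (PMF.pure s) := by
  rw [Runs, steps_nil, PMF.pure_map]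

theorem Runs.append {ν : PMF α} {f : α → Store} {ξ : α → PMF Store}
    (h : Runs O K s t (ν.map f)) (h' : ∀ a ∈ ν.support, Runs O K' (f a) t' (ξ a)) :
    Runs O (K ++ K') s (t + t') (ν.bind ξ) := by
  have hc : ∀ c ∈ (steps O t (K, s)).support, Halts O (K', c.2) t' := by
    intro c hc
    rw [h, PMF.map_comp, PMF.mem_support_map_iff] at hc
    obtain ⟨a, ha, rfl⟩ := hc
    exact (h' a ha).halts
  rw [Runs, steps_append O K' t' t K s h.halts hc, h, PMF.map_comp, PMF.bind_map, PMF.map_bind]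
  exact bind_congr_support _ fun a ha => h' a ha

theorem Runs.of_step {ν : PMF α} {f : α → List Prog × Store} {ξ : α → PMF Store}
    (h : step O (K, s) = ν.map f) (h' : ∀ a ∈ ν.support, Runs O (f a).1 (f a).2 t (ξ a)) :
    Runs O K s (t + 1) (ν.bind ξ) := by
  rw [Runs, steps, h, PMF.bind_map, PMF.map_bind]
  exact bind_congr_support _ fun a ha => h' a ha

theorem Runs.of_step_pure {c : Config}
    (h : step O (K, s) = PMF.pure c) (h' : Runs O c.1 c.2 t μ) : Runs O K s (t + 1) μ := by
  rw [Runs, steps, h, PMF.pure_bind]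
  exact h'

theorem Exec.skip : Exec O Prog.skip s 1 s := Runs.of_step_pure rfl Runs.nil

theorem Exec.push (r : ℕ) (b : Bool) :
    Exec O (Prog.push r b) s 1 (Function.update s r (b :: s r)) :=
  Runs.of_step_pure rfl Runs.nil

theorem Exec.pop (r : ℕ) : Exec O (Prog.pop r) s 1 (Function.update s r (s r).tail) :=
  Runs.of_step_pure rfl Runs.nil

theorem Runs.coin (r : ℕ) : Runs O [Prog.coin r] s 1
    ((PMF.uniformOfFintype Bool).map fun b => Function.update s r (b :: s r)) := by
  have := Runs.of_step (O := O) (K := [Prog.coin r]) (s := s) (t := 0) (ν := PMF.uniformOfFintype Bool)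
    (f := fun b => ([], Function.update s r (b :: s r))) rfl (fun a _ => Runs.nil)
  exact this

theorem Runs.query (q a : ℕ) : Runs O [Prog.query q a] s 1
    ((O (s q)).map fun c => Function.update s a c) := by
  have := Runs.of_step (O := O) (K := [Prog.query q a]) (s := s) (t := 0) (ν := O (s q))
    (f := fun c => ([], Function.update s a c)) rfl (fun a _ => Runs.nil)
  exact this

theorem Runs.seq {ν : PMF α} {f : α → Store} {ξ : α → PMF Store}
    (h : Runs O [P] s t (ν.map f)) (h' : ∀ a ∈ ν.support, Runs O [Q] (f a) t' (ξ a)) :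
    Runs O [Prog.seq P Q] s (t + t' + 1) (ν.bind ξ) :=
  Runs.of_step_pure rfl (Runs.append h h')

theorem Runs.seq_map {ν : PMF α} {f : α → Store} {g : α → Store}
    (h : Runs O [P] s t (ν.map f)) (h' : ∀ a ∈ ν.support, Exec O Q (f a) t' (g a)) :
    Runs O [Prog.seq P Q] s (t + t' + 1) (ν.map g) :=
  Runs.seq h h'

theorem Exec.seq_runs (h : Exec O P s t s') (h' : Runs O [Q] s' t' μ) :
    Runs O [Prog.seq P Q] s (t + t' + 1) μ := by
  have h1 : Runs O [P] s t ((PMF.pure ()).map fun _ => s') := by rw [PMF.pure_map]; exact h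
  have := Runs.seq (ξ := fun _ => μ) h1 (fun _ _ => h')
  rwa [PMF.pure_bind] at this

theorem Exec.seq (h : Exec O P s t s') (h' : Exec O Q s' t' s'') :
    Exec O (Prog.seq P Q) s (t + t' + 1) s'' := h.seq_runs h'

theorem Runs.branch_nil {r : ℕ} {E : Prog} (hr : s r = []) (h : Runs O [E] s t μ) :
    Runs O [Prog.branch r E P Q] s (t + 1) μ :=
  Runs.of_step_pure (c := ([E], s)) (by simp [step, hr]) h

theorem Runs.branch_false {r : ℕ} {E : Prog} {l : List Bool} (hr : s r = false :: l)
    (h : Runs O [P] s t μ) : Runs O [Prog.branch r E P Q] s (t + 1) μ :=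
  Runs.of_step_pure (c := ([P], s)) (by simp [step, hr]) h

theorem Runs.branch_true {r : ℕ} {E : Prog} {l : List Bool} (hr : s r = true :: l)
    (h : Runs O [Q] s t μ) : Runs O [Prog.branch r E P Q] s (t + 1) μ :=
  Runs.of_step_pure (c := ([Q], s)) (by simp [step, hr]) h

theorem Exec.loop_nil {r : ℕ} (hr : s r = []) : Exec O (Prog.loop r P) s 1 s :=
  Runs.of_step_pure (c := ([], s)) (by simp [step, hr]) Runs.nil

theorem Runs.loop_cons {r : ℕ} {ν : PMF α} {f : α → Store} {ξ : α → PMF Store} (hr : s r ≠ [])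
    (h : Runs O [P] s t (ν.map f))
    (h' : ∀ a ∈ ν.support, Runs O [Prog.loop r P] (f a) t' (ξ a)) :
    Runs O [Prog.loop r P] s (t + t' + 1) (ν.bind ξ) := by
  refine Runs.of_step_pure (c := ([P] ++ [Prog.loop r P], s)) ?_ (Runs.append h h')
  obtain ⟨b, l, hl⟩ := List.exists_cons_of_ne_nil hr
  simp [step, hl]

theorem Exec.loop_cons {r : ℕ} (hr : s r ≠ []) (h : Exec O P s t s')
    (h' : Exec O (Prog.loop r P) s' t' s'') : Exec O (Prog.loop r P) s (t + t' + 1) s'' := by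
  have h1 : Runs O [P] s t ((PMF.pure ()).map fun _ => s') := by rw [PMF.pure_map]; exact h
  have := Runs.loop_cons (ξ := fun _ => PMF.pure s'') hr h1 (fun _ _ => h')
  rwa [PMF.pure_bind] at this

/-- The law of a chain with transition kernels `κ j`, `κ (j + 1)`, … after `d` transitions. -/
def chain (κ : ℕ → α → PMF α) (j : ℕ) : ℕ → α → PMF α
  | 0, a => PMF.pure a
  | d + 1, a => (chain κ j d a).bind (κ (j + d))

theorem chain_succ' (κ : ℕ → α → PMF α) (j d : ℕ) (a : α) :
    chain κ j (d + 1) a = (κ j a).bind (chain κ (j + 1) d) := by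
  induction d generalizing a with
  | zero => simp [chain]
  | succ d ih =>
    rw [chain, ih, PMF.bind_bind]
    congr 1
    funext b
    rw [chain, show j + (d + 1) = j + 1 + d by omega]

theorem Runs.loop_chain {r : ℕ} (m T : ℕ) (f : ℕ → α → Store) (κ : ℕ → α → PMF α)
    (G : ℕ → α → Prop) (hne : ∀ j < m, ∀ a, G j a → f j a r ≠ []) (hend : ∀ a, G m a → f m a r = [])
    (hP : ∀ j < m, ∀ a, G j a → Runs O [P] (f j a) T ((κ j a).map (f (j + 1))))
    (hG : ∀ j < m, ∀ a, G j a → ∀ b ∈ (κ j a).support, G (j + 1) b) (a : α) (ha : G 0 a) :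
    Runs O [Prog.loop r P] (f 0 a) (m * (T + 1) + 1) ((chain κ 0 m a).map (f m)) := by
  have key : ∀ d j, j + d = m → ∀ a, G j a →
      Runs O [Prog.loop r P] (f j a) (d * (T + 1) + 1) ((chain κ j d a).map (f m)) := by
    intro d
    induction d with
    | zero =>
      intro j hj a ha
      obtain rfl : j = m := by omega
      rw [chain, PMF.pure_map]
      exact Runs.mono (Exec.loop_nil (hend a ha)) (by omega)
    | succ d ih =>
      intro j hj a ha
      rw [chain_succ', PMF.map_bind]
      refine Runs.mono (Runs.loop_cons (hne j (by omega) a ha) (hP j (by omega) a ha)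
        fun b hb => ih (j + 1) (by omega) b (hG j (by omega) a ha b hb)) (by ring_nf; omega)
  simpa using key m 0 (by omega) a ha

theorem Exec.loop_iter {r : ℕ} (m T : ℕ) (f : ℕ → Store) (hne : ∀ j < m, f j r ≠ [])
    (hend : f m r = []) (hP : ∀ j < m, Exec O P (f j) T (f (j + 1))) :
    Exec O (Prog.loop r P) (f 0) (m * (T + 1) + 1) (f m) := by
  have key : ∀ d j, j + d = m → Exec O (Prog.loop r P) (f j) (d * (T + 1) + 1) (f m) := by
    intro d
    induction d with
    | zero =>
      intro j hj
      obtain rfl : j = m := by omega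
      exact Runs.mono (Exec.loop_nil hend) (by omega)
    | succ d ih =>
      intro j hj
      exact Runs.mono (Exec.loop_cons (hne j (by omega)) (hP j (by omega)) (ih (j + 1) (by omega)))
        (by ring_nf; omega)
  simpa using key m 0 (by omega)

theorem Exec.loop_fold {r : ℕ} (T : ℕ) (f : List Bool → α → Store) (g : Bool → α → α)
    (hr : ∀ l c, f l c r = l) (hP : ∀ b l c, Exec O P (f (b :: l) c) T (f l (g b c)))
    (l : List Bool) (c : α) :
    Exec O (Prog.loop r P) (f l c) (l.length * (T + 1) + 1)
      (f [] (l.foldl (fun c b => g b c) c)) := by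
  induction l generalizing c with
  | nil => exact Runs.mono (Exec.loop_nil (hr [] c)) (by simp)
  | cons b l ih =>
    exact Runs.mono (Exec.loop_cons (by simp [hr]) (hP b l c) (ih (g b c)))
      (by simp only [List.length_cons]; ring_nf; omega)

/-! ### Algorithms -/

theorem Runs.haltsWithin {inp : List (List Bool)} (h : Runs O [P] (load inp) t μ) :
    HaltsWithin O P inp t := h.halts

theorem Runs.output_eq {inp : List (List Bool)} (h : Runs O [P] (load inp) t μ) :
    output O P inp t = μ.map fun s => s 0 := by
  rw [output, h, PMF.map_comp]
  rfl

end MILR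

end

noncomputable section

namespace MILR

/-! ### Renaming stacks and replacing oracle queries by subroutines -/

/-- Renames the stacks by `ρ` and replaces the query with question on `q` and answer on `a` by the
program `Q q a`. -/
def Prog.compile (ρ : ℕ → ℕ) (Q : ℕ → ℕ → Prog) : Prog → Prog
  | Prog.skip => Prog.skip
  | Prog.push r b => Prog.push (ρ r) b
  | Prog.pop r => Prog.pop (ρ r)
  | Prog.coin r => Prog.coin (ρ r)
  | Prog.query q a => Q q a
  | Prog.seq P P' => Prog.seq (P.compile ρ Q) (P'.compile ρ Q)
  | Prog.branch r E P P' => Prog.branch (ρ r) (E.compile ρ Q) (P.compile ρ Q) (P'.compile ρ Q)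
  | Prog.loop r P => Prog.loop (ρ r) (P.compile ρ Q)

/-- `emb` embeds a store in a larger one, whose stack `ρ r` is the stack `r` of the embedded one. -/
structure IsLens (ρ : ℕ → ℕ) (emb : Store → Store) : Prop where
  get : ∀ σ r, emb σ (ρ r) = σ r
  set : ∀ σ r v, Function.update (emb σ) (ρ r) v = emb (Function.update σ r v)

variable {ρ : ℕ → ℕ} {emb : Store → Store} {Q : ℕ → ℕ → Prog} {O O' : Oracle}

theorem queryFree_of_mem_step {K : List Prog} {s : Store} (hK : ∀ P ∈ K, P.QueryFree) {c : Config}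
    (hc : c ∈ (step O (K, s)).support) : ∀ P ∈ c.1, P.QueryFree := by
  cases K with
  | nil => simp only [step, PMF.support_pure, Set.mem_singleton_iff] at hc; subst hc; exact hK
  | cons P K =>
    have h1 := hK P (by simp)
    have h2 : ∀ P ∈ K, P.QueryFree := fun P hP => hK P (by simp [hP])
    cases P <;> simp only [step, PMF.support_pure, Set.mem_singleton_iff,
      PMF.mem_support_map_iff] at hc
    case branch => subst hc; simp only [Prog.QueryFree] at h1; split <;> simpa [h1] using h2
    case loop => 
      subst hc
      split
      · simpa using h2
      · simpa [h1] using ⟨by simpa [Prog.QueryFree] using h1, h2⟩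
    case seq => subst hc; simp only [Prog.QueryFree] at h1; simpa [h1] using h2
    all_goals first
      | (subst hc; exact h2)
      | (obtain ⟨_, _, rfl⟩ := hc; exact h2)

theorem step_compile (hl : IsLens ρ emb) {P : Prog} {K : List Prog} {σ : Store}
    (hP : ∀ q a, P ≠ Prog.query q a) :
    step O ((P :: K).map (Prog.compile ρ Q), emb σ) =
      (step O' (P :: K, σ)).map fun c => (c.1.map (Prog.compile ρ Q), emb c.2) := by
  cases P
  case query q a => exact absurd rfl (hP q a)
  all_goals simp only [List.map_cons, Prog.compile, step, PMF.pure_map, PMF.map_comp,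
      Function.comp_def, hl.set, hl.get]
  all_goals split <;> rfl

theorem steps_compile_of_queryFree (hl : IsLens ρ emb) (t : ℕ) (K : List Prog) (σ : Store)
    (hK : ∀ P ∈ K, P.QueryFree) :
    steps O t (K.map (Prog.compile ρ Q), emb σ) =
      (steps O' t (K, σ)).map fun c => (c.1.map (Prog.compile ρ Q), emb c.2) := by
  induction t generalizing K σ with
  | zero => simp [steps, PMF.pure_map]
  | succ t ih =>
    cases K with
    | nil => simp [steps_nil, PMF.pure_map]
    | cons P K =>
      rw [steps, step_compile (O' := O') hl, PMF.bind_map, steps, PMF.map_bind]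
      · exact bind_congr_support _ fun c hc => ih c.1 c.2 (queryFree_of_mem_step hK hc)
      · rintro q a rfl
        exact hK (Prog.query q a) (by simp)

theorem length_of_mem_step {l : ℕ} (hO : ∀ q, ∀ c ∈ (O q).support, c.length ≤ l) {c c' : Config}
    (hc : c' ∈ (step O c).support) (r : ℕ) : (c'.2 r).length ≤ (c.2 r).length + (l + 1) := by
  obtain ⟨K, s⟩ := c
  have upd : ∀ (r' : ℕ) (w : List Bool), (w.length ≤ (s r').length + (l + 1)) →
      (Function.update s r' w r).length ≤ (s r).length + (l + 1) := by
    intro r' w hw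
    by_cases h : r = r'
    · subst h; simpa using hw
    · rw [Function.update_of_ne h]; omega
  cases K with
  | nil => simp only [step, PMF.support_pure, Set.mem_singleton_iff] at hc; subst hc; simp
  | cons P K =>
    cases P <;> simp only [step, PMF.support_pure, Set.mem_singleton_iff,
      PMF.mem_support_map_iff] at hc
    case query q a =>
      obtain ⟨w, hw, rfl⟩ := hc
      exact upd _ _ (by have := hO _ w hw; omega)
    case branch => subst hc; split <;> simp
    case loop => subst hc; split <;> simp
    case push => subst hc; exact upd _ _ (by simp)
    case pop => subst hc; exact upd _ _ (by simp; omega)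
    case coin => obtain ⟨w, hw, rfl⟩ := hc; exact upd _ _ (by simp)
    all_goals subst hc; simp

theorem Runs.compile (hl : IsLens ρ emb) {l L T : ℕ} (hT : 1 ≤ T)
    (hO' : ∀ q, ∀ c ∈ (O' q).support, c.length ≤ l)
    (hQ : ∀ σ q a, (∀ r, (σ r).length ≤ L) →
      Runs O [Q q a] (emb σ) T ((O' (σ q)).map fun c => emb (Function.update σ a c)))
    (t : ℕ) (K : List Prog) (σ : Store) (hσ : ∀ r, (σ r).length + t * (l + 1) ≤ L)
    (h : Halts O' (K, σ) t) :
    Runs O (K.map (Prog.compile ρ Q)) (emb σ) (t * T)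
      ((steps O' t (K, σ)).map fun c => emb c.2) := by
  induction t generalizing K σ with
  | zero =>
    obtain rfl : K = [] := h (K, σ) (by simp [steps])
    simpa [steps, PMF.pure_map] using Runs.nil
  | succ t ih =>
    have hσ' : ∀ c ∈ (step O' (K, σ)).support, ∀ r, (c.2 r).length + t * (l + 1) ≤ L := by
      intro c hc r
      have h1 := length_of_mem_step hO' hc r
      have h2 := hσ r
      simp only at h1
      have : (t + 1) * (l + 1) = t * (l + 1) + (l + 1) := by ring
      omega
    cases K with
    | nil =>
      rw [steps_nil, PMF.pure_map]
      exact Runs.nil.mono (Nat.zero_le _)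
    | cons P K =>
      rw [steps, PMF.map_bind]
      by_cases hP : ∃ q a, P = Prog.query q a
      · obtain ⟨q, a, rfl⟩ := hP
        have hs : step O' (Prog.query q a :: K, σ) =
          (O' (σ q)).map fun c => (K, Function.update σ a c) := rfl
        have key := Runs.append (K' := K.map (Prog.compile ρ Q)) (t' := t * T)
          (hQ σ q a fun r => (Nat.le_add_right _ _).trans (hσ r))
          (fun c hc => ih K (Function.update σ a c)
            (hσ' (K, Function.update σ a c) (by
              rw [hs, PMF.mem_support_map_iff]; exact ⟨c, hc, rfl⟩))
            (h.of_step (by rw [hs, PMF.mem_support_map_iff]; exact ⟨c, hc, rfl⟩)))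
        refine key.of_eq (by ring_nf; omega) ?_
        rw [hs, PMF.bind_map]
        rfl
      · push Not at hP
        have key := Runs.of_step (ν := step O' (P :: K, σ))
          (f := fun c => (c.1.map (Prog.compile ρ Q), emb c.2))
          (ξ := fun c => (steps O' t c).map fun c => emb c.2) (t := t * T)
          (step_compile hl hP) fun c hc => ih c.1 c.2 (hσ' c hc) (h.of_step hc)
        exact key.mono (by rw [Nat.add_mul]; omega)

theorem support_steps_of_size_le {N t : ℕ} {K : List Prog} {s : Store}
    (hK : ∀ P ∈ K, P.size ≤ N) (hq : ∀ P ∈ K, P.QueryFree) {c : Config}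
    (hc : c ∈ (steps O t (K, s)).support) {r : ℕ} (hr : N ≤ r) : c.2 r = s r := by
  induction t generalizing K s with
  | zero => simp only [steps, PMF.support_pure, Set.mem_singleton_iff] at hc; rw [hc]
  | succ t ih =>
    rw [steps, PMF.mem_support_bind_iff] at hc
    obtain ⟨d, hd, hc⟩ := hc
    have hdq := queryFree_of_mem_step hq hd
    suffices h : (∀ P ∈ d.1, P.size ≤ N) ∧ d.2 r = s r by
      rw [ih h.1 hdq hc, h.2]
    cases K with
    | nil => simp only [step, PMF.support_pure, Set.mem_singleton_iff] at hd; subst hd; simp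
    | cons P K =>
      have h1 := hK P (by simp)
      have h2 : ∀ P ∈ K, P.size ≤ N := fun P hP => hK P (by simp [hP])
      cases P <;> simp only [step, PMF.support_pure, Set.mem_singleton_iff,
        PMF.mem_support_map_iff] at hd <;> simp only [Prog.size] at h1
      case query q a => exact (hq (Prog.query q a) (by simp)).elim
      case branch => 
        subst hd
        split <;> refine ⟨fun P hP => ?_, rfl⟩ <;> rcases List.mem_cons.1 hP with rfl | hP <;>
          first | exact h2 _ hP | omega
      case loop r' P =>
        subst hd
        split
        · exact ⟨h2, rfl⟩
        · refine ⟨fun P' hP => ?_, rfl⟩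
          rcases List.mem_cons.1 hP with rfl | hP
          · omega
          rcases List.mem_cons.1 hP with rfl | hP
          · simpa [Prog.size] using h1
          · exact h2 _ hP
      case seq P P' =>
        subst hd
        refine ⟨fun P'' hP => ?_, rfl⟩
        rcases List.mem_cons.1 hP with rfl | hP
        · omega
        rcases List.mem_cons.1 hP with rfl | hP
        · omega
        · exact h2 _ hP
      case skip => subst hd; exact ⟨h2, rfl⟩
      case coin =>
        obtain ⟨_, _, rfl⟩ := hd
        exact ⟨h2, Function.update_of_ne (by omega) _ _⟩
      all_goals subst hd; exact ⟨h2, Function.update_of_ne (by omega) _ _⟩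

theorem length_of_mem_steps {l t : ℕ} (hO : ∀ q, ∀ c ∈ (O q).support, c.length ≤ l) {c c' : Config}
    (hc : c' ∈ (steps O t c).support) (r : ℕ) :
    (c'.2 r).length ≤ (c.2 r).length + t * (l + 1) := by
  induction t generalizing c with
  | zero => simp only [steps, PMF.support_pure, Set.mem_singleton_iff] at hc; rw [hc]; omega
  | succ t ih =>
    rw [steps, PMF.mem_support_bind_iff] at hc
    obtain ⟨d, hd, hc⟩ := hc
    have h1 := ih hc
    have h2 := length_of_mem_step hO hd r
    have : (t + 1) * (l + 1) = t * (l + 1) + (l + 1) := by ring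
    omega

/-! ### Basic routines -/

open Prog

variable {s : Store}

/-- Empties the stack `a`. -/
def clear (a : ℕ) : Prog := loop a (pop a)

theorem exec_clear (a : ℕ) :
    Exec O (clear a) s (2 * (s a).length + 1) (Function.update s a []) := by
  have := Exec.loop_fold (O := O) (r := a) (P := pop a) 1
    (fun l (_ : Unit) => Function.update s a l) (fun _ c => c) (by simp)
    (fun b l c => (Exec.pop a).of_eq le_rfl (by simp)) (s a) ()
  simp only [Function.update_eq_self] at this
  exact this.of_eq (by ring_nf; omega) rfl

/-- Moves the letters of the stack `a` one by one to the stack `b`. -/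
def move (a b : ℕ) : Prog :=
  loop a (branch a skip (seq (pop a) (push b false)) (seq (pop a) (push b true)))

theorem exec_move {a b : ℕ} (hab : a ≠ b) : Exec O (move a b) s (5 * (s a).length + 1)
    (Function.update (Function.update s b ((s a).reverse ++ s b)) a []) := by
  have := Exec.loop_fold (O := O) (r := a)
    (P := branch a skip (seq (pop a) (push b false)) (seq (pop a) (push b true))) 4
    (fun l (w : List Bool) => Function.update (Function.update s b w) a l) (fun b w => b :: w)
    (by simp)
    (fun c l w => by
      have hs : ∀ x, Function.update (Function.update (Function.update s b w) a l) b x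
        = Function.update (Function.update s b x) a l := fun x => by
          rw [Function.update_comm hab.symm, Function.update_idem, Function.update_comm hab.symm]
      cases c
      · refine Runs.branch_false (l := l) (by simp) ((Exec.pop a).seq (Exec.push b false)
          |>.of_eq le_rfl ?_)
        simp [hab.symm, hs]
      · refine Runs.branch_true (l := l) (by simp) ((Exec.pop a).seq (Exec.push b true)
          |>.of_eq le_rfl ?_)
        simp [hab.symm, hs]) (s a) (s b)
  simp only [Function.update_eq_self] at this
  refine this.of_eq (by ring_nf; omega) ?_
  simp

/-- Moves the content of the stack `a` to the top of the stack `b`, with the help of the empty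
stack `t`. -/
def transfer (a b t : ℕ) : Prog := seq (move a t) (move t b)

theorem exec_transfer {a b t : ℕ} (hab : a ≠ b) (hat : a ≠ t) (hbt : b ≠ t) (ht : s t = []) :
    Exec O (transfer a b t) s (10 * (s a).length + 3)
      (Function.update (Function.update s b (s a ++ s b)) a []) := by
  refine ((exec_move hat).seq (exec_move hbt.symm)).of_eq ?_ ?_
  · simp [ht, hat.symm]; omega
  · funext r
    simp only [Function.update_apply]
    split_ifs <;> simp_all

/-- Copies the content of the stack `a` to the top of the stack `b`, with the help of the empty
stack `t`. -/
def copy (a b t : ℕ) : Prog :=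
  seq (move a t) (loop t (branch t skip
    (seq (pop t) (seq (push a false) (push b false)))
    (seq (pop t) (seq (push a true) (push b true)))))

theorem exec_copy {a b t : ℕ} (hab : a ≠ b) (hat : a ≠ t) (hbt : b ≠ t) (ht : s t = []) :
    Exec O (copy a b t) s (12 * (s a).length + 3) (Function.update s b (s a ++ s b)) := by
  have := Exec.loop_fold (O := O) (r := t)
    (P := branch t skip (seq (pop t) (seq (push a false) (push b false)))
      (seq (pop t) (seq (push a true) (push b true)))) 6
    (fun l (w : List Bool × List Bool) =>
      Function.update (Function.update (Function.update s b w.2) a w.1) t l)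
    (fun b w => (b :: w.1, b :: w.2))
    (by simp)
    (fun c l w => by
      cases c
      · refine Runs.branch_false (l := l) (by simp) ((Exec.pop t).seq ((Exec.push a false).seq
          (Exec.push b false)) |>.of_eq le_rfl ?_)
        funext r
        simp only [Function.update_apply]
        split_ifs <;> simp_all
      · refine Runs.branch_true (l := l) (by simp) ((Exec.pop t).seq ((Exec.push a true).seq
          (Exec.push b true)) |>.of_eq le_rfl ?_)
        funext r
        simp only [Function.update_apply]
        split_ifs <;> simp_all) (s a).reverse ([], s b)
  have h2 : ∀ (l : List Bool) (w : List Bool × List Bool),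
      l.reverse.foldl (fun c b => (b :: c.1, b :: c.2)) w = (l ++ w.1, l ++ w.2) := by
    intro l w
    induction l with
    | nil => rfl
    | cons b l ih => simp [List.foldl_append, ih]
  rw [h2] at this
  have hs : Function.update (Function.update (Function.update s b (s b)) a []) t (s a).reverse =
      Function.update (Function.update s t ((s a).reverse ++ s t)) a [] := by
    funext r
    simp only [Function.update_apply]
    split_ifs <;> simp_all
  rw [hs] at this
  refine ((exec_move hat).seq this).of_eq ?_ ?_
  · simp; omega
  · funext r
    simp only [Function.update_apply]
    split_ifs <;> simp_all

end MILR

end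

noncomputable section

namespace MILR

open Prog

variable {O : Oracle} {s : Store}

/-! ### Self-delimiting strings -/

/-- The self-delimiting encoding of one string. -/
def encodeStr (w : List Bool) : List Bool := (w.flatMap fun b => [true, b]) ++ [false]

theorem encodeStr_cons (b : Bool) (w : List Bool) :
    encodeStr (b :: w) = true :: b :: encodeStr w := rfl

theorem length_encodeStr (w : List Bool) : (encodeStr w).length = 2 * w.length + 1 := by
  induction w with
  | nil => rfl
  | cons b w ih => simp [encodeStr_cons, ih]; ring

theorem encodeSeq_eq {n l : ℕ} (p : Fin n → BitStr l) :
    encodeSeq p = (List.ofFn p).flatMap fun w => encodeStr (List.ofFn w) := rfl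

/-- Decodes the string at the top of the stack `a` and moves it letter by letter to the stack `b`,
with the help of the empty stack `t`. -/
def readStr (a b t : ℕ) : Prog :=
  seq (push t true) (loop t (branch a (pop t) (seq (pop a) (pop t)) (seq (pop a)
    (branch a skip (seq (pop a) (push b false)) (seq (pop a) (push b true))))))

theorem exec_readStr {a b t : ℕ} (hab : a ≠ b) (hat : a ≠ t) (hbt : b ≠ t) (ht : s t = [])
    {w v : List Bool} (ha : s a = encodeStr w ++ v) :
    Exec O (readStr a b t) s (8 * w.length + 8)
      (Function.update (Function.update s b (w.reverse ++ s b)) a v) := by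
  have key : ∀ (w : List Bool) (s : Store), s a = encodeStr w ++ v → s t = [true] →
      Exec O (loop t (branch a (pop t) (seq (pop a) (pop t)) (seq (pop a)
        (branch a skip (seq (pop a) (push b false)) (seq (pop a) (push b true))))))
        s (8 * w.length + 6) (Function.update (Function.update (Function.update s b
          (w.reverse ++ s b)) a v) t []) := by
    intro w
    induction w with
    | nil =>
      intro s ha ht
      refine (Exec.loop_cons (by simp [ht]) (Runs.branch_false (l := v) (by simp [ha, encodeStr])
        ((Exec.pop a).seq (Exec.pop t))) (Exec.loop_nil (by simp [ht, hat.symm]))).of_eq (by simp) ?_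
      funext r
      simp only [Function.update_apply]
      split_ifs <;> simp_all [encodeStr]
    | cons c w ih =>
      intro s ha ht
      rw [encodeStr_cons] at ha
      have h1 : Exec O (branch a (pop t) (seq (pop a) (pop t)) (seq (pop a)
          (branch a skip (seq (pop a) (push b false)) (seq (pop a) (push b true))))) s 7
          (Function.update (Function.update s b (c :: s b)) a (encodeStr w ++ v)) := by
        refine Runs.branch_true (t := 6) (l := c :: (encodeStr w ++ v)) (by simp [ha]) ?_
        cases c
        · refine ((Exec.pop a).seq (Runs.branch_false (l := encodeStr w ++ v) (by simp [ha])
            ((Exec.pop a).seq (Exec.push b false)))).of_eq le_rfl ?_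
          funext r
          simp only [Function.update_apply]
          split_ifs <;> simp_all
        · refine ((Exec.pop a).seq (Runs.branch_true (l := encodeStr w ++ v) (by simp [ha])
            ((Exec.pop a).seq (Exec.push b true)))).of_eq le_rfl ?_
          funext r
          simp only [Function.update_apply]
          split_ifs <;> simp_all
      refine (Exec.loop_cons (by simp [ht]) h1 (ih _ (by simp) (by simp [hat.symm, hbt.symm,
        ht]))).of_eq (by simp; omega) ?_
      funext r
      simp only [Function.update_apply]
      split_ifs <;> simp_all
  refine ((Exec.push t true).seq (key w _ (by simp [hat, ha]) (by simp [ht]))).of_eq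
    (by omega) ?_
  funext r
  simp only [Function.update_apply]
  split_ifs <;> simp_all

theorem exec_readStr_nil {a b t : ℕ} (hat : a ≠ t) (ht : s t = [])
    (ha : s a = []) : Exec O (readStr a b t) s 6 s := by
  refine ((Exec.push t true).seq (Exec.loop_cons (by simp) (Runs.branch_nil (by simp [ha, hat])
    (Exec.pop t)) (Exec.loop_nil (by simp [ht])))).of_eq (by simp) ?_
  simp

/-- Encodes the reversal of the content of the stack `a` and pushes the encoding on the stack
`b`. -/
def writeStr (a b : ℕ) : Prog :=
  seq (push b false) (loop a (branch a skip
    (seq (pop a) (seq (push b false) (push b true)))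
    (seq (pop a) (seq (push b true) (push b true)))))

theorem exec_writeStr {a b : ℕ} (hab : a ≠ b) :
    Exec O (writeStr a b) s (7 * (s a).length + 3)
      (Function.update (Function.update s b (encodeStr (s a).reverse ++ s b)) a []) := by
  have := Exec.loop_fold (O := O) (r := a)
    (P := branch a skip (seq (pop a) (seq (push b false) (push b true)))
      (seq (pop a) (seq (push b true) (push b true)))) 6
    (fun l (w : List Bool) =>
      Function.update (Function.update s b w) a l)
    (fun c w => true :: c :: w)
    (by simp)
    (fun c l w => by
      cases c
      · refine Runs.branch_false (l := l) (by simp) ((Exec.pop a).seq ((Exec.push b false).seq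
          (Exec.push b true)) |>.of_eq le_rfl ?_)
        funext r
        simp only [Function.update_apply]
        split_ifs <;> simp_all
      · refine Runs.branch_true (l := l) (by simp) ((Exec.pop a).seq ((Exec.push b true).seq
          (Exec.push b true)) |>.of_eq le_rfl ?_)
        funext r
        simp only [Function.update_apply]
        split_ifs <;> simp_all) (s a) (false :: s b)
  have h2 : ∀ (l v : List Bool), l.foldl (fun w c => true :: c :: w) (false :: v) =
      encodeStr l.reverse ++ v := by
    intro l v
    induction l using List.reverseRecOn with
    | nil => rfl
    | append_singleton l b ih => simp [List.foldl_append, ih, encodeStr_cons]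
  rw [h2] at this
  have hs : Function.update (Function.update s b (false :: s b)) a (s a) =
      Function.update s b (false :: s b) := by
    funext r
    simp only [Function.update_apply]
    split_ifs <;> simp_all
  rw [hs] at this
  exact ((Exec.push b false).seq this).of_eq (by ring_nf; omega) rfl

/-! ### Three disjoint zones of stacks -/

/-- The `r`-th stack of the first zone. -/
def bS (r : ℕ) : ℕ := 3 * r

/-- The `r`-th stack of the second zone. -/
def eS (r : ℕ) : ℕ := 3 * r + 1

/-- The `r`-th stack of the third zone. -/
def wS (r : ℕ) : ℕ := 3 * r + 2

/-- The store whose zones have the contents `B`, `E` and `W`. -/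
def zones (B E W : Store) : Store := fun r =>
  if r % 3 = 0 then B (r / 3) else if r % 3 = 1 then E (r / 3) else W (r / 3)

variable {B E W : Store} {r r' : ℕ} {v : List Bool}

@[simp] theorem zones_bS : zones B E W (bS r) = B r := by
  simp [zones, bS]

@[simp] theorem zones_eS : zones B E W (eS r) = E r := by
  have h1 : (3 * r + 1) % 3 = 1 := by omega
  have h2 : (3 * r + 1) / 3 = r := by omega
  simp [zones, eS, h1, h2]

@[simp] theorem zones_wS : zones B E W (wS r) = W r := by
  have h1 : (3 * r + 2) % 3 = 2 := by omega
  have h2 : (3 * r + 2) / 3 = r := by omega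
  simp [zones, wS, h1, h2]

theorem zones_cases (r : ℕ) : ∃ i, r = bS i ∨ r = eS i ∨ r = wS i :=
  ⟨r / 3, by simp only [bS, eS, wS]; omega⟩

@[simp] theorem bS_inj : bS r = bS r' ↔ r = r' := by simp only [bS]; omega
@[simp] theorem eS_inj : eS r = eS r' ↔ r = r' := by simp only [eS]; omega
@[simp] theorem wS_inj : wS r = wS r' ↔ r = r' := by simp only [wS]; omega
@[simp] theorem bS_ne_eS : bS r ≠ eS r' := by simp only [bS, eS]; omega
@[simp] theorem bS_ne_wS : bS r ≠ wS r' := by simp only [bS, wS]; omega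
@[simp] theorem eS_ne_wS : eS r ≠ wS r' := by simp only [wS, eS]; omega
@[simp] theorem eS_ne_bS : eS r ≠ bS r' := bS_ne_eS.symm
@[simp] theorem wS_ne_bS : wS r ≠ bS r' := bS_ne_wS.symm
@[simp] theorem wS_ne_eS : wS r ≠ eS r' := eS_ne_wS.symm

@[simp] theorem update_zones_bS :
    Function.update (zones B E W) (bS r) v = zones (Function.update B r v) E W := by
  funext i
  obtain ⟨i, rfl | rfl | rfl⟩ := zones_cases i <;> simp [Function.update_apply]

@[simp] theorem update_zones_eS :
    Function.update (zones B E W) (eS r) v = zones B (Function.update E r v) W := by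
  funext i
  obtain ⟨i, rfl | rfl | rfl⟩ := zones_cases i <;> simp [Function.update_apply]

@[simp] theorem update_zones_wS :
    Function.update (zones B E W) (wS r) v = zones B E (Function.update W r v) := by
  funext i
  obtain ⟨i, rfl | rfl | rfl⟩ := zones_cases i <;> simp [Function.update_apply]

theorem isLens_bS : IsLens bS fun σ => zones σ E W := ⟨by simp, by simp⟩

theorem isLens_eS : IsLens eS fun σ => zones B σ W := ⟨by simp, by simp⟩

theorem load_eq_zones (a b c : List Bool) : load [a, b, c] = zones (load [a]) (load [b]) (load [c]) := by
  funext i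
  have h3 : ∀ i, load [a, b, c] (i + 1 + 1 + 1) = [] := fun i => rfl
  have h1 : ∀ w i, load [w] (i + 1) = [] := fun w i => rfl
  obtain ⟨i, rfl | rfl | rfl⟩ := zones_cases i <;> rcases i with _ | i
  · rw [zones_bS]; rfl
  · rw [zones_bS, h1, show bS (i + 1) = bS i + 1 + 1 + 1 by simp only [bS]; ring, h3]
  · rw [zones_eS]; rfl
  · rw [zones_eS, h1, show eS (i + 1) = eS i + 1 + 1 + 1 by simp only [eS]; ring, h3]
  · rw [zones_wS]; rfl
  · rw [zones_wS, h1, show wS (i + 1) = wS i + 1 + 1 + 1 by simp only [wS]; ring, h3]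

theorem update_load {l : List (List Bool)} (h : r < l.length) :
    Function.update (load l) r v = load (l.set r v) := by
  funext i
  by_cases hi : i = r
  · subst hi; simp [load, h]
  · simp [load, hi, Ne.symm hi, List.getD]

@[simp] theorem load_zero (a : List Bool) (l : List (List Bool)) : load (a :: l) 0 = a := rfl

@[simp] theorem load_succ (a : List Bool) (l : List (List Bool)) (i : ℕ) :
    load (a :: l) (i + 1) = load l i := rfl

@[simp] theorem load_nil (i : ℕ) : load [] i = [] := rfl

theorem load_append_nil (l : List (List Bool)) : load (l ++ [[]]) = load l := by
  funext i
  induction l generalizing i with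
  | nil => rcases i with _ | i <;> rfl
  | cons a l ih => rcases i with _ | i <;> [rfl; exact ih i]

theorem length_load_le {l : List (List Bool)} {L : ℕ} (h : ∀ w ∈ l, w.length ≤ L) (i : ℕ) :
    (load l i).length ≤ L := by
  by_cases hi : i < l.length
  · simpa [load, hi, List.getD] using h _ (List.getElem_mem hi)
  · simp [load, List.getD, List.getElem?_eq_none (not_lt.1 hi)]

/-! ### Calling an algorithm in the second zone -/

/-- Empties the stacks `1`, …, `n` of the second zone. -/
def clearRange : ℕ → Prog
  | 0 => skip
  | n + 1 => seq (clear (eS (n + 1))) (clearRange n)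

theorem exec_clearRange {L : ℕ} (hL : ∀ r, (E r).length ≤ L) (n : ℕ) :
    Exec O (clearRange n) (zones B E W) (n * (2 * L + 2) + 1)
      (zones B (fun r => if 1 ≤ r ∧ r ≤ n then [] else E r) W) := by
  induction n generalizing E with
  | zero =>
    refine Exec.skip.of_eq (by omega) ?_
    congr 1
    funext r
    rw [if_neg (by omega)]
  | succ n ih =>
    have h1 := exec_clear (O := O) (s := zones B E W) (eS (n + 1))
    rw [update_zones_eS, zones_eS] at h1
    refine (h1.seq (ih (E := Function.update E (n + 1) []) fun r => ?_)).of_eq ?_ ?_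
    · by_cases hr : r = n + 1
      · subst hr; simp
      · simpa [hr] using hL r
    · have := hL (n + 1)
      ring_nf
      ring_nf at this
      omega
    · congr 1
      funext r
      simp only [Function.update_apply]
      split_ifs <;> first | rfl | omega

/-- Runs `P` in the second zone and leaves nothing but its output there. -/
def call (P : Prog) : Prog := seq (P.compile eS fun _ _ => skip) (clearRange (P.size + 3))

/-- A bound for the number of steps of a call of `P`, when `P` halts within `t` steps and its inputs
have length at most `L`. -/
def callTime (P : Prog) (L t : ℕ) : ℕ := t + (P.size + 3) * (2 * (L + t) + 2) + 2

theorem runs_call {P : Prog} (hP : P.QueryFree) {inp : List (List Bool)} {t L : ℕ}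
    (hh : HaltsWithin noOracle P inp t) (hinp : inp.length ≤ 3) (hL : ∀ w ∈ inp, w.length ≤ L) :
    Runs O [call P] (zones B (load inp) W) (callTime P L t)
      ((output noOracle P inp t).map fun w => zones B (load [w, []]) W) := by
  have hs : steps O t ([P.compile eS fun _ _ => skip], zones B (load inp) W) = _ :=
    steps_compile_of_queryFree (O := O) (O' := noOracle) (Q := fun _ _ => skip)
      (isLens_eS (B := B) (W := W)) t [P] (load inp) (by simpa using hP)
  have h1 : Runs O [P.compile eS fun _ _ => skip] (zones B (load inp) W) t
      ((steps noOracle t ([P], load inp)).map fun c => zones B c.2 W) := by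
    rw [Runs, hs, PMF.map_comp, PMF.map, PMF.map]
    refine bind_congr_support _ fun c hc => ?_
    obtain ⟨K, s⟩ := c
    obtain rfl : K = [] := hh _ hc
    rfl
  rw [output, PMF.map_comp]
  refine Runs.of_eq (Runs.seq_map h1 (g := fun c => zones B (load [c.2 0, []]) W)
    (t' := (P.size + 3) * (2 * (L + t) + 2) + 1) (fun c hc => ?_)) ?_ rfl
  · refine (exec_clearRange (L := L + t) (fun r => ?_) (P.size + 3)).of_eq le_rfl ?_
    · have h2 := length_of_mem_steps (l := 0) (O := noOracle) (by simp [noOracle]) hc r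
      have h3 := length_load_le hL r
      simp only [zero_add, mul_one] at h2
      omega
    · congr 1
      funext r
      rcases Nat.eq_zero_or_pos r with rfl | hr
      · simp
      · obtain ⟨r, rfl⟩ := Nat.exists_eq_add_of_lt hr
        have h0 : load [c.2 0, []] (0 + r + 1) = [] := by
          rw [show load [c.2 0, []] = load ([c.2 0] ++ [[]]) from rfl, load_append_nil]
          rfl
        rw [h0]
        split_ifs with hr'
        · rfl
        · rw [support_steps_of_size_le (N := P.size) (by simp) (by simpa using hP) hc (by omega)]
          have : inp.length ≤ 0 + r + 1 := by omega
          rw [load, List.getD, List.getElem?_eq_none this]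
          rfl
  · simp only [callTime]
    omega

end MILR

end

noncomputable section

namespace MILR

/-! ### Polynomial bounds and negligible functions -/

variable {Γ : ℕ → ℝ} {f g : ℕ → ℕ}

theorem PolyIn.of_le_pow (c : ℕ) (h : ∀ᶠ k in atTop, (f k : ℝ) ≤ Γ k ^ c) : PolyIn Γ f := by
  refine ⟨c, IsBigO.of_bound 1 ?_⟩
  filter_upwards [h] with k hk
  rw [Real.norm_of_nonneg (by positivity), one_mul]
  exact hk.trans (le_abs_self _)

theorem PolyIn.exists_le_pow (hΓ : Tendsto Γ atTop atTop) (h : PolyIn Γ f) :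
    ∃ c : ℕ, ∀ᶠ k in atTop, (f k : ℝ) ≤ Γ k ^ c := by
  obtain ⟨c, hc⟩ := h
  obtain ⟨C, hC⟩ := hc.bound
  refine ⟨c + 1, ?_⟩
  filter_upwards [hC, hΓ.eventually_ge_atTop C, hΓ.eventually_ge_atTop 0] with k h1 h2 h3
  rw [Real.norm_of_nonneg (by positivity), Real.norm_of_nonneg (by positivity)] at h1
  rw [pow_succ, mul_comm]
  exact h1.trans (mul_le_mul_of_nonneg_right h2 (by positivity))

theorem PolyIn.mono (hg : PolyIn Γ g) (h : ∀ k, f k ≤ g k) : PolyIn Γ f := by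
  obtain ⟨c, hc⟩ := hg
  refine ⟨c, IsBigO.trans (IsBigO.of_bound 1 (Eventually.of_forall fun k => ?_)) hc⟩
  simpa using h k

theorem PolyIn.const (hΓ : Tendsto Γ atTop atTop) (n : ℕ) : PolyIn Γ fun _ => n :=
  .of_le_pow 1 (by simpa using hΓ.eventually_ge_atTop (n : ℝ))

theorem PolyIn.add (hΓ : Tendsto Γ atTop atTop) (hf : PolyIn Γ f) (hg : PolyIn Γ g) :
    PolyIn Γ fun k => f k + g k := by
  obtain ⟨c, hc⟩ := hf.exists_le_pow hΓ
  obtain ⟨d, hd⟩ := hg.exists_le_pow hΓ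
  refine .of_le_pow (max c d + 1) ?_
  filter_upwards [hc, hd, hΓ.eventually_ge_atTop 2] with k h1 h2 h3
  have h4 := h1.trans (pow_le_pow_right₀ (by linarith) (le_max_left c d))
  have h5 := h2.trans (pow_le_pow_right₀ (by linarith) (le_max_right c d))
  have h6 : 0 ≤ Γ k ^ max c d := by positivity
  push_cast
  rw [pow_succ]
  nlinarith

theorem PolyIn.mul (hf : PolyIn Γ f) (hg : PolyIn Γ g) :
    PolyIn Γ fun k => f k * g k := by
  obtain ⟨c, hc⟩ := hf
  obtain ⟨d, hd⟩ := hg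
  refine ⟨c + d, ?_⟩
  simp only [pow_add]
  push_cast
  exact hc.mul hd

theorem IsPoly.const (n : ℕ) : IsPoly fun _ => n := PolyIn.const tendsto_natCast_atTop_atTop n

theorem IsPoly.id : IsPoly fun k => k := .of_le_pow 1 (by simp)

theorem IsPoly.add (hf : IsPoly f) (hg : IsPoly g) : IsPoly fun k => f k + g k :=
  PolyIn.add tendsto_natCast_atTop_atTop hf hg

theorem IsPoly.mul (hf : IsPoly f) (hg : IsPoly g) : IsPoly fun k => f k * g k :=
  PolyIn.mul hf hg

theorem IsPoly.div_ten (hf : IsPoly f) : IsPoly fun k => f (k / 10) := by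
  obtain ⟨c, hc⟩ := PolyIn.exists_le_pow tendsto_natCast_atTop_atTop hf
  refine .of_le_pow c ?_
  have ht : Tendsto (fun k : ℕ => k / 10) atTop atTop := Nat.tendsto_div_const_atTop (by norm_num)
  filter_upwards [ht.eventually hc] with k hk
  refine hk.trans (pow_le_pow_left₀ (by positivity) ?_ c)
  exact_mod_cast Nat.div_le_self k 10

theorem IsPoly.polyIn {a : ℝ} (ha : 0 < a) (hlow : ∀ᶠ k : ℕ in atTop, a * k ≤ Γ k)
    (hf : IsPoly f) : PolyIn Γ f := by
  obtain ⟨c, hc⟩ := hf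
  refine ⟨c, hc.trans (IsBigO.pow (IsBigO.of_bound a⁻¹ ?_) c)⟩
  filter_upwards [hlow] with k hk
  rw [Real.norm_of_nonneg (by positivity), inv_mul_eq_div, le_div_iff₀ ha, mul_comm]
  exact hk.trans (le_abs_self _)

theorem PolyIn.comp_mul_ten_add {r : ℕ} (hr : r < 10)
    (hreg : ∃ c : ℕ, Γ =O[atTop] fun k : ℕ => Γ (k / 10) ^ c) (hf : PolyIn Γ f) :
    PolyIn Γ fun k => f (10 * k + r) := by
  obtain ⟨c, hc⟩ := hf
  obtain ⟨d, hd⟩ := hreg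
  have ht : Tendsto (fun k : ℕ => 10 * k + r) atTop atTop :=
    tendsto_atTop_mono (fun k => show k ≤ 10 * k + r by omega) tendsto_id
  refine ⟨d * c, ?_⟩
  have h := (hc.trans (hd.pow c)).comp_tendsto ht
  refine h.congr (fun _ => rfl) fun k => ?_
  simp only [Function.comp_apply, ← pow_mul]
  congr 2
  omega

theorem tendsto_of_low {a : ℝ} (ha : 0 < a) (hlow : ∀ᶠ k : ℕ in atTop, a * k ≤ Γ k) :
    Tendsto Γ atTop atTop :=
  tendsto_atTop_mono' _ hlow (tendsto_natCast_atTop_atTop.const_mul_atTop ha)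

/-- The function `ε` tends to `0` faster than every inverse power of `Γ`. -/
def NegligibleIn (Γ : ℕ → ℝ) (ε : ℕ → ℝ) : Prop :=
  ∀ c : ℕ, Tendsto (fun k => Γ k ^ c * ε k) atTop (nhds 0)

variable {ε ε' : ℕ → ℝ}

theorem NegligibleIn.add (h : NegligibleIn Γ ε) (h' : NegligibleIn Γ ε') :
    NegligibleIn Γ fun k => ε k + ε' k := fun c => by
  simpa [mul_add] using (h c).add (h' c)

theorem NegligibleIn.mono (hΓ : Tendsto Γ atTop atTop) (h : NegligibleIn Γ ε')
    (h0 : ∀ᶠ k in atTop, 0 ≤ ε k) (hle : ∀ᶠ k in atTop, ε k ≤ ε' k) : NegligibleIn Γ ε := fun c => by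
  refine squeeze_zero' ?_ ?_ (h c)
  · filter_upwards [h0, hΓ.eventually_ge_atTop 0] with k h1 h2
    positivity
  · filter_upwards [hle, hΓ.eventually_ge_atTop 0] with k h1 h2
    gcongr

theorem NegligibleIn.poly_mul (hΓ : Tendsto Γ atTop atTop) (h : NegligibleIn Γ ε)
    (h0 : ∀ k, 0 ≤ ε k) (hf : PolyIn Γ f) : NegligibleIn Γ fun k => f k * ε k := by
  obtain ⟨d, hd⟩ := hf.exists_le_pow hΓ
  refine NegligibleIn.mono hΓ (ε' := fun k => Γ k ^ d * ε k) (fun c => ?_)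
    (Eventually.of_forall fun k => mul_nonneg (Nat.cast_nonneg _) (h0 k)) ?_
  · simpa [pow_add, mul_assoc] using h (c + d)
  · filter_upwards [hd] with k hk
    exact mul_le_mul_of_nonneg_right hk (h0 k)

theorem NegligibleIn.div_ten (hΓ : Tendsto Γ atTop atTop)
    (hreg : ∃ c : ℕ, Γ =O[atTop] fun k : ℕ => Γ (k / 10) ^ c)
    (h : NegligibleIn Γ ε) (h0 : ∀ k, 0 ≤ ε k) : NegligibleIn Γ fun k => ε (k / 10) := fun c => by
  obtain ⟨d, hd⟩ := hreg
  obtain ⟨C, hC⟩ := hd.bound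
  have ht : Tendsto (fun k : ℕ => k / 10) atTop atTop := Nat.tendsto_div_const_atTop (by norm_num)
  have h1 := ((h (d * c)).comp ht).const_mul (C ^ c)
  rw [mul_zero] at h1
  refine squeeze_zero' ?_ ?_ h1
  · filter_upwards [hΓ.eventually_ge_atTop 0] with k hk
    exact mul_nonneg (pow_nonneg hk c) (h0 _)
  · filter_upwards [hΓ.eventually_ge_atTop 0, (hΓ.comp ht).eventually_ge_atTop 0, hC] with k h2 h3 h4
    simp only [Function.comp_apply] at h3 ⊢
    rw [Real.norm_of_nonneg h2, Real.norm_of_nonneg (by positivity)] at h4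
    rw [← mul_assoc, pow_mul, ← mul_pow]
    exact mul_le_mul_of_nonneg_right (pow_le_pow_left₀ h2 h4 c) (h0 _)

theorem prOne_nonneg (μ : PMF (List Bool)) : 0 ≤ prOne μ := ENNReal.toReal_nonneg

theorem prOne_le_one (μ : PMF (List Bool)) : prOne μ ≤ 1 := by
  have := ENNReal.toReal_mono ENNReal.one_ne_top (μ.coe_le_one [true])
  simpa [prOne] using this

theorem abs_prOne_sub_le (μ μ' : PMF (List Bool)) : |prOne μ - prOne μ'| ≤ 1 := by
  rw [abs_le]
  constructor <;> linarith [prOne_nonneg μ, prOne_nonneg μ', prOne_le_one μ, prOne_le_one μ']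

theorem negligibleAdvantage_iff (hΓ : Tendsto Γ atTop atTop) {μ : Bool → ℕ → PMF (List Bool)} :
    NegligibleAdvantage Γ μ ↔
      NegligibleIn Γ fun k => |prOne (μ false k) - prOne (μ true k)| := by
  constructor
  · rintro ⟨ν, hν, h⟩ c
    refine squeeze_zero' ?_ ?_ ((hν c).comp hΓ)
    · filter_upwards [hΓ.eventually_ge_atTop 0] with k hk
      positivity
    · filter_upwards [hΓ.eventually_ge_atTop 0] with k hk
      exact mul_le_mul_of_nonneg_left (h k) (pow_nonneg hk c)
  · intro h
    set adv : ℕ → ℝ := fun k => |prOne (μ false k) - prOne (μ true k)| with hadv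
    have h0 : ∀ k, 0 ≤ adv k := fun k => abs_nonneg _
    have hbdd : ∀ y, BddAbove (adv '' {k | Γ k = y}) := fun y =>
      ⟨1, by rintro _ ⟨k, _, rfl⟩; exact abs_prOne_sub_le _ _⟩
    refine ⟨fun y => sSup (adv '' {k | Γ k = y}), fun c => ?_, fun k =>
      le_csSup (hbdd _) ⟨k, rfl, rfl⟩⟩
    rw [Metric.tendsto_atTop]
    intro δ hδ
    obtain ⟨K, hK⟩ := (Metric.tendsto_atTop.1 (h c)) (δ / 2) (by positivity)
    obtain ⟨M, hM⟩ := ((Finset.range K).image Γ).bddAbove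
    refine ⟨max (M + 1) 1, fun y hy => ?_⟩
    have hy1 : (1 : ℝ) ≤ y := (le_max_right _ _).trans hy
    have hyM : M < y := by have := (le_max_left _ _).trans hy; linarith
    have hyc : 0 < y ^ c := by positivity
    have hle : sSup (adv '' {k | Γ k = y}) ≤ δ / 2 / y ^ c := by
      refine Real.sSup_le ?_ (by positivity)
      rintro _ ⟨k, hk, rfl⟩
      have hk : Γ k = y := hk
      have hkK : K ≤ k := by
        by_contra hlt
        have := hM (Finset.mem_coe.2 (Finset.mem_image_of_mem Γ (Finset.mem_range.2 (not_le.1 hlt))))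
        linarith
      have h1 := hK k hkK
      rw [Real.dist_eq, sub_zero, abs_of_nonneg (by rw [hk]; exact mul_nonneg hyc.le (h0 k)), hk] at h1
      rw [le_div_iff₀ hyc, mul_comm]
      exact h1.le
    have hnn : 0 ≤ sSup (adv '' {k | Γ k = y}) :=
      Real.sSup_nonneg (by rintro _ ⟨k, _, rfl⟩; exact h0 k)
    change dist (y ^ c * sSup (adv '' {k | Γ k = y})) 0 < δ
    rw [Real.dist_eq, sub_zero, abs_of_nonneg (by positivity)]
    rw [le_div_iff₀ hyc] at hle
    linarith

/-- An exponentially small function is negligible in every function of subexponential growth. -/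
theorem negligibleIn_exp (hΓ : Tendsto Γ atTop atTop)
    (hup : ∃ g : ℕ → ℝ, g =o[atTop] (fun k : ℕ => (k : ℝ)) ∧ ∀ᶠ k : ℕ in atTop, Γ k ≤ (2 : ℝ) ^ g k)
    {b : ℝ} (hb : 0 < b) : NegligibleIn Γ fun k => (2 : ℝ) ^ (-(b * k)) := fun c => by
  obtain ⟨g, hg, hle⟩ := hup
  have h1 : Tendsto (fun k : ℕ => (2 : ℝ) ^ (-(b / 2 * k))) atTop (nhds 0) := by
    have : Tendsto (fun k : ℕ => -(b / 2 * (k : ℝ))) atTop atBot :=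
      tendsto_neg_atTop_atBot.comp (tendsto_natCast_atTop_atTop.const_mul_atTop (by positivity))
    exact (tendsto_rpow_atBot_of_base_gt_one 2 (by norm_num)).comp this
  refine squeeze_zero' ?_ ?_ h1
  · filter_upwards [hΓ.eventually_ge_atTop 0] with k hk
    positivity
  · filter_upwards [hΓ.eventually_ge_atTop 0, hle,
      hg.bound (show 0 < b / (2 * (c + 1)) by positivity)] with k h2 h3 h4
    have h5 : Γ k ^ c ≤ (2 : ℝ) ^ (c * g k) := by
      refine (pow_le_pow_left₀ h2 h3 c).trans (le_of_eq ?_)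
      rw [mul_comm, Real.rpow_mul (by norm_num), Real.rpow_natCast]
    have h6 : c * g k ≤ b / 2 * k := by
      have h7 : g k ≤ b / (2 * (c + 1)) * k := by
        refine (le_abs_self _).trans (h4.trans (le_of_eq ?_))
        rw [Real.norm_of_nonneg (by positivity)]
      calc c * g k ≤ c * (b / (2 * (c + 1)) * k) := by gcongr
        _ = (c / (c + 1)) * (b / 2 * k) := by field_simp
        _ ≤ 1 * (b / 2 * k) := by
          refine mul_le_mul_of_nonneg_right ?_ (by positivity)
          rw [div_le_one (by positivity)]
          linarith
        _ = b / 2 * k := one_mul _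
    calc Γ k ^ c * (2 : ℝ) ^ (-(b * k)) ≤ 2 ^ (c * g k) * (2 : ℝ) ^ (-(b * k)) := by gcongr
      _ = (2 : ℝ) ^ (c * g k + -(b * k)) := by rw [Real.rpow_add (by norm_num)]
      _ ≤ (2 : ℝ) ^ (-(b / 2 * k)) := by
        refine Real.rpow_le_rpow_of_exponent_le (by norm_num) ?_
        linarith

end MILR

end

noncomputable section

namespace MILR

open Prog

variable {O : Oracle}

/-! ### Query-free and coin-free programs -/

theorem queryFree_clear (a : ℕ) : (clear a).QueryFree := trivial

theorem coinFree_clear (a : ℕ) : (clear a).CoinFree := trivial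

theorem queryFree_move (a b : ℕ) : (move a b).QueryFree := by simp [move, QueryFree]

theorem coinFree_move (a b : ℕ) : (move a b).CoinFree := by simp [move, CoinFree]

theorem queryFree_transfer (a b t : ℕ) : (transfer a b t).QueryFree :=
  ⟨queryFree_move _ _, queryFree_move _ _⟩

theorem coinFree_transfer (a b t : ℕ) : (transfer a b t).CoinFree :=
  ⟨coinFree_move _ _, coinFree_move _ _⟩

theorem queryFree_call (P : Prog) : (call P).QueryFree := by
  refine ⟨?_, ?_⟩
  · induction P <;> simp_all [compile, QueryFree]
  · induction P.size + 3 <;> simp_all [clearRange, queryFree_clear, QueryFree]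

theorem coinFree_call {P : Prog} (hP : P.CoinFree) : (call P).CoinFree := by
  refine ⟨?_, ?_⟩
  · induction P <;> simp_all [compile, CoinFree]
  · induction P.size + 3 <;> simp_all [clearRange, coinFree_clear, CoinFree]

/-! ### Efficiency of the hashed scheme -/

theorem length_of_mem_output {P : Prog} {inp : List (List Bool)} {L t : ℕ}
    (hL : ∀ w ∈ inp, w.length ≤ L) {c : List Bool} (hc : c ∈ (output noOracle P inp t).support) :
    c.length ≤ L + t := by
  rw [output, PMF.mem_support_map_iff] at hc
  obtain ⟨d, hd, rfl⟩ := hc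
  have h2 := length_of_mem_steps (l := 0) (O := noOracle) (by simp [noOracle]) hd 0
  have h3 := length_load_le hL 0
  simp only [zero_add, mul_one] at h2
  omega

/-- Replaces the first two of the inputs `x`, `g`, `m` by the result of `P` on `g`, `x`, and runs
`P'` on the result. -/
def hashThen (P P' : Prog) : Prog :=
  seq (transfer (bS 0) (eS 1) (wS 1)) (seq (call P) (seq (transfer (wS 0) (eS 1) (wS 1))
    (seq (call P') (transfer (eS 0) (bS 0) (wS 1)))))

/-- A bound for the number of steps of `hashThen P P'`. -/
def hashThenTime (P P' : Prog) (L t t' : ℕ) : ℕ :=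
  (10 * L + 3) + callTime P L t + (10 * L + 3) + callTime P' L t' + (10 * (L + t') + 3) + 4

theorem runs_hashThen {P P' : Prog} (hP : P.QueryFree) (hP' : P'.QueryFree)
    {x g m y : List Bool} {L t t' : ℕ} (hx : x.length ≤ L) (hg : g.length ≤ L) (hm : m.length ≤ L)
    (hy : y.length ≤ L) (hh : HaltsWithin noOracle P [g, x] t)
    (ho : output noOracle P [g, x] t = PMF.pure y) (hh' : HaltsWithin noOracle P' [y, m] t') :
    Runs O [hashThen P P'] (load [x, g, m]) (hashThenTime P P' L t t')
      ((output noOracle P' [y, m] t').map fun c =>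
        zones (load [c]) (load [[], []]) (load [[], []])) := by
  have h0 : load [x, g, m] = zones (load [x]) (load [g, []]) (load [m, []]) := by
    rw [load_eq_zones, ← load_append_nil [g], ← load_append_nil [m]]
    rfl
  rw [h0]
  have e1 : Exec O (transfer (bS 0) (eS 1) (wS 1)) (zones (load [x]) (load [g, []]) (load [m, []]))
      (10 * L + 3) (zones (load [[]]) (load [g, x]) (load [m, []])) := by
    refine (exec_transfer (by simp) (by simp) (by simp) (by simp)).of_eq ?_ ?_
    · simpa using hx
    · simp [update_load]
  have e2 : Exec O (call P) (zones (load [[]]) (load [g, x]) (load [m, []]))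
      (callTime P L t) (zones (load [[]]) (load [y, []]) (load [m, []])) := by
    have := runs_call (O := O) (B := load [[]]) (W := load [m, []]) (L := L) hP hh (by simp)
      (by simp [hx, hg])
    rwa [ho, PMF.pure_map] at this
  have e3 : Exec O (transfer (wS 0) (eS 1) (wS 1)) (zones (load [[]]) (load [y, []]) (load [m, []]))
      (10 * L + 3) (zones (load [[]]) (load [y, m]) (load [[], []])) := by
    refine (exec_transfer (by simp) (by simp) (by simp) (by simp)).of_eq ?_ ?_
    · simpa using hm
    · simp [update_load]
  have e4 := runs_call (O := O) (B := load [[]]) (W := load [[], []]) (L := L) hP' hh' (by simp)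
      (by simp [hy, hm])
  have e5 := Runs.seq_map (Q := transfer (eS 0) (bS 0) (wS 1)) (t' := 10 * (L + t') + 3) e4
    (g := fun c => zones (load [c]) (load [[], []]) (load [[], []])) fun c hc => by
      refine (exec_transfer (by simp) (by simp) (by simp) (by simp)).of_eq ?_ ?_
      · simpa using length_of_mem_output (by simp [hy, hm]) hc
      · simp [update_load]
  exact (e1.seq_runs (e2.seq_runs (e3.seq_runs e5))).mono (by simp only [hashThenTime]; omega)

theorem hashThen_runsInTime {P P' : Prog} (hP : P.QueryFree) (hP' : P'.QueryFree) {ι : ℕ → Type}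
    {x g m y : ∀ k, ι k → List Bool} {f : ∀ k, ι k → PMF (List Bool)} {L t t' : ℕ → ℕ}
    (hx : ∀ k i, (x k i).length ≤ L k) (hg : ∀ k i, (g k i).length ≤ L k)
    (hm : ∀ k i, (m k i).length ≤ L k) (hy : ∀ k i, (y k i).length ≤ L k)
    (h : ∀ k i, HaltsWithin noOracle P [g k i, x k i] (t k) ∧
      output noOracle P [g k i, x k i] (t k) = PMF.pure (y k i))
    (h' : ∀ k i, HaltsWithin noOracle P' [y k i, m k i] (t' k) ∧
      output noOracle P' [y k i, m k i] (t' k) = f k i) :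
    RunsInTime (fun k => hashThenTime P P' (L k) (t k) (t' k)) (hashThen P P')
      (fun k i => [x k i, g k i, m k i]) f := by
  refine ⟨⟨queryFree_transfer _ _ _, queryFree_call _, queryFree_transfer _ _ _, queryFree_call _,
    queryFree_transfer _ _ _⟩, fun k i => ?_⟩
  have := runs_hashThen (O := noOracle) hP hP' (hx k i) (hg k i) (hm k i) (hy k i) (h k i).1
    (h k i).2 (h' k i).1
  refine ⟨this.haltsWithin, ?_⟩
  rw [this.output_eq, PMF.map_comp, ← (h' k i).2]
  exact PMF.map_id _

theorem IsPoly.callTime {P : Prog} {L t : ℕ → ℕ} (hL : IsPoly L) (ht : IsPoly t) :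
    IsPoly fun k => callTime P (L k) (t k) :=
  (ht.add ((IsPoly.const _).mul (((IsPoly.const 2).mul (hL.add ht)).add (.const 2)))).add (.const 2)

theorem IsPoly.hashThenTime {P P' : Prog} {L t t' : ℕ → ℕ} (hL : IsPoly L) (ht : IsPoly t)
    (ht' : IsPoly t') : IsPoly fun k => hashThenTime P P' (L k) (t k) (t' k) :=
  (((((((IsPoly.const 10).mul hL).add (.const 3)).add (hL.callTime ht)).add
    (((IsPoly.const 10).mul hL).add (.const 3))).add (hL.callTime ht')).add
    (((IsPoly.const 10).mul (hL.add ht')).add (.const 3))).add (.const 4)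

theorem hashedScheme_isValid {S : EncScheme} {H : HashFamily fun k => k / 10}
    (hH : H.IsUniversal) (hS : S.IsValid) (hU : S.UniformKeys) : (hashedScheme S H).IsValid := by
  have hL : IsPoly fun k => k + H.seedLen k + S.ctLen (k / 10) + 1 :=
    ((IsPoly.id.add hH.seedLen_poly).add hS.ctLen_poly.div_ten).add (.const 1)
  obtain ⟨Ph, th, hPh, hth, hqh, hrh⟩ := hH.hash_eff
  refine ⟨hH.seedLen_poly, hS.ctLen_poly.div_ten, ?_, hH.sample_eff, ?_, ?_, fun k x p m =>
    hS.correct _ _ _⟩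
  · have := hS.gen_eff
    simp only [hU _] at this
    exact this
  · obtain ⟨Pe, te, hte, hqe, hre⟩ := hS.enc_eff
    refine ⟨hashThen Ph Pe, _, hL.hashThenTime hth hte.div_ten, hashThen_runsInTime hqh hqe
      (ι := fun k => BitStr k × BitStr (H.seedLen k) × Bool)
      (y := fun k i => List.ofFn (H.hash k i.2.1 i.1)) (fun k i => ?_) (fun k i => ?_)
      (fun k i => ?_) (fun k i => ?_) (fun k i => hrh k (i.2.1, i.1))
      (fun k i => hre (k / 10) (H.hash k i.2.1 i.1, i.2.2))⟩ <;>
    simp only [hashedScheme, List.length_ofFn, List.length_singleton] <;> omega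
  · obtain ⟨Pd, td, hPd, htd, hqd, hrd⟩ := hS.dec_eff
    refine ⟨hashThen Ph Pd, _, ?_, hL.hashThenTime hth htd.div_ten, hashThen_runsInTime hqh hqd
      (ι := fun k => BitStr k × BitStr (H.seedLen k) × BitStr (S.ctLen (k / 10)))
      (y := fun k i => List.ofFn (H.hash k i.2.1 i.1)) (fun k i => ?_) (fun k i => ?_)
      (fun k i => ?_) (fun k i => ?_) (fun k i => hrh k (i.2.1, i.1))
      (fun k i => hrd (k / 10) (H.hash k i.2.1 i.1, i.2.2))⟩
    · exact ⟨coinFree_transfer _ _ _, coinFree_call hPh, coinFree_transfer _ _ _, coinFree_call hPd,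
        coinFree_transfer _ _ _⟩
    all_goals (simp only [hashedScheme, List.length_ofFn]; omega)

end MILR

end

noncomputable section

namespace MILR

open Prog

variable {O : Oracle}

/-! ### Simulating the oracle of many instances -/

/-- An instance in a hybrid experiment: its key, a bit that is `false` if messages are replaced
by `0`, and a bit that is `true` if queries are passed on to the oracle instead. -/
abbrev Entry : Type := List Bool × Bool × Bool

/-- An instance as a string. -/
def entryStr (e : Entry) : List Bool := e.1 ++ [e.2.1, e.2.2]

/-- A list of instances as a string. -/
def tableStr (T : List Entry) : List Bool := T.flatMap fun e => encodeStr (entryStr e)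

/-- The oracle that answers queries for the instances in the list `T` by means of the encryption
algorithm `enc` and the oracle `O`. -/
def simOracle (O : Oracle) (enc : List Bool → Bool → PMF (List Bool)) (T : List Entry) : Oracle
  | [] => PMF.pure []
  | m :: u => match T[u.length]? with
    | none => PMF.pure []
    | some (_, _, true) => O [m]
    | some (key, flag, false) => enc key (flag && m)

theorem tableStr_cons (e : Entry) (T : List Entry) :
    tableStr (e :: T) = encodeStr (entryStr e) ++ tableStr T := rfl

theorem tableStr_drop_le (T : List Entry) (j : ℕ) :
    (tableStr (T.drop j)).length ≤ (tableStr T).length := by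
  induction T generalizing j with
  | nil => simp
  | cons e T ih =>
    rcases j with _ | j
    · simp
    · exact (ih j).trans (by simp [tableStr_cons])

/-- Answers a query, the bit `m` followed by the string on stack `1` of the third zone, for the table
on stack `3`. -/
def lookup (P : Prog) (m : Bool) : Prog :=
  seq (pop (wS 1)) (seq (push (wS 4) m) (seq
    (loop (wS 1) (seq (pop (wS 1)) (seq (readStr (wS 3) (wS 5) (wS 2)) (clear (wS 5)))))
    (seq (readStr (wS 3) (wS 5) (wS 2)) (seq (clear (wS 3)) (branch (wS 5) (clear (wS 4))
      (seq (pop (wS 5)) (seq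
        (branch (wS 5) skip (seq (pop (wS 5)) (seq (pop (wS 4)) (push (wS 4) false))) (pop (wS 5)))
        (seq (move (wS 5) (eS 0)) (seq (move (wS 4) (eS 1)) (call P)))))
      (seq (clear (wS 5)) (seq (query (wS 4) (eS 0)) (clear (wS 4)))))))))

/-- Answers the query on stack `q` of the first zone and leaves the answer on stack `a`. -/
def querySub (P : Prog) (q a : ℕ) : Prog :=
  seq (copy (bS q) (wS 1) (wS 2)) (seq (copy (wS 0) (wS 3) (wS 2)) (seq
    (branch (wS 1) (clear (wS 3)) (lookup P false) (lookup P true))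
    (seq (clear (bS a)) (transfer (eS 0) (bS a) (wS 2)))))

variable {P : Prog} {T : List Entry} {σ : Store} {N L l t : ℕ}

theorem exec_read_entry (hN : (tableStr T).length ≤ N) (t0 w1 w4 : List Bool) :
    Exec O (readStr (wS 3) (wS 5) (wS 2))
      (zones σ (load [[], []]) (load [t0, w1, [], tableStr T, w4, []])) (8 * N + 8)
      (zones σ (load [[], []]) (load [t0, w1, [], tableStr T.tail, w4,
        ((T.head?.map entryStr).getD []).reverse])) := by
  cases T with
  | nil =>
    exact (exec_readStr_nil (by simp) (by simp) (by simp [tableStr])).of_eq (by omega) (by simp)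
  | cons e T =>
    refine (exec_readStr (w := entryStr e) (v := tableStr T) (by simp) (by simp) (by simp) (by simp)
      (by simp [tableStr_cons])).of_eq ?_ ?_
    · simp only [tableStr_cons, List.length_append, length_encodeStr] at hN
      omega
    · simp [update_load]

theorem length_head_le (hN : (tableStr T).length ≤ N) :
    ((T.head?.map entryStr).getD []).length ≤ N := by
  cases T with
  | nil => simp
  | cons e T =>
    simp only [tableStr_cons, List.length_append, length_encodeStr] at hN
    simp
    omega

/-- A bound for the number of steps of `lookup P m`. -/
def lookupTime (P : Prog) (N L t : ℕ) : ℕ :=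
  L * (10 * N + 14) + callTime P (N + 1) t + 40 * N + 60

theorem runs_lookup (hP : P.QueryFree) (hN : (tableStr T).length ≤ N)
    (hT : ∀ e ∈ T, ∀ b, HaltsWithin noOracle P [e.1, [b]] t) (m : Bool) (u : List Bool)
    (hu : u.length ≤ L) (t0 : List Bool) :
    Runs O [lookup P m]
      (zones σ (load [[], []]) (load [t0, m :: u, [], tableStr T, [], []]))
      (lookupTime P N L t)
      ((simOracle O (fun key b => output noOracle P [key, [b]] t) T (m :: u)).map fun c =>
        zones σ (load [c, []]) (load [t0, [], [], [], [], []])) := by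
  have e1 : Exec O (pop (wS 1))
      (zones σ (load [[], []]) (load [t0, m :: u, [], tableStr T, [], []])) 1
      (zones σ (load [[], []]) (load [t0, u, [], tableStr T, [], []])) :=
    (Exec.pop _).of_eq le_rfl (by simp [update_load])
  have e2 : Exec O (push (wS 4) m)
      (zones σ (load [[], []]) (load [t0, u, [], tableStr T, [], []])) 1
      (zones σ (load [[], []]) (load [t0, u, [], tableStr T, [m], []])) :=
    (Exec.push _ _).of_eq le_rfl (by simp [update_load])
  have e3 : Exec O
      (loop (wS 1) (seq (pop (wS 1)) (seq (readStr (wS 3) (wS 5) (wS 2)) (clear (wS 5)))))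
      (zones σ (load [[], []]) (load [t0, u, [], tableStr T, [m], []])) (L * (10 * N + 14) + 1)
      (zones σ (load [[], []]) (load [t0, [], [], tableStr (T.drop u.length), [m], []])) := by
    refine (Exec.loop_iter u.length (10 * N + 13) (fun j => zones σ (load [[], []])
      (load [t0, u.drop j, [], tableStr (T.drop j), [m], []])) (fun j hj => ?_) (by simp)
      (fun j hj => ?_)).of_eq (by gcongr) (by simp)
    · simpa using hj
    · have hNj := (tableStr_drop_le T j).trans hN
      have a1 : Exec O (pop (wS 1)) (zones σ (load [[], []])
            (load [t0, u.drop j, [], tableStr (T.drop j), [m], []])) 1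
          (zones σ (load [[], []]) (load [t0, u.drop (j + 1), [], tableStr (T.drop j), [m], []])) :=
        (Exec.pop _).of_eq le_rfl (by simp [update_load])
      have a2 := exec_read_entry (O := O) (σ := σ) hNj t0 (u.drop (j + 1)) [m]
      refine (a1.seq (a2.seq (exec_clear (wS 5)))).of_eq ?_ ?_
      · have := length_head_le hNj
        simp only [zones_wS, load_succ, load_zero, List.length_reverse]
        omega
      · simp [update_load]
  have hNj := (tableStr_drop_le T u.length).trans hN
  have hl := length_head_le hNj
  have e4 := exec_read_entry (O := O) (σ := σ) hNj t0 [] [m]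
  have e5 : Exec O (clear (wS 3)) (zones σ (load [[], []]) (load [t0, [], [],
        tableStr (T.drop u.length).tail, [m],
        (((T.drop u.length).head?.map entryStr).getD []).reverse])) (2 * N + 1)
      (zones σ (load [[], []]) (load [t0, [], [], [], [m],
        (((T.drop u.length).head?.map entryStr).getD []).reverse])) := by
    refine (exec_clear _).of_eq ?_ (by simp [update_load])
    have := (tableStr_drop_le T (u.length + 1)).trans hN
    simp only [zones_wS, load_succ, load_zero, List.tail_drop]
    omega
  have hhd : (T.drop u.length).head? = T[u.length]? := by simp
  rw [hhd] at e4 e5 hl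
  refine Runs.mono (t := 1 + (1 + ((L * (10 * N + 14) + 1) + ((8 * N + 8) + ((2 * N + 1) +
    (16 * N + 30 + callTime P (N + 1) t) + 1) + 1) + 1) + 1) + 1) (e1.seq_runs (e2.seq_runs
      (e3.seq_runs (e4.seq_runs (e5.seq_runs ?_))))) (by simp only [lookupTime]; omega)
  rcases hTu : T[u.length]? with _ | ⟨key, flag, _ | _⟩
  · simp only [simOracle, hTu, PMF.pure_map]
    exact Runs.mono (Runs.branch_nil (by simp) ((exec_clear (wS 4)).of_eq le_rfl
      (by simp [update_load]))) (by simp; omega)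
  · rw [hTu] at hl
    simp only [Option.map_some, Option.getD_some, entryStr, List.length_append, List.length_cons,
      List.length_nil] at hl
    simp only [simOracle, hTu]
    have hmem : (key, flag, false) ∈ T := List.mem_of_getElem? hTu
    have c1 : Exec O (pop (wS 5)) (zones σ (load [[], []]) (load [t0, [], [], [], [m],
          (((some (key, flag, false)).map entryStr).getD []).reverse])) 1
        (zones σ (load [[], []]) (load [t0, [], [], [], [m], flag :: key.reverse])) :=
      (Exec.pop _).of_eq le_rfl (by simp [update_load, entryStr])
    have c2 : Exec O
        (branch (wS 5) skip (seq (pop (wS 5)) (seq (pop (wS 4)) (push (wS 4) false))) (pop (wS 5)))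
        (zones σ (load [[], []]) (load [t0, [], [], [], [m], flag :: key.reverse])) 6
        (zones σ (load [[], []]) (load [t0, [], [], [], [flag && m], key.reverse])) := by
      cases flag
      · exact Runs.branch_false (by simp; rfl) (((Exec.pop _).seq ((Exec.pop _).seq
          (Exec.push _ _))).of_eq le_rfl (by simp [update_load]))
      · exact Runs.branch_true (by simp; rfl) ((Exec.pop _).of_eq (by omega)
          (by simp [update_load]))
    have c3 : Exec O (move (wS 5) (eS 0))
        (zones σ (load [[], []]) (load [t0, [], [], [], [flag && m], key.reverse])) (5 * N + 1)
        (zones σ (load [key, []]) (load [t0, [], [], [], [flag && m], []])) :=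
      (exec_move (by simp)).of_eq (by simp; omega) (by simp [update_load])
    have c4 : Exec O (move (wS 4) (eS 1))
        (zones σ (load [key, []]) (load [t0, [], [], [], [flag && m], []])) 6
        (zones σ (load [key, [flag && m]]) (load [t0, [], [], [], [], []])) :=
      (exec_move (by simp)).of_eq (by simp) (by simp [update_load])
    have c5 := runs_call (O := O) (B := σ) (W := load [t0, [], [], [], [], []]) (L := N + 1) hP
      (hT _ hmem (flag && m)) (by simp) (by simp; omega)
    exact (Runs.branch_false (by simp [entryStr]; rfl) (c1.seq_runs (c2.seq_runs (c3.seq_runs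
      (c4.seq_runs c5))))).mono (by omega)
  · rw [hTu] at hl
    simp only [Option.map_some, Option.getD_some, entryStr, List.length_append, List.length_cons,
      List.length_nil] at hl
    simp only [simOracle, hTu]
    have c1 : Exec O (clear (wS 5)) (zones σ (load [[], []]) (load [t0, [], [], [], [m],
          (((some (key, flag, true)).map entryStr).getD []).reverse])) (2 * N + 1)
        (zones σ (load [[], []]) (load [t0, [], [], [], [m], []])) :=
      (exec_clear _).of_eq (by simp [entryStr]; omega) (by simp [update_load])
    have c2 : Runs O [query (wS 4) (eS 0)]
        (zones σ (load [[], []]) (load [t0, [], [], [], [m], []])) 1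
        ((O [m]).map fun c => zones σ (load [c, []]) (load [t0, [], [], [], [m], []])) :=
      (Runs.query _ _).of_eq le_rfl (by simp [update_load])
    have c3 := Runs.seq_map (Q := clear (wS 4)) (t' := 3) c2
      (g := fun c => zones σ (load [c, []]) (load [t0, [], [], [], [], []])) fun c _ =>
        (exec_clear _).of_eq (by simp) (by simp [update_load])
    exact (Runs.branch_true (by simp [entryStr]; rfl) (c1.seq_runs c3)).mono (by omega)

/-- A bound for the number of steps of `querySub P q a`. -/
def queryTime (P : Prog) (N L l t : ℕ) : ℕ :=
  lookupTime P N L t + 14 * L + 12 * N + 10 * l + 20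

theorem runs_querySub (hP : P.QueryFree) (hN : (tableStr T).length ≤ N)
    (hT : ∀ e ∈ T, ∀ b, HaltsWithin noOracle P [e.1, [b]] t)
    (hl : ∀ w, ∀ c ∈ (simOracle O (fun key b => output noOracle P [key, [b]] t) T w).support,
      c.length ≤ l)
    (q a : ℕ) (hσ : ∀ r, (σ r).length ≤ L) :
    Runs O [querySub P q a]
      (zones σ (load [[], []]) (load [tableStr T, [], [], [], [], []])) (queryTime P N L l t)
      ((simOracle O (fun key b => output noOracle P [key, [b]] t) T (σ q)).map fun c =>
        zones (Function.update σ a c) (load [[], []]) (load [tableStr T, [], [], [], [], []])) := by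
  have e1 : Exec O (copy (bS q) (wS 1) (wS 2))
      (zones σ (load [[], []]) (load [tableStr T, [], [], [], [], []])) (12 * L + 3)
      (zones σ (load [[], []]) (load [tableStr T, σ q, [], [], [], []])) :=
    (exec_copy (by simp) (by simp) (by simp) (by simp)).of_eq (by simpa using hσ q)
      (by simp [update_load])
  have e2 : Exec O (copy (wS 0) (wS 3) (wS 2))
      (zones σ (load [[], []]) (load [tableStr T, σ q, [], [], [], []])) (12 * N + 3)
      (zones σ (load [[], []]) (load [tableStr T, σ q, [], tableStr T, [], []])) :=
    (exec_copy (by simp) (by simp) (by simp) (by simp)).of_eq (by simpa using hN)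
      (by simp [update_load])
  have e3 : Runs O [branch (wS 1) (clear (wS 3)) (lookup P false) (lookup P true)]
      (zones σ (load [[], []]) (load [tableStr T, σ q, [], tableStr T, [], []]))
      (lookupTime P N L t + 1)
      ((simOracle O (fun key b => output noOracle P [key, [b]] t) T (σ q)).map fun c =>
        zones σ (load [c, []]) (load [tableStr T, [], [], [], [], []])) := by
    rcases hq : σ q with _ | ⟨_ | _, u⟩
    · simp only [simOracle, PMF.pure_map]
      refine Runs.branch_nil (by simp) ((exec_clear (wS 3)).of_eq ?_ (by simp [update_load]))
      simp only [zones_wS, load_succ, load_zero, lookupTime]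
      omega
    · have := hσ q
      rw [hq, List.length_cons] at this
      exact Runs.branch_false (by simp; rfl) (runs_lookup hP hN hT false u (by omega) _)
    · have := hσ q
      rw [hq, List.length_cons] at this
      exact Runs.branch_true (by simp; rfl) (runs_lookup hP hN hT true u (by omega) _)
  have e4 := Runs.seq_map (Q := seq (clear (bS a)) (transfer (eS 0) (bS a) (wS 2)))
    (t' := 2 * L + 1 + (10 * l + 3) + 1) e3
    (g := fun c => zones (Function.update σ a c) (load [[], []])
      (load [tableStr T, [], [], [], [], []])) fun c hc => by
        have f1 : Exec O (clear (bS a))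
            (zones σ (load [c, []]) (load [tableStr T, [], [], [], [], []])) (2 * L + 1)
            (zones (Function.update σ a []) (load [c, []])
              (load [tableStr T, [], [], [], [], []])) :=
          (exec_clear _).of_eq (by simpa using hσ a) (by simp)
        exact f1.seq ((exec_transfer (by simp) (by simp) (by simp) (by simp)).of_eq
          (by simpa using hl _ c hc) (by simp [update_load]))
  exact (e1.seq_runs (e2.seq_runs e4)).mono (by simp only [queryTime]; omega)

/-- The program `B` in the first zone, with queries answered by means of the table on stack `0` of the
third zone. -/
def simulate (P B : Prog) : Prog := B.compile bS (querySub P)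

/-- A bound for the number of steps of `simulate P B`. -/
def simTime (P : Prog) (N L l t tB : ℕ) : ℕ := tB * queryTime P N (L + tB * (l + 1)) l t

theorem runs_simulate {B : Prog} {inp : List (List Bool)} {tB : ℕ} (hP : P.QueryFree)
    (hN : (tableStr T).length ≤ N) (hT : ∀ e ∈ T, ∀ b, HaltsWithin noOracle P [e.1, [b]] t)
    (hl : ∀ w, ∀ c ∈ (simOracle O (fun key b => output noOracle P [key, [b]] t) T w).support,
      c.length ≤ l)
    (hL : ∀ w ∈ inp, w.length ≤ L) (hB : TimeBounded B inp l tB) :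
    ∃ μ : PMF Store, Runs O [simulate P B]
      (zones (load inp) (load [[], []]) (load [tableStr T, [], [], [], [], []]))
      (simTime P N L l t tB) μ ∧
      (μ.map fun s => s 0) =
        output (simOracle O (fun key b => output noOracle P [key, [b]] t) T) B inp tB := by
  have := Runs.compile (O := O) (Q := querySub P)
    (isLens_bS (E := load [[], []]) (W := load [tableStr T, [], [], [], [], []]))
    (T := queryTime P N (L + tB * (l + 1)) l t) (by simp only [queryTime]; omega) hl
    (fun σ q a hσ => runs_querySub hP hN hT hl q a hσ) tB [B] (load inp)
    (fun r => by have := length_load_le hL r; omega) (hB _ hl)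
  refine ⟨_, this, ?_⟩
  rw [PMF.map_comp, output]
  congr 1

end MILR

end

noncomputable section

namespace MILR

open Prog

variable {O : Oracle} {P B : Prog} {T : List Entry} {N L l t tB : ℕ}

theorem length_of_mem_simOracle {enc : List Bool → Bool → PMF (List Bool)}
    (hO : ∀ w, ∀ c ∈ (O w).support, c.length ≤ l)
    (henc : ∀ e ∈ T, ∀ b, ∀ c ∈ (enc e.1 b).support, c.length ≤ l) :
    ∀ w, ∀ c ∈ (simOracle O enc T w).support, c.length ≤ l := by
  rintro (_ | ⟨m, u⟩) c hc
  · simp only [simOracle, PMF.support_pure, Set.mem_singleton_iff] at hc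
    simp [hc]
  · rcases hTu : T[u.length]? with _ | ⟨key, flag, _ | _⟩ <;> simp only [simOracle, hTu] at hc
    · simp only [PMF.support_pure, Set.mem_singleton_iff] at hc
      simp [hc]
    · exact henc _ (List.mem_of_getElem? hTu) _ c hc
    · exact hO _ c hc

/-! ### A non-uniform reduction -/

/-- Pushes the string `w` on the stack `r`. -/
def pushStr (r : ℕ) : List Bool → Prog
  | [] => skip
  | b :: w => seq (pushStr r w) (push r b)

theorem exec_pushStr (r : ℕ) (w : List Bool) (s : Store) :
    Exec O (pushStr r w) s (2 * w.length + 1) (Function.update s r (w ++ s r)) := by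
  induction w with
  | nil => exact Exec.skip.of_eq (by simp) (by simp)
  | cons b w ih => exact (ih.seq (Exec.push r b)).of_eq (by simp; ring_nf; omega) (by simp)

theorem size_pushStr (r : ℕ) (w : List Bool) : (pushStr r w).size = w.length * (r + 2) + 1 := by
  induction w with
  | nil => simp [pushStr, size]
  | cons b w ih => simp [pushStr, size, ih]; ring

theorem size_querySub (P : Prog) (q a : ℕ) :
    (querySub P q a).size ≤ ((querySub P 0 0).size + 30) * (q + a + 1) := by
  have : (querySub P q a).size ≤ (querySub P 0 0).size + 30 * (q + a) := by
    simp only [querySub, copy, clear, transfer, move, bS, size]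
    omega
  nlinarith

theorem size_simulate (P B : Prog) :
    (simulate P B).size ≤ ((querySub P 0 0).size + 30) * B.size := by
  unfold simulate
  induction B with
  | query q a => exact size_querySub P q a
  | _ => simp only [compile, size, bS] at *; nlinarith

/-- Replaces the input by `inp` and simulates `B` with the table of instances `tab`. -/
def hardwired (P B : Prog) (inp : List (List Bool)) (tab : List Bool) : Prog :=
  seq (clear (bS 0)) (seq (pushStr (bS 0) (inp.getD 0 [])) (seq (pushStr (bS 1) (inp.getD 1 []))
    (seq (pushStr (bS 2) (inp.getD 2 [])) (seq (pushStr (wS 0) tab) (simulate P B)))))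

/-- A bound for the number of steps of the program `hardwired P B inp tab`. -/
def hardwiredTime (P : Prog) (N L l t tB n : ℕ) : ℕ :=
  2 * n + 6 * L + 2 * N + 10 + simTime P N L l t tB

theorem load_one_eq_zones (w : List Bool) : load [w] =
    zones (load [w, [], []]) (load [[], []]) (load [[], [], [], [], [], []]) := by
  have h1 : load [w] = load [w, [], []] := by
    rw [← load_append_nil [w], ← load_append_nil ([w] ++ [[]])]
    rfl
  have h2 : ∀ n, load (List.replicate n []) = load [[]] := fun n => by
    funext i
    have h0 : load [[]] i = [] := by rcases i with _ | i <;> rfl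
    rw [h0]
    clear h0
    induction n generalizing i with
    | zero => rfl
    | succ n ih => rcases i with _ | i <;> [rfl; exact ih i]
  have h3 := h2 2
  have h4 := h2 6
  have h5 := load_eq_zones w [] []
  rw [← load_append_nil [w]] at h5
  simp only [List.replicate] at h3 h4
  rw [h3, h4, ← h1, ← load_append_nil [w], ← h5, load_append_nil [w], h1]

theorem runs_hardwired {inp : List (List Bool)} (hP : P.QueryFree)
    (hN : (tableStr T).length ≤ N) (hT : ∀ e ∈ T, ∀ b, HaltsWithin noOracle P [e.1, [b]] t)
    (hl : ∀ w, ∀ c ∈ (simOracle O (fun key b => output noOracle P [key, [b]] t) T w).support,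
      c.length ≤ l)
    (hinp : inp.length ≤ 3) (hL : ∀ w ∈ inp, w.length ≤ L) (hB : TimeBounded B inp l tB) (n : ℕ) :
    HaltsWithin O (hardwired P B inp (tableStr T)) [unary n] (hardwiredTime P N L l t tB n) ∧
      output O (hardwired P B inp (tableStr T)) [unary n] (hardwiredTime P N L l t tB n) =
        output (simOracle O (fun key b => output noOracle P [key, [b]] t) T) B inp tB := by
  obtain ⟨μ, hμ, ho⟩ := runs_simulate hP hN hT hl hL hB
  have hload : load inp = load [inp.getD 0 [], inp.getD 1 [], inp.getD 2 []] := by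
    funext i
    rcases i with _ | _ | _ | i
    · rfl
    · rfl
    · rfl
    · simp only [load_succ, load_nil]
      rw [load, List.getD, List.getElem?_eq_none (by omega)]
      rfl
  have hLi : ∀ i, (inp.getD i []).length ≤ L := length_load_le hL
  rw [hload] at hμ
  have e1 : Exec O (clear (bS 0)) (load [unary n]) (2 * n + 1)
      (zones (load [[], [], []]) (load [[], []]) (load [[], [], [], [], [], []])) := by
    rw [load_one_eq_zones]
    exact (exec_clear _).of_eq (by simp [unary]) (by simp [update_load])
  have e2 := exec_pushStr (O := O) (bS 0) (inp.getD 0 [])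
    (zones (load [[], [], []]) (load [[], []]) (load [[], [], [], [], [], []]))
  have e3 := exec_pushStr (O := O) (bS 1) (inp.getD 1 [])
    (zones (load [inp.getD 0 [], [], []]) (load [[], []]) (load [[], [], [], [], [], []]))
  have e4 := exec_pushStr (O := O) (bS 2) (inp.getD 2 [])
    (zones (load [inp.getD 0 [], inp.getD 1 [], []]) (load [[], []])
      (load [[], [], [], [], [], []]))
  have e5 := exec_pushStr (O := O) (wS 0) (tableStr T)
    (zones (load [inp.getD 0 [], inp.getD 1 [], inp.getD 2 []]) (load [[], []])
      (load [[], [], [], [], [], []]))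
  have h0 := hLi 0
  have h1 := hLi 1
  have h2 := hLi 2
  have key : Runs O [hardwired P B inp (tableStr T)] (load [unary n])
      (hardwiredTime P N L l t tB n) μ :=
    (e1.seq_runs ((e2.of_eq (by omega : _ ≤ 2 * L + 1) (by simp [update_load])).seq_runs
      ((e3.of_eq (by omega : _ ≤ 2 * L + 1) (by simp [update_load])).seq_runs
      ((e4.of_eq (by omega : _ ≤ 2 * L + 1) (by simp [update_load])).seq_runs
      ((e5.of_eq (by omega : _ ≤ 2 * N + 1) (by simp [update_load])).seq_runs hμ))))).mono
      (by simp only [hardwiredTime]; omega)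
  exact ⟨key.haltsWithin, key.output_eq.trans ho⟩

theorem size_hardwired {inp : List (List Bool)} {tab : List Bool} (hN : tab.length ≤ N)
    (hL : ∀ w ∈ inp, w.length ≤ L) : (hardwired P B inp tab).size ≤
      15 * L + 4 * N + 20 + ((querySub P 0 0).size + 30) * B.size := by
  have hLi : ∀ i, (inp.getD i []).length ≤ L := length_load_le hL
  have h0 := hLi 0
  have h1 := hLi 1
  have h2 := hLi 2
  have h3 := size_simulate P B
  simp only [hardwired, size, size_pushStr, clear, bS, wS]
  omega

variable {Γ : ℕ → ℝ}

theorem PolyIn.callTime (hΓ : Tendsto Γ atTop atTop) {P : Prog} {L t : ℕ → ℕ} (hL : PolyIn Γ L)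
    (ht : PolyIn Γ t) : PolyIn Γ fun k => callTime P (L k) (t k) :=
  .add hΓ (.add hΓ ht (.mul (.const hΓ _) (.add hΓ (.mul (.const hΓ 2) (.add hΓ hL ht))
    (.const hΓ 2)))) (.const hΓ 2)

theorem PolyIn.simTime (hΓ : Tendsto Γ atTop atTop) {P : Prog} {N L l t tB : ℕ → ℕ}
    (hN : PolyIn Γ N) (hL : PolyIn Γ L) (hl : PolyIn Γ l) (ht : PolyIn Γ t) (htB : PolyIn Γ tB) :
    PolyIn Γ fun k => simTime P (N k) (L k) (l k) (t k) (tB k) := by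
  have hL' : PolyIn Γ fun k => L k + tB k * (l k + 1) :=
    .add hΓ hL (.mul htB (.add hΓ hl (.const hΓ 1)))
  have h1 : PolyIn Γ fun k => lookupTime P (N k) (L k + tB k * (l k + 1)) (t k) :=
    .add hΓ (.add hΓ (.add hΓ (.mul hL' (.add hΓ (.mul (.const hΓ 10) hN) (.const hΓ 14)))
      (.callTime hΓ (.add hΓ hN (.const hΓ 1)) ht)) (.mul (.const hΓ 40) hN)) (.const hΓ 60)
  exact .mul htB (.add hΓ (.add hΓ (.add hΓ (.add hΓ h1 (.mul (.const hΓ 14) hL'))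
    (.mul (.const hΓ 12) hN)) (.mul (.const hΓ 10) hl)) (.const hΓ 20))

theorem PolyIn.hardwiredTime (hΓ : Tendsto Γ atTop atTop) {P : Prog} {N L l t tB n : ℕ → ℕ}
    (hN : PolyIn Γ N) (hL : PolyIn Γ L) (hl : PolyIn Γ l) (ht : PolyIn Γ t) (htB : PolyIn Γ tB)
    (hn : PolyIn Γ n) :
    PolyIn Γ fun k => hardwiredTime P (N k) (L k) (l k) (t k) (tB k) (n k) :=
  .add hΓ (.add hΓ (.add hΓ (.add hΓ (.mul (.const hΓ 2) hn) (.mul (.const hΓ 6) hL))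
    (.mul (.const hΓ 2) hN)) (.const hΓ 10)) (.simTime hΓ hN hL hl ht htB)

end MILR

end

noncomputable section

namespace MILR

open scoped BigOperators

/-! ### Averages -/

section Average

variable {α β : Type*} [Fintype α] [Fintype β]

theorem abs_expect_le_of_forall [Nonempty α] {f : α → ℝ} {c : ℝ} (h : ∀ a, |f a| ≤ c) :
    |𝔼 a, f a| ≤ c :=
  (Finset.abs_expect_le _ _).trans (Finset.expect_le Finset.univ_nonempty fun a _ => h a)

theorem expect_pi_prod {ι : Type*} [Fintype ι] [DecidableEq ι] [Nonempty α] (J : Finset ι)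
    (f : ι → α → ℝ) : (𝔼 p : ι → α, ∏ j ∈ J, f j (p j)) = ∏ j ∈ J, 𝔼 a, f j a := by
  have h1 : ∀ g : ι → ℝ, ∏ j ∈ J, g j = ∏ j, if j ∈ J then g j else 1 := fun g => by
    rw [Finset.prod_ite_mem, Finset.univ_inter]
  have h2 : ∀ j, (if j ∈ J then 𝔼 a, f j a else 1) = 𝔼 a, if j ∈ J then f j a else 1 := fun j => by
    split_ifs
    · rfl
    · rw [Fintype.expect_const]
  simp only [h1, h2]
  simp only [Fintype.expect_eq_sum_div_card, Finset.prod_div_distrib, Finset.prod_univ_sum,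
    Fintype.card_pi, Fintype.piFinset_univ]
  simp

theorem expect_update {ι : Type*} [Fintype ι] [DecidableEq ι] [Nonempty α] (j : ι)
    (f : (ι → α) → ℝ) : (𝔼 y : ι → α, 𝔼 a, f (Function.update y j a)) = 𝔼 y : ι → α, f y := by
  have h : ∀ g : (ι → α) → ℝ, (𝔼 y : ι → α, g y) =
      𝔼 b : {i // i ≠ j} → α, 𝔼 a, g ((Equiv.funSplitAt j α).symm (a, b)) := fun g => by
    rw [Finset.expect_comm, ← Finset.expect_product', Finset.univ_product_univ]
    refine Fintype.expect_equiv (Equiv.funSplitAt j α) _ _ fun y => ?_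
    rw [Prod.mk.eta, Equiv.symm_apply_apply]
  rw [h, h f]
  refine Finset.expect_congr rfl fun b _ => ?_
  have h2 : ∀ a a', Function.update ((Equiv.funSplitAt j α).symm (a, b)) j a' =
      (Equiv.funSplitAt j α).symm (a', b) := fun a a' => by
    funext i
    by_cases hi : i = j
    · subst hi; simp [Equiv.funSplitAt, Equiv.piSplitAt]
    · simp [Equiv.funSplitAt, Equiv.piSplitAt, hi]
  simp only [h2]
  rw [Fintype.expect_const]

end Average

/-! ### A leftover hash lemma for many instances -/

section LeftoverHash

variable {ι X Y G : Type*} [Fintype ι] [DecidableEq ι] [DecidableEq X] [Fintype Y]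
  [DecidableEq Y] [Fintype G] [Nonempty G]

theorem expect_collision_le {h : G → X → Y}
    (hu : ∀ x y, x ≠ y → (𝔼 g, if h g x = h g y then (1 : ℝ) else 0) ≤ (Fintype.card Y : ℝ)⁻¹)
    (J : Finset ι) (x x' : ι → X) :
    (𝔼 p : ι → G, if ∀ j ∈ J, h (p j) (x j) = h (p j) (x' j) then (1 : ℝ) else 0) ≤
      ∑ I ∈ J.powerset, (if ∀ j ∈ I, x j = x' j then (1 : ℝ) else 0) *
        (Fintype.card Y : ℝ)⁻¹ ^ (J.card - I.card) := by
  have h1 : ∀ p : ι → G, (if ∀ j ∈ J, h (p j) (x j) = h (p j) (x' j) then (1 : ℝ) else 0) =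
      ∏ j ∈ J, if h (p j) (x j) = h (p j) (x' j) then (1 : ℝ) else 0 := fun p => by
    rw [Finset.prod_boole]
    congr
  simp only [h1]
  rw [expect_pi_prod J fun j g => if h g (x j) = h g (x' j) then (1 : ℝ) else 0]
  refine (Finset.prod_le_prod (fun j _ => Finset.expect_nonneg fun g _ => by split_ifs <;> simp)
    fun j _ => show _ ≤ (if x j = x' j then (1 : ℝ) else 0) + (Fintype.card Y : ℝ)⁻¹ from ?_).trans
    (le_of_eq ?_)
  · by_cases hx : x j = x' j
    · simp only [hx, if_true]
      rw [Fintype.expect_const]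
      simp
    · simpa [hx] using hu _ _ hx
  · rw [Finset.prod_add]
    refine Finset.sum_congr rfl fun I hI => ?_
    rw [Finset.prod_boole, Finset.prod_const,
      Finset.card_sdiff_of_subset (Finset.mem_powerset.1 hI)]
    congr

theorem abs_hash_sub_uniform_le [Fintype X] [Nonempty Y] {h : G → X → Y}
    (hu : ∀ x y, x ≠ y → (𝔼 g, if h g x = h g y then (1 : ℝ) else 0) ≤ (Fintype.card Y : ℝ)⁻¹)
    (J : Finset ι) {v : (ι → X) → ℝ} (hv : ∀ x, 0 ≤ v x) {θ : ℝ}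
    (hd : ∀ I ⊆ J, ∀ b : ι → X, (∑ x, if ∀ i ∈ I, x i = b i then v x else 0) ≤
      θ ^ I.card * ∑ x, v x)
    {F : (ι → G) → (J → Y) → ℝ} (hF : ∀ p y, |F p y| ≤ 1) :
    |(∑ x, v x * 𝔼 p, F p fun j => h (p j) (x j)) - (∑ x, v x) * 𝔼 p, 𝔼 y, F p y| ≤
      (∑ x, v x) * √((1 + Fintype.card Y * θ) ^ J.card - 1) := by
  set M := ∑ x, v x with hM
  have hM0 : 0 ≤ M := Finset.sum_nonneg fun x _ => hv x
  set c : ℝ := (Fintype.card Y : ℝ) ^ J.card with hc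
  have hY : (0 : ℝ) < Fintype.card Y := by exact_mod_cast Fintype.card_pos
  have hc0 : 0 < c := by positivity
  have hcard : (Fintype.card (J → Y) : ℝ) = c := by simp [hc]
  let π : (ι → G) → (ι → X) → J → Y := fun p x j => h (p j) (x j)
  let N : (ι → G) → (J → Y) → ℝ := fun p y => ∑ x, if π p x = y then v x else 0
  have hNF : ∀ p, ∑ x, v x * F p (π p x) = ∑ y, N p y * F p y := fun p => by
    simp only [N, Finset.sum_mul, ite_mul, zero_mul]
    rw [Finset.sum_comm]
    simp
  have hN1 : ∀ p, ∑ y, N p y = M := fun p => by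
    simp only [N]
    rw [Finset.sum_comm]
    simp [hM]
  have hN2 : ∀ p, ∑ y, N p y ^ 2 = ∑ x, ∑ x', v x * v x' * if π p x = π p x' then 1 else 0 := by
    intro p
    have : ∀ y, N p y ^ 2 = ∑ x, ∑ x', (if π p x = y then v x else 0) *
        (if π p x' = y then v x' else 0) := fun y => by
      rw [sq, Finset.sum_mul_sum]
    simp only [this]
    rw [Finset.sum_comm]
    refine Finset.sum_congr rfl fun x _ => ?_
    rw [Finset.sum_comm]
    refine Finset.sum_congr rfl fun x' _ => ?_
    simp only [ite_mul, zero_mul]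
    rw [Finset.sum_ite_eq]
    simp [eq_comm]
  have hEN : (𝔼 p, ∑ y, N p y ^ 2) ≤ M ^ 2 * (θ + (Fintype.card Y : ℝ)⁻¹) ^ J.card := by
    simp only [hN2]
    calc (𝔼 p, ∑ x, ∑ x', v x * v x' * if π p x = π p x' then (1 : ℝ) else 0)
        = ∑ x, ∑ x', v x * v x' *
            𝔼 p : ι → G, if ∀ j ∈ J, h (p j) (x j) = h (p j) (x' j) then (1 : ℝ) else 0 := by
          rw [Finset.expect_sum_comm]
          refine Finset.sum_congr rfl fun x _ => ?_
          rw [Finset.expect_sum_comm]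
          refine Finset.sum_congr rfl fun x' _ => ?_
          rw [Finset.mul_expect]
          refine Finset.expect_congr rfl fun p _ => ?_
          congr 2
          simp [π, funext_iff]
      _ ≤ ∑ x, ∑ x', v x * v x' *
            ∑ I ∈ J.powerset, (if ∀ j ∈ I, x j = x' j then (1 : ℝ) else 0) *
              (Fintype.card Y : ℝ)⁻¹ ^ (J.card - I.card) := by
          gcongr with x _ x' _
          · exact mul_nonneg (hv x) (hv x')
          · exact expect_collision_le hu J x x'
      _ = ∑ I ∈ J.powerset, (Fintype.card Y : ℝ)⁻¹ ^ (J.card - I.card) *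
            ∑ x, v x * ∑ x', if ∀ j ∈ I, x' j = x j then v x' else 0 := by
          simp only [Finset.mul_sum]
          rw [Finset.sum_congr rfl fun x _ => Finset.sum_comm]
          rw [Finset.sum_comm]
          refine Finset.sum_congr rfl fun I _ => Finset.sum_congr rfl fun x _ =>
            Finset.sum_congr rfl fun x' _ => ?_
          have : (∀ j ∈ I, x j = x' j) ↔ ∀ j ∈ I, x' j = x j := by simp only [eq_comm]
          simp only [this]
          split_ifs <;> ring
      _ ≤ ∑ I ∈ J.powerset, (Fintype.card Y : ℝ)⁻¹ ^ (J.card - I.card) *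
            ∑ x, v x * (θ ^ I.card * M) := by
          gcongr with I hI x _
          · exact hv x
          · exact hd I (Finset.mem_powerset.1 hI) x
      _ = M ^ 2 * (θ + (Fintype.card Y : ℝ)⁻¹) ^ J.card := by
          rw [← Finset.sum_pow_mul_eq_add_pow, Finset.mul_sum]
          refine Finset.sum_congr rfl fun I _ => ?_
          rw [← Finset.sum_mul, ← hM]
          ring
  let D : (ι → G) → ℝ := fun p => ∑ y, |N p y - M * c⁻¹|
  have hD : ∀ p, |∑ x, v x * F p (π p x) - M * 𝔼 y, F p y| ≤ D p := fun p => by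
    have : M * 𝔼 y, F p y = ∑ y, M * c⁻¹ * F p y := by
      rw [Fintype.expect_eq_sum_div_card, hcard, ← Finset.mul_sum, div_eq_inv_mul, mul_assoc]
    rw [hNF, this, ← Finset.sum_sub_distrib]
    refine (Finset.abs_sum_le_sum_abs _ _).trans (Finset.sum_le_sum fun y _ => ?_)
    rw [← sub_mul, abs_mul]
    exact mul_le_of_le_one_right (abs_nonneg _) (hF p y)
  have hD2 : ∀ p, D p ^ 2 ≤ c * ∑ y, N p y ^ 2 - M ^ 2 := fun p => by
    have h1 := sq_sum_le_card_mul_sum_sq (s := Finset.univ) (f := fun y => |N p y - M * c⁻¹|)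
    rw [Finset.card_univ, hcard] at h1
    refine h1.trans (le_of_eq ?_)
    have h2 : ∀ y, |N p y - M * c⁻¹| ^ 2 = N p y ^ 2 - 2 * (M * c⁻¹) * N p y + (M * c⁻¹) ^ 2 :=
      fun y => by rw [sq_abs]; ring
    simp only [h2, Finset.sum_add_distrib, Finset.sum_sub_distrib, ← Finset.mul_sum, hN1]
    rw [Finset.sum_const, Finset.card_univ, nsmul_eq_mul, hcard]
    field_simp
    ring
  have hED : (𝔼 p, D p) ^ 2 ≤ M ^ 2 * ((1 + Fintype.card Y * θ) ^ J.card - 1) := by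
    calc (𝔼 p, D p) ^ 2 ≤ 𝔼 p, D p ^ 2 := by
          have := Finset.expect_mul_sq_le_sq_mul_sq Finset.univ D fun _ => (1 : ℝ)
          simpa using this
      _ ≤ 𝔼 p, (c * ∑ y, N p y ^ 2 - M ^ 2) := Finset.expect_le_expect fun p _ => hD2 p
      _ = c * (𝔼 p, ∑ y, N p y ^ 2) - M ^ 2 := by
          rw [Finset.expect_sub_distrib, ← Finset.mul_expect, Fintype.expect_const]
      _ ≤ c * (M ^ 2 * (θ + (Fintype.card Y : ℝ)⁻¹) ^ J.card) - M ^ 2 := by gcongr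
      _ = M ^ 2 * ((1 + Fintype.card Y * θ) ^ J.card - 1) := by
          have : 1 + Fintype.card Y * θ = Fintype.card Y * (θ + (Fintype.card Y : ℝ)⁻¹) := by
            field_simp
            ring
          rw [this, mul_pow]
          ring
  have hsum : (∑ x, v x * 𝔼 p, F p fun j => h (p j) (x j)) - M * 𝔼 p, 𝔼 y, F p y =
      𝔼 p, (∑ x, v x * F p (π p x) - M * 𝔼 y, F p y) := by
    rw [Finset.expect_sub_distrib, Finset.expect_sum_comm, ← Finset.mul_expect]
    simp only [← Finset.mul_expect]
    rfl
  rw [hsum]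
  calc _ ≤ 𝔼 p, |∑ x, v x * F p (π p x) - M * 𝔼 y, F p y| := Finset.abs_expect_le _ _
    _ ≤ 𝔼 p, D p := Finset.expect_le_expect fun p _ => hD p
    _ ≤ √(M ^ 2 * ((1 + Fintype.card Y * θ) ^ J.card - 1)) := Real.le_sqrt_of_sq_le hED
    _ = M * √((1 + Fintype.card Y * θ) ^ J.card - 1) := by
        rw [Real.sqrt_mul (sq_nonneg M), Real.sqrt_sq hM0]

end LeftoverHash

end MILR

end

noncomputable section

namespace MILR

open scoped BigOperators

/-! ### Decomposition of leaky sources into dense sources -/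

section Decomposition

variable {ι X : Type*} [Fintype ι] [DecidableEq ι] [Fintype X] [DecidableEq X]

theorem expect_agree [Nonempty X] (I : Finset ι) (a : ι → X) :
    (𝔼 x : ι → X, if ∀ i ∈ I, x i = a i then (1 : ℝ) else 0) =
      (Fintype.card X : ℝ)⁻¹ ^ I.card := by
  have h1 : ∀ x : ι → X, (if ∀ i ∈ I, x i = a i then (1 : ℝ) else 0) =
      ∏ i ∈ I, if x i = a i then (1 : ℝ) else 0 := fun x => by
    rw [Finset.prod_boole]
    congr
  simp only [h1]
  rw [expect_pi_prod I fun i x => if x = a i then (1 : ℝ) else 0]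
  simp

theorem sum_agree_le [Nonempty X] (I : Finset ι) (a : ι → X) {w : (ι → X) → ℝ}
    (hw : ∀ x, w x ≤ (Fintype.card X : ℝ)⁻¹ ^ Fintype.card ι) :
    (∑ x, if ∀ i ∈ I, x i = a i then w x else 0) ≤ (Fintype.card X : ℝ)⁻¹ ^ I.card := by
  rw [← expect_agree I a, Fintype.expect_eq_sum_div_card, Finset.sum_div]
  refine Finset.sum_le_sum fun x _ => ?_
  split_ifs
  · simpa using hw x
  · simp

/-- The weights `v` are supported on points that agree with `a` on `I`, and every choice of values
of the coordinates in a set `I'` disjoint from `I` has relative weight at most `θ ^ |I'|`. -/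
structure IsDensePiece (θ : ℝ) (I : Finset ι) (a : ι → X) (v : (ι → X) → ℝ) : Prop where
  nonneg : ∀ x, 0 ≤ v x
  agree : ∀ x, v x ≠ 0 → ∀ i ∈ I, x i = a i
  dense : ∀ I' ⊆ Iᶜ, ∀ b : ι → X, (∑ x, if ∀ i ∈ I', x i = b i then v x else 0) ≤
    θ ^ I'.card * ∑ x, v x

/-- The part of `w` on `{x ∈ E | x_I = a_I}` is dense if `I` is a maximal set for which this part has
relative weight at least `θ ^ |I|` in `E`. -/
theorem isDensePiece_of_maximal {w : (ι → X) → ℝ} (hw0 : ∀ x, 0 ≤ w x) {θ : ℝ} (hθ : 0 < θ)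
    {E : Finset (ι → X)} {I : Finset ι} {a : ι → X}
    (hI : θ ^ I.card * ∑ x ∈ E, w x ≤ ∑ x ∈ E with ∀ i ∈ I, x i = a i, w x)
    (hmax : ∀ (I' : Finset ι) (b : ι → X),
      θ ^ I'.card * ∑ x ∈ E, w x ≤ (∑ x ∈ E with ∀ i ∈ I', x i = b i, w x) → I'.card ≤ I.card) :
    IsDensePiece θ I a fun x => if x ∈ E ∧ ∀ i ∈ I, x i = a i then w x else 0 := by
  have hsum : (∑ x, if x ∈ E ∧ ∀ i ∈ I, x i = a i then w x else 0) =
      ∑ x ∈ E with ∀ i ∈ I, x i = a i, w x := by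
    rw [← Finset.sum_filter]
    congr 1
    ext x
    simp
  refine ⟨fun x => ?_, fun x hx => ?_, fun I' hI' b => ?_⟩
  · split_ifs
    · exact hw0 x
    · exact le_rfl
  · by_contra hne
    exact hx (if_neg fun h => hne h.2)
  · rw [hsum]
    rcases I'.eq_empty_or_nonempty with rfl | hne
    · simp [← hsum]
    · have hdisj : Disjoint I I' := by
        rw [Finset.disjoint_left]
        intro i hi hi'
        exact (Finset.mem_compl.1 (hI' hi')) hi
      have h1 : (∑ x, if ∀ i ∈ I', x i = b i then
            (if x ∈ E ∧ ∀ i ∈ I, x i = a i then w x else 0) else 0) =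
          ∑ x ∈ E with ∀ i ∈ I ∪ I', x i = (if i ∈ I then a i else b i), w x := by
        simp only [← ite_and]
        rw [← Finset.sum_filter]
        congr 1
        ext x
        simp only [Finset.mem_filter, Finset.mem_univ, true_and, Finset.mem_union]
        constructor
        · rintro ⟨hb, hE, ha⟩
          refine ⟨hE, fun i hi => ?_⟩
          split_ifs with h
          · exact ha i h
          · exact hb i (hi.resolve_left h)
        · rintro ⟨hE, h⟩
          refine ⟨fun i hi => ?_, hE, fun i hi => ?_⟩
          · have := h i (Or.inr hi)
            rwa [if_neg (Finset.disjoint_right.1 hdisj hi)] at this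
          · have := h i (Or.inl hi)
            rwa [if_pos hi] at this
      rw [h1]
      by_contra hlt
      push Not at hlt
      have h2 := hmax (I ∪ I') (fun i => if i ∈ I then a i else b i) (by
        rw [Finset.card_union_of_disjoint hdisj, pow_add]
        refine le_trans ?_ hlt.le
        rw [mul_comm (θ ^ I.card), mul_assoc]
        gcongr)
      rw [Finset.card_union_of_disjoint hdisj] at h2
      have := hne.card_pos
      omega

/-- A family `w` of weights, each at most the uniform one, can be split into pieces that are fixed in
the coordinates of a set `I` and dense in the others, up to a part of small total weight. The
function `I` does not depend on the test `Φ`. -/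
theorem exists_dense_decomposition [Nonempty X] {w : (ι → X) → ℝ} (hw0 : ∀ x, 0 ≤ w x)
    (hw : ∀ x, w x ≤ (Fintype.card X : ℝ)⁻¹ ^ Fintype.card ι) {θ ε : ℝ} (hθ : 0 < θ)
    (hθq : θ ^ 2 = (Fintype.card X : ℝ)⁻¹) (hε : 0 < ε) (hε1 : ε ≤ 1) :
    ∃ I : (ι → X) → Finset ι, (∀ x, ε ≤ θ ^ (I x).card) ∧
      ∀ (Φ : (ι → X) → Finset ι → ℝ) (δ : ℝ), 0 ≤ δ → (∀ x I, |Φ x I| ≤ 1) →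
        (∀ I a v, IsDensePiece θ I a v → |∑ x, v x * Φ x I| ≤ δ * ∑ x, v x) →
        |∑ x, w x * Φ x (I x)| ≤ δ * ∑ x, w x + ε := by
  suffices h : ∀ E : Finset (ι → X), ∃ I : (ι → X) → Finset ι, (∀ x, ε ≤ θ ^ (I x).card) ∧
      ∀ (Φ : (ι → X) → Finset ι → ℝ) (δ : ℝ), 0 ≤ δ → (∀ x I, |Φ x I| ≤ 1) →
        (∀ I a v, IsDensePiece θ I a v → |∑ x, v x * Φ x I| ≤ δ * ∑ x, v x) →
        |∑ x ∈ E, w x * Φ x (I x)| ≤ δ * ∑ x ∈ E, w x + ε from h Finset.univ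
  intro E
  induction E using Finset.strongInduction with
  | H E ih =>
  rcases le_or_gt (∑ x ∈ E, w x) ε with hE | hE
  · refine ⟨fun _ => ∅, fun x => by simpa using hε1, fun Φ δ hδ hΦ _ => ?_⟩
    calc |∑ x ∈ E, w x * Φ x ∅| ≤ ∑ x ∈ E, |w x * Φ x ∅| := Finset.abs_sum_le_sum_abs _ _
      _ ≤ ∑ x ∈ E, w x := Finset.sum_le_sum fun x _ => by
        rw [abs_mul, abs_of_nonneg (hw0 x)]
        exact mul_le_of_le_one_right (hw0 x) (hΦ _ _)
      _ ≤ δ * ∑ x ∈ E, w x + ε := by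
        have : 0 ≤ δ * ∑ x ∈ E, w x := mul_nonneg hδ (Finset.sum_nonneg fun x _ => hw0 x)
        linarith
  · let S : Finset (Finset ι) := {I | ∃ a : ι → X,
      θ ^ I.card * ∑ x ∈ E, w x ≤ ∑ x ∈ E with ∀ i ∈ I, x i = a i, w x}
    have hS : S.Nonempty := ⟨∅, by simp [S]⟩
    obtain ⟨I, hIS, hmax⟩ := S.exists_max_image Finset.card hS
    obtain ⟨a, ha⟩ := (Finset.mem_filter.1 hIS).2
    have hpiece := isDensePiece_of_maximal hw0 hθ ha fun I' b h' =>
      hmax I' (Finset.mem_filter.2 ⟨Finset.mem_univ _, b, h'⟩)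
    set A : Finset (ι → X) := E.filter fun x => ∀ i ∈ I, x i = a i with hA
    have hApos : 0 < ∑ x ∈ A, w x := lt_of_lt_of_le (by have := hε.trans hE; positivity) ha
    have hAne : A.Nonempty := by
      by_contra hne
      rw [Finset.not_nonempty_iff_eq_empty] at hne
      simp [hne] at hApos
    have hAE : A ⊆ E := Finset.filter_subset _ _
    obtain ⟨I₀, hcard, hI₀⟩ := ih (E \ A) (Finset.sdiff_ssubset hAE hAne)
    have hsize : ε ≤ θ ^ I.card := by
      have h1 : ∑ x ∈ A, w x ≤ θ ^ I.card * θ ^ I.card := by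
        rw [← pow_add, ← two_mul, pow_mul, hθq]
        refine le_trans ?_ (sum_agree_le I a hw)
        rw [← Finset.sum_filter]
        exact Finset.sum_le_sum_of_subset_of_nonneg
          (Finset.filter_subset_filter _ (Finset.subset_univ _)) fun x _ _ => hw0 x
      have h2 : θ ^ I.card * ε ≤ θ ^ I.card * θ ^ I.card :=
        (mul_le_mul_of_nonneg_left hE.le (by positivity)).trans (ha.trans h1)
      exact le_of_mul_le_mul_left h2 (by positivity)
    refine ⟨fun x => if x ∈ A then I else I₀ x, fun x => ?_, fun Φ δ hδ hΦ hdense => ?_⟩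
    · dsimp only
      split_ifs
      · exact hsize
      · exact hcard x
    · have h1 := hI₀ Φ δ hδ hΦ hdense
      have h2 := hdense I a _ hpiece
      have h3 : ∀ f : (ι → X) → ℝ, (∑ x, (if x ∈ E ∧ ∀ i ∈ I, x i = a i then w x else 0) * f x) =
          ∑ x ∈ A, w x * f x := fun f => by
        simp only [ite_mul, zero_mul]
        rw [← Finset.sum_filter]
        congr 1
        ext x
        simp [hA]
      have h4 := h3 fun _ => 1
      simp only [mul_one] at h4
      rw [h3, h4] at h2
      have h5 : ∑ x ∈ E, w x * Φ x (if x ∈ A then I else I₀ x) =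
          ∑ x ∈ E \ A, w x * Φ x (I₀ x) + ∑ x ∈ A, w x * Φ x I := by
        rw [← Finset.sum_sdiff hAE]
        congr 1
        · refine Finset.sum_congr rfl fun x hx => ?_
          rw [if_neg (Finset.mem_sdiff.1 hx).2]
        · refine Finset.sum_congr rfl fun x hx => ?_
          rw [if_pos hx]
      rw [h5, ← Finset.sum_sdiff hAE, mul_add]
      refine (abs_add_le _ _).trans ?_
      linarith

end Decomposition

end MILR

end

noncomputable section

namespace MILR

open scoped BigOperators

/-! ### Experiments as averages -/

theorem prOne_bind {α : Type} [Fintype α] (μ : PMF α) (f : α → PMF (List Bool)) :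
    prOne (μ.bind f) = ∑ a, (μ a).toReal * prOne (f a) := by
  rw [prOne, PMF.bind_apply, tsum_fintype, ENNReal.toReal_sum]
  · simp only [ENNReal.toReal_mul, prOne]
  · exact fun a _ => ENNReal.mul_ne_top (PMF.apply_ne_top _ _) (PMF.apply_ne_top _ _)

theorem prOne_bind_uniform {α : Type} [Fintype α] [Nonempty α] (f : α → PMF (List Bool)) :
    prOne ((PMF.uniformOfFintype α).bind f) = 𝔼 a, prOne (f a) := by
  rw [prOne_bind, Fintype.expect_eq_sum_div_card, Finset.sum_div]
  refine Finset.sum_congr rfl fun a _ => ?_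
  rw [PMF.uniformOfFintype_apply, ENNReal.toReal_inv, ENNReal.toReal_natCast, inv_mul_eq_div]

theorem uniformOfFintype_bind_map {α β γ : Type} [Fintype α] [Nonempty α] [Fintype β] [Nonempty β]
    [Fintype γ] [Nonempty γ] (e : α × β ≃ γ) :
    (PMF.uniformOfFintype α).bind (fun a => (PMF.uniformOfFintype β).map fun b => e (a, b)) =
      PMF.uniformOfFintype γ := by
  ext c
  obtain ⟨⟨a, b⟩, rfl⟩ := e.surjective c
  simp only [PMF.bind_apply, PMF.map_apply, PMF.uniformOfFintype_apply, tsum_fintype,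
    EmbeddingLike.apply_eq_iff_eq, Prod.mk.injEq]
  rw [Finset.sum_eq_single a, Finset.sum_eq_single b]
  · simp only [if_true]
    rw [← ENNReal.mul_inv, ← Fintype.card_congr e, Fintype.card_prod, Nat.cast_mul] <;> simp
  · intro b' _ hb'
    simp [Ne.symm hb']
  · simp
  · intro a' _ ha'
    simp [Ne.symm ha']
  · simp

theorem iid_uniform (m n : ℕ) :
    iid (uniformBits m) n = PMF.uniformOfFintype (Fin n → BitStr m) := by
  induction n with
  | zero =>
    ext v
    rw [iid, PMF.uniformOfFintype_apply, Subsingleton.elim v Fin.elim0]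
    simp
  | succ n ih =>
    rw [iid, ih]
    exact uniformOfFintype_bind_map (Fin.consEquiv fun _ => BitStr m)

theorem HashFamily.IsUniversal.expect_le {outLen : ℕ → ℕ} {H : HashFamily outLen}
    (hH : H.IsUniversal) (k : ℕ) (x y : BitStr k) (hxy : x ≠ y) :
    (𝔼 g, if H.hash k g x = H.hash k g y then (1 : ℝ) else 0) ≤
      (Fintype.card (BitStr (outLen k)) : ℝ)⁻¹ := by
  have h := hH.universal k x y hxy
  rw [uniformBits, PMF.toOuterMeasure_uniformOfFintype_apply] at h
  have h2 := ENNReal.toReal_mono (by simp) h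
  rw [ENNReal.toReal_div, ENNReal.toReal_natCast, ENNReal.toReal_natCast] at h2
  rw [Fintype.expect_eq_sum_div_card, Finset.sum_boole]
  rw [Fintype.card_subtype] at h2
  simpa using h2

/-! ### Hybrid experiments -/

/-- The oracle that encrypts under the keys `y`, where the messages for the instances `j` with
`f j = false` are replaced by `0`. -/
def keyOracle (S : EncScheme) {k n : ℕ} (y : Fin n → BitStr k) (f : Fin n → Bool) : Oracle
  | [] => PMF.pure []
  | m :: u =>
    if h : u.length < n then
      (S.enc k (y ⟨u.length, h⟩) (f ⟨u.length, h⟩ && m)).map fun c => List.ofFn c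
    else PMF.pure []

theorem hashedScheme_oracle (S : EncScheme) (H : HashFamily fun k => k / 10) {k n : ℕ}
    (x : Fin n → BitStr k) (p : Fin n → BitStr (H.seedLen k)) (J : Finset (Fin n)) (b : Bool) :
    (hashedScheme S H).oracle x p J b =
      keyOracle S (fun j => H.hash k (p j) (x j)) fun j => if j ∈ J then b else true := by
  funext w
  rcases w with _ | ⟨m, u⟩
  · rfl
  · simp only [Scheme.oracle, keyOracle, hashedScheme]
    split_ifs <;> simp

/-- The keys `y` for the instances in `J` and `a` for the others. -/
def glue {ι Y : Type} {J : Finset ι} [DecidableEq ι] (y : J → Y) (a : ι → Y) : ι → Y :=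
  fun i => if h : i ∈ J then y ⟨i, h⟩ else a i

theorem expect_glue_univ {ι Y : Type} [Fintype ι] [DecidableEq ι] [Fintype Y] (a : ι → Y)
    (F : (ι → Y) → ℝ) :
    (𝔼 y : ↥(Finset.univ : Finset ι) → Y, F (glue y a)) = 𝔼 y : ι → Y, F y := by
  refine Fintype.expect_equiv (Equiv.arrowCongr (Equiv.subtypeUnivEquiv Finset.mem_univ)
    (Equiv.refl Y)) _ _ fun y => ?_
  congr 1
  funext i
  simp [glue, Equiv.arrowCongr]

theorem expect_glue_keyOracle {S : EncScheme} {k n : ℕ} {J : Finset (Fin n)} (hJ : J = Finset.univ)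
    {a : Fin n → BitStr k} (b : Bool) (B : Prog) (inp : List (List Bool)) (t : ℕ) :
    (𝔼 y : ↥J → BitStr k, prOne (output (keyOracle S (glue y a)
      fun j => if j ∈ J then b else true) B inp t)) =
    𝔼 y : Fin n → BitStr k, prOne (output (keyOracle S y fun _ => b) B inp t) := by
  subst hJ
  rw [← expect_glue_univ a]
  simp only [Finset.mem_univ, if_true]

theorem hybrid_le {ι Y : Type} [Fintype ι] [DecidableEq ι] [Fintype Y] [Nonempty Y]
    {D : (ι → Y) → (ι → Bool) → ℝ} {ε : ℝ}
    (h : ∀ j y f, |(𝔼 x, D (Function.update y j x) (Function.update f j false)) -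
      𝔼 x, D (Function.update y j x) (Function.update f j true)| ≤ ε) (J : Finset ι) (a : ι → Y) :
    |(𝔼 y : J → Y, D (glue y a) fun j => if j ∈ J then false else true) -
      𝔼 y : J → Y, D (glue y a) fun j => if j ∈ J then true else true| ≤ J.card * ε := by
  suffices hS : ∀ S : Finset ι, S ⊆ J →
      |(𝔼 y : J → Y, D (glue y a) fun j => if j ∈ J then false else true) -
        𝔼 y : J → Y, D (glue y a) fun j => if j ∈ J then decide (j ∈ S) else true| ≤
        S.card * ε by
    convert hS J le_rfl using 6 with y
    split_ifs with hj <;> simp [hj]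
  intro S
  induction S using Finset.induction_on with
  | empty => simp
  | insert i S hi ih =>
    intro hS
    have hiJ : i ∈ J := hS (Finset.mem_insert_self i S)
    set f : ι → Bool := fun j => if j ∈ J then decide (j ∈ S) else true with hf
    have hf0 : Function.update f i false = f := by
      rw [Function.update_eq_self_iff]
      simp [hf, hiJ, hi]
    have hf1 : Function.update f i true =
        fun j => if j ∈ J then decide (j ∈ insert i S) else true := by
      funext j
      by_cases hj : j = i
      · subst hj; simp
      · simp [hj, hf]
    have hg : ∀ g : ι → Bool, (𝔼 y : J → Y, D (glue y a) g) =
        𝔼 y : J → Y, 𝔼 x, D (Function.update (glue y a) i x) g := fun g => by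
      rw [← expect_update (⟨i, hiJ⟩ : J) fun y => D (glue y a) g]
      refine Finset.expect_congr rfl fun y _ => Finset.expect_congr rfl fun x _ => ?_
      congr 1
      funext j
      by_cases hj : j = i
      · subst hj; simp [glue, hiJ]
      · by_cases hjJ : j ∈ J <;> simp [glue, hj, hjJ]
    have hstep : |(𝔼 y : J → Y, D (glue y a) f) -
        𝔼 y : J → Y, D (glue y a) (Function.update f i true)| ≤ ε := by
      rw [hg f, hg (Function.update f i true), ← Finset.expect_sub_distrib]
      refine abs_expect_le_of_forall fun y => ?_
      have := h i (glue y a) f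
      rwa [hf0] at this
    rw [hf1] at hstep
    have := ih ((Finset.subset_insert i S).trans hS)
    rw [Finset.card_insert_of_notMem hi]
    push_cast
    refine (abs_sub_le _ _ _).trans ((add_le_add this hstep).trans (by linarith))

/-! ### Security of dense pieces -/

/-- The square root of `2⁻ᵏ`. -/
def theta (k : ℕ) : ℝ := √((2 ^ k : ℝ)⁻¹)

theorem theta_pos (k : ℕ) : 0 < theta k := Real.sqrt_pos.2 (by positivity)

theorem theta_sq (k : ℕ) : theta k ^ 2 = (Fintype.card (BitStr k) : ℝ)⁻¹ := by
  rw [theta, Real.sq_sqrt (by positivity)]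
  simp

theorem theta_le_one (k : ℕ) : theta k ≤ 1 := by
  rw [theta, Real.sqrt_le_one, inv_le_one_iff₀]
  exact Or.inr (one_le_pow₀ (by norm_num))

/-- The error of the leftover hash lemma for `n` instances. -/
def hashError (k n : ℕ) : ℝ := √((1 + 2 ^ (k / 10) * theta k) ^ n - 1)

theorem one_le_hashBase (k : ℕ) : 1 ≤ 1 + 2 ^ (k / 10) * theta k := by
  have := theta_pos k
  have : 0 ≤ 2 ^ (k / 10) * theta k := by positivity
  linarith

theorem abs_piece_le {S : EncScheme} {H : HashFamily fun k => k / 10} (hH : H.IsUniversal)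
    {k n : ℕ} {v : (Fin n → BitStr k) → ℝ} {I : Finset (Fin n)} {a : Fin n → BitStr k}
    (hv : IsDensePiece (theta k) I a v) (B : Prog) (t : ℕ)
    (inp : (Fin n → BitStr (H.seedLen k)) → List (List Bool)) {η : ℝ}
    (hη : |𝔼 p : Fin n → BitStr (H.seedLen k),
      ((𝔼 y : ↥(Iᶜ) → BitStr (k / 10), prOne (output (keyOracle S
          (glue y fun j => H.hash k (p j) (a j)) fun j => if j ∈ Iᶜ then false else true)
          B (inp p) t)) -
        𝔼 y : ↥(Iᶜ) → BitStr (k / 10), prOne (output (keyOracle S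
          (glue y fun j => H.hash k (p j) (a j)) fun j => if j ∈ Iᶜ then true else true)
          B (inp p) t))| ≤ η) :
    |∑ x, v x * 𝔼 p : Fin n → BitStr (H.seedLen k),
      (prOne (output ((hashedScheme S H).oracle x p Iᶜ false) B (inp p) t) -
        prOne (output ((hashedScheme S H).oracle x p Iᶜ true) B (inp p) t))| ≤
      (hashError k n + η) * ∑ x, v x := by
  let F : (Fin n → BitStr (H.seedLen k)) → (↥(Iᶜ) → BitStr (k / 10)) → ℝ := fun p y =>
    prOne (output (keyOracle S (glue y fun j => H.hash k (p j) (a j))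
      fun j => if j ∈ Iᶜ then false else true) B (inp p) t) -
    prOne (output (keyOracle S (glue y fun j => H.hash k (p j) (a j))
      fun j => if j ∈ Iᶜ then true else true) B (inp p) t)
  have h1 := abs_hash_sub_uniform_le (hH.expect_le k) Iᶜ hv.nonneg hv.dense (F := F)
    fun p y => abs_prOne_sub_le _ _
  have h2 : ∀ x, v x * 𝔼 p : Fin n → BitStr (H.seedLen k),
      (prOne (output ((hashedScheme S H).oracle x p Iᶜ false) B (inp p) t) -
        prOne (output ((hashedScheme S H).oracle x p Iᶜ true) B (inp p) t)) =
      v x * 𝔼 p, F p fun j => H.hash k (p j) (x j) := fun x => by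
    by_cases hx : v x = 0
    · simp [hx]
    · congr 1
      refine Finset.expect_congr rfl fun p _ => ?_
      have hg : (glue (J := Iᶜ) (fun j => H.hash k (p j) (x j)) fun j => H.hash k (p j) (a j)) =
          fun j => H.hash k (p j) (x j) := by
        funext j
        by_cases hj : j ∈ Iᶜ
        · simp only [glue, dif_pos hj]
        · simp only [glue, dif_neg hj]
          rw [hv.agree x hx j (by simpa using hj)]
      simp only [F, hg, hashedScheme_oracle]
  simp only [h2]
  have hM : 0 ≤ ∑ x, v x := Finset.sum_nonneg fun x _ => hv.nonneg x
  have h3 : |𝔼 p, 𝔼 y, F p y| ≤ η := by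
    simpa only [F, Finset.expect_sub_distrib] using hη
  have h4 : √((1 + (Fintype.card (BitStr (k / 10)) : ℝ) * theta k) ^ (Iᶜ).card - 1) ≤
      hashError k n := by
    refine Real.sqrt_le_sqrt ?_
    have : (Fintype.card (BitStr (k / 10)) : ℝ) = 2 ^ (k / 10) := by simp
    rw [this]
    have := pow_le_pow_right₀ (one_le_hashBase k) ((Finset.card_le_univ Iᶜ).trans_eq
      (Fintype.card_fin n))
    linarith
  calc _ ≤ (∑ x, v x) * √((1 + (Fintype.card (BitStr (k / 10)) : ℝ) * theta k) ^ (Iᶜ).card - 1) +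
        |(∑ x, v x) * 𝔼 p, 𝔼 y, F p y| := by
        have := abs_sub_abs_le_abs_sub (∑ x, v x * 𝔼 p, F p fun j => H.hash k (p j) (x j))
          ((∑ x, v x) * 𝔼 p, 𝔼 y, F p y)
        linarith
    _ ≤ (∑ x, v x) * hashError k n + (∑ x, v x) * η := by
        rw [abs_mul, abs_of_nonneg hM]
        gcongr
    _ = _ := by ring

theorem isDensePiece_uniform (k n : ℕ) (a : Fin n → BitStr k) :
    IsDensePiece (theta k) ∅ a fun _ => (Fintype.card (Fin n → BitStr k) : ℝ)⁻¹ := by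
  refine ⟨fun x => by positivity, by simp, fun I _ b => ?_⟩
  have h1 : (∑ _x : Fin n → BitStr k, (Fintype.card (Fin n → BitStr k) : ℝ)⁻¹) = 1 := by simp
  rw [h1, mul_one]
  refine (sum_agree_le I b fun x => by simp).trans ?_
  rw [← theta_sq, ← pow_mul]
  exact pow_le_pow_of_le_one (theta_pos k).le (theta_le_one k) (by omega)

theorem abs_multiExperiment_le {S : EncScheme} {H : HashFamily fun k => k / 10}
    (hH : H.IsUniversal) {k n : ℕ} (B : Prog) (t : ℕ) {η : ℝ}
    (hη : |𝔼 p : Fin n → BitStr (H.seedLen k),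
      ((𝔼 y : Fin n → BitStr (k / 10), prOne (output (keyOracle S y fun _ => false) B
          [unary k, encodeSeq p] t)) -
        𝔼 y : Fin n → BitStr (k / 10), prOne (output (keyOracle S y fun _ => true) B
          [unary k, encodeSeq p] t))| ≤ η) :
    |prOne ((hashedScheme S H).multiExperiment k n B t false) -
      prOne ((hashedScheme S H).multiExperiment k n B t true)| ≤ hashError k n + η := by
  have h0 := abs_piece_le (S := S) hH (isDensePiece_uniform k n fun _ _ => false) B t
    (fun p => [unary k, encodeSeq p]) (η := η)
  simp only [expect_glue_keyOracle Finset.compl_empty] at h0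
  have h := h0 hη
  have h1 : (∑ _x : Fin n → BitStr k, (Fintype.card (Fin n → BitStr k) : ℝ)⁻¹) = 1 := by simp
  rw [h1, mul_one, Finset.compl_empty] at h
  refine le_trans (le_of_eq ?_) h
  have h2 : ∀ b, prOne ((hashedScheme S H).multiExperiment k n B t b) =
      𝔼 x : Fin n → BitStr k, 𝔼 p : Fin n → BitStr (H.seedLen k),
        prOne (output ((hashedScheme S H).oracle x p Finset.univ b) B [unary k, encodeSeq p] t) := by
    intro b
    have e : (hashedScheme S H).multiExperiment k n B t b =
        (PMF.uniformOfFintype (Fin n → BitStr k)).bind fun x =>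
          (PMF.uniformOfFintype (Fin n → BitStr (H.seedLen k))).bind fun p =>
            output ((hashedScheme S H).oracle x p Finset.univ b) B [unary k, encodeSeq p] t := by
      rw [← iid_uniform, ← iid_uniform]
      rfl
    rw [e, prOne_bind_uniform]
    refine Finset.expect_congr rfl fun x _ => ?_
    exact prOne_bind_uniform _
  rw [h2, h2, ← Finset.expect_sub_distrib]
  congr 1
  rw [Fintype.expect_eq_sum_div_card, Finset.sum_div]
  refine Finset.sum_congr rfl fun x _ => ?_
  rw [div_eq_inv_mul, Finset.expect_sub_distrib]

theorem negligibleIn_hashError {Γ : ℕ → ℝ} (hΓ : Tendsto Γ atTop atTop)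
    (hup : ∃ g : ℕ → ℝ, g =o[atTop] (fun k : ℕ => (k : ℝ)) ∧ ∀ᶠ k : ℕ in atTop, Γ k ≤ (2 : ℝ) ^ g k)
    {n : ℕ → ℕ} (hn : PolyIn Γ n) : NegligibleIn Γ fun k => hashError k (n k) := by
  have h1 : NegligibleIn Γ fun k => (2 * n k : ℕ) * (2 : ℝ) ^ (-((1 / 5 : ℝ) * k)) :=
    (negligibleIn_exp hΓ hup (by norm_num)).poly_mul hΓ (fun k => by positivity)
      (.mul (.const hΓ 2) hn)
  have h2 : NegligibleIn Γ fun k => (n k : ℕ) * (2 : ℝ) ^ (-((2 / 5 : ℝ) * k)) :=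
    (negligibleIn_exp hΓ hup (by norm_num)).poly_mul hΓ (fun k => by positivity) hn
  have h3 := (h2 0).eventually (ge_mem_nhds (show (0 : ℝ) < 1 by norm_num))
  refine h1.mono hΓ (Eventually.of_forall fun k => Real.sqrt_nonneg _) ?_
  filter_upwards [h3] with k hk
  simp only [pow_zero, one_mul] at hk
  set e : ℝ := (2 : ℝ) ^ (-((2 / 5 : ℝ) * k)) with he
  have he0 : 0 < e := by positivity
  have hbase : 2 ^ (k / 10) * theta k ≤ e := by
    have ht : theta k = (2 : ℝ) ^ (-((1 / 2 : ℝ) * k)) := by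
      rw [theta, Real.sqrt_eq_rpow, ← Real.rpow_natCast, ← Real.rpow_neg (by norm_num),
        ← Real.rpow_mul (by norm_num)]
      congr 1
      ring
    rw [ht, ← Real.rpow_natCast, ← Real.rpow_add (by norm_num), he]
    refine Real.rpow_le_rpow_of_exponent_le (by norm_num) ?_
    have : ((k / 10 : ℕ) : ℝ) ≤ (k : ℝ) / 10 := Nat.cast_div_le
    linarith
  have hexp : (1 + 2 ^ (k / 10) * theta k) ^ n k - 1 ≤ 2 * (n k * e) := by
    have hb : 1 + 2 ^ (k / 10) * theta k ≤ Real.exp e := by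
      have := Real.add_one_le_exp e
      linarith
    have h4 := pow_le_pow_left₀ (zero_le_one.trans (one_le_hashBase k)) hb (n k)
    rw [← Real.exp_nat_mul] at h4
    have h5 := Real.abs_exp_sub_one_le (x := n k * e) (by rwa [abs_of_nonneg (by positivity)])
    rw [abs_of_nonneg (show (0 : ℝ) ≤ n k * e by positivity)] at h5
    linarith [(abs_le.1 h5).2]
  refine Real.sqrt_le_iff.2 ⟨by positivity, hexp.trans ?_⟩
  have he2 : e = ((2 : ℝ) ^ (-((1 / 5 : ℝ) * k))) ^ 2 := by
    rw [he, ← Real.rpow_natCast, ← Real.rpow_mul (by norm_num)]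
    congr 1
    push_cast
    ring
  rw [mul_pow, ← he2, ← mul_assoc]
  refine mul_le_mul_of_nonneg_right ?_ he0.le
  have : (n k : ℝ) ≤ n k ^ 2 := by exact_mod_cast Nat.le_self_pow (by norm_num) (n k)
  push_cast
  nlinarith

end MILR

end

noncomputable section

namespace MILR

open scoped BigOperators

variable {Γ : ℕ → ℝ}

/-! ### Simulation of hybrid experiments -/

/-- The table of the instances with keys `y`, flags `f` and oracle flags `o`. -/
def mkTable {k n : ℕ} (y : Fin n → BitStr k) (f o : Fin n → Bool) : List Entry :=
  List.ofFn fun j => (List.ofFn (y j), f j, o j)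

theorem length_tableStr_mkTable {k n : ℕ} (y : Fin n → BitStr k) (f o : Fin n → Bool) :
    (tableStr (mkTable y f o)).length = n * (2 * (k + 2) + 1) := by
  simp [tableStr, mkTable, List.length_flatMap, List.map_ofFn, Function.comp_def,
    length_encodeStr, entryStr]

/-- The program `P` computes the encryption algorithm for the security parameter `k`. -/
def ComputesEnc (S : EncScheme) (P : Prog) (k t : ℕ) : Prop :=
  ∀ (y : BitStr k) (m : Bool), HaltsWithin noOracle P [List.ofFn y, [m]] t ∧
    output noOracle P [List.ofFn y, [m]] t = (S.enc k y m).map fun c => List.ofFn c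

variable {S : EncScheme} {P : Prog} {k n t : ℕ}

theorem ComputesEnc.halts (hP : ComputesEnc S P k t) (y : Fin n → BitStr k) (f o : Fin n → Bool) :
    ∀ e ∈ mkTable y f o, ∀ b, HaltsWithin noOracle P [e.1, [b]] t := by
  intro e he b
  obtain ⟨j, rfl⟩ := (List.mem_ofFn' _ _).1 he
  exact (hP (y j) b).1

theorem ComputesEnc.length_le (hP : ComputesEnc S P k t) {O : Oracle}
    (hO : ∀ w, ∀ c ∈ (O w).support, c.length ≤ S.ctLen k) (y : Fin n → BitStr k)
    (f o : Fin n → Bool) : ∀ w, ∀ c ∈ (simOracle O (fun key b => output noOracle P [key, [b]] t)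
      (mkTable y f o) w).support, c.length ≤ S.ctLen k := by
  refine length_of_mem_simOracle hO fun e he b c hc => ?_
  obtain ⟨j, rfl⟩ := (List.mem_ofFn' _ _).1 he
  simp only [(hP (y j) b).2, PMF.mem_support_map_iff] at hc
  obtain ⟨c, _, rfl⟩ := hc
  simp

theorem length_of_mem_oracle (x : BitStr k) (b : Bool) :
    ∀ w, ∀ c ∈ (S.oracle k x b w).support, c.length ≤ S.ctLen k := by
  intro w c hc
  rcases w with _ | ⟨m, _ | ⟨m', w⟩⟩ <;> simp only [EncScheme.oracle] at hc
  · simp only [PMF.support_pure, Set.mem_singleton_iff] at hc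
    simp [hc]
  · rw [PMF.mem_support_map_iff] at hc
    obtain ⟨c, _, rfl⟩ := hc
    simp
  · simp only [PMF.support_pure, Set.mem_singleton_iff] at hc
    simp [hc]

theorem ComputesEnc.simOracle_eq (hP : ComputesEnc S P k t) (y : Fin n → BitStr k)
    (f o : Fin n → Bool) (x : BitStr k) (b : Bool) :
    simOracle (S.oracle k x b) (fun key b => output noOracle P [key, [b]] t) (mkTable y f o) =
      keyOracle S (fun j => if o j then x else y j) fun j => if o j then b else f j := by
  funext w
  rcases w with _ | ⟨m, u⟩
  · rfl
  · simp only [simOracle, keyOracle, mkTable, List.getElem?_ofFn]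
    by_cases hu : u.length < n
    · simp only [hu, dif_pos]
      rcases ho : o ⟨u.length, hu⟩
      · simp only [(hP _ _).2]
        simp
      · simp [EncScheme.oracle]
    · simp only [hu, dif_neg, not_false_eq_true]

theorem output_of_le {O : Oracle} {B : Prog} {inp : List (List Bool)} {t t' : ℕ}
    (h : HaltsWithin O B inp t) (ht : t ≤ t') : output O B inp t' = output O B inp t := by
  obtain ⟨d, rfl⟩ := Nat.exists_eq_add_of_le ht
  rw [output, output, Halts.steps_add h]

theorem TimeBounded.mono {B : Prog} {inp : List (List Bool)} {l t t' : ℕ}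
    (h : TimeBounded B inp l t) (ht : t ≤ t') : TimeBounded B inp l t' := fun O hO => by
  have := h O hO
  exact (Runs.mono (Halts.runs this) ht).haltsWithin

/-- Security of a scheme with respect to an adversary for every `k` that attacks the instances for
the security parameter `k / 10`. -/
theorem EncScheme.Secure.negligibleIn_div_ten {kind : AdvKind} (hS : S.Secure kind Γ)
    (hΓ : Tendsto Γ atTop atTop) (hreg : ∃ c : ℕ, Γ =O[atTop] fun k : ℕ => Γ (k / 10) ^ c)
    {R : ℕ → Prog} {T : ℕ → ℕ} (hR : ∀ r < 10, kind.Allows Γ fun k => R (10 * k + r))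
    (hT : PolyIn Γ T)
    (hb : ∀ k, TimeBounded (R k) [unary (k / 10)] (S.ctLen (k / 10)) (T k)) :
    NegligibleIn Γ fun k => |prOne (S.experiment (k / 10) (R k) (T k) false) -
      prOne (S.experiment (k / 10) (R k) (T k) true)| := by
  have h1 : ∀ r < 10, NegligibleIn Γ fun k =>
      |prOne (S.experiment k (R (10 * k + r)) (T (10 * k + r)) false) -
        prOne (S.experiment k (R (10 * k + r)) (T (10 * k + r)) true)| := fun r hr => by
    rw [← negligibleAdvantage_iff hΓ (μ := fun b k =>
      S.experiment k (R (10 * k + r)) (T (10 * k + r)) b)]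
    refine hS _ _ (hR r hr) (hT.comp_mul_ten_add hr hreg) fun k => ?_
    have := hb (10 * k + r)
    rwa [show (10 * k + r) / 10 = k by omega] at this
  have h2 : ∀ m ≤ 10, NegligibleIn Γ fun k => ∑ r ∈ Finset.range m,
      |prOne (S.experiment (k / 10) (R (10 * (k / 10) + r)) (T (10 * (k / 10) + r)) false) -
        prOne (S.experiment (k / 10) (R (10 * (k / 10) + r)) (T (10 * (k / 10) + r)) true)| := by
    intro m
    induction m with
    | zero => intro _ c; simp
    | succ m ih =>
      intro hm
      simp only [Finset.sum_range_succ]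
      exact (ih (by omega)).add ((h1 m (by omega)).div_ten hΓ hreg fun k => abs_nonneg _)
  refine (h2 10 le_rfl).mono hΓ (Eventually.of_forall fun k => abs_nonneg _)
    (Eventually.of_forall fun k => ?_)
  have h3 := Finset.single_le_sum (f := fun r =>
    |prOne (S.experiment (k / 10) (R (10 * (k / 10) + r)) (T (10 * (k / 10) + r)) false) -
      prOne (S.experiment (k / 10) (R (10 * (k / 10) + r)) (T (10 * (k / 10) + r)) true)|)
    (fun r _ => abs_nonneg _) (Finset.mem_range.2 (Nat.mod_lt k (by norm_num : 0 < 10)))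
  simpa only [Nat.div_add_mod] using h3

theorem prOne_experiment (hU : S.UniformKeys) (B : Prog) (t : ℕ) (b : Bool) :
    prOne (S.experiment k B t b) =
      𝔼 x : BitStr k, prOne (output (S.oracle k x b) B [unary k] t) := by
  rw [EncScheme.experiment, hU, uniformBits, prOne_bind_uniform]

/-! ### Security of hybrids against non-uniform adversaries -/

/-- The advantage in distinguishing whether the messages for the instance `j` are replaced by `0`,
when its key is random and the other keys are fixed. -/
def hybridAdvantage (S : EncScheme) {k n : ℕ} (B : Prog) (inp : List (List Bool)) (t : ℕ)
    (j : Fin n) (y : Fin n → BitStr k) (f : Fin n → Bool) : ℝ :=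
  |(𝔼 x, prOne (output (keyOracle S (Function.update y j x) (Function.update f j false)) B inp t)) -
    𝔼 x, prOne (output (keyOracle S (Function.update y j x) (Function.update f j true)) B inp t)|

theorem hardwired_spec (hU : S.UniformKeys) {B : Prog} {inp : List (List Bool)} {L tB : ℕ}
    (hq : P.QueryFree) (hP : ComputesEnc S P k t) (hinp : inp.length ≤ 3)
    (hL : ∀ w ∈ inp, w.length ≤ L) (hB : TimeBounded B inp (S.ctLen k) tB) (j : Fin n)
    (y : Fin n → BitStr k) (f : Fin n → Bool) :
    ∃ R : Prog, R.size ≤ 15 * L + 4 * (n * (2 * (k + 2) + 1)) + 20 +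
        ((querySub P 0 0).size + 30) * B.size ∧
      TimeBounded R [unary k] (S.ctLen k)
        (hardwiredTime P (n * (2 * (k + 2) + 1)) L (S.ctLen k) t tB k) ∧
      hybridAdvantage S B inp tB j y f =
        |prOne (S.experiment k R
            (hardwiredTime P (n * (2 * (k + 2) + 1)) L (S.ctLen k) t tB k) false) -
          prOne (S.experiment k R
            (hardwiredTime P (n * (2 * (k + 2) + 1)) L (S.ctLen k) t tB k) true)| := by
  set o : Fin n → Bool := fun i => decide (i = j) with ho
  have hlen := length_tableStr_mkTable y f o
  refine ⟨hardwired P B inp (tableStr (mkTable y f o)), size_hardwired hlen.le hL, fun O hO =>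
    (runs_hardwired hq hlen.le (hP.halts y f o) (hP.length_le hO y f o) hinp hL hB k).1, ?_⟩
  have h1 : ∀ x b, output (S.oracle k x b) (hardwired P B inp (tableStr (mkTable y f o))) [unary k]
      (hardwiredTime P (n * (2 * (k + 2) + 1)) L (S.ctLen k) t tB k) =
      output (keyOracle S (Function.update y j x) (Function.update f j b)) B inp tB := fun x b => by
    rw [(runs_hardwired hq hlen.le (hP.halts y f o)
      (hP.length_le (length_of_mem_oracle x b) y f o) hinp hL hB k).2, hP.simOracle_eq]
    congr 2 <;> funext i <;> simp [ho, Function.update_apply]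
  simp only [prOne_experiment hU, h1, hybridAdvantage]

theorem exists_negligibleIn_hybridAdvantage (hΓ : Tendsto Γ atTop atTop)
    {a : ℝ} (ha : 0 < a) (hlow : ∀ᶠ k : ℕ in atTop, a * k ≤ Γ k)
    (hreg : ∃ c : ℕ, Γ =O[atTop] fun k : ℕ => Γ (k / 10) ^ c) (hV : S.IsValid)
    (hU : S.UniformKeys) (hS : S.Secure AdvKind.nonuniform Γ) {n : ℕ → ℕ} (hn : PolyIn Γ n)
    {ι : ℕ → Type} [∀ k, Finite (ι k)] {inp : ∀ k, ι k → List (List Bool)} {L : ℕ → ℕ}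
    (hL : PolyIn Γ L) (hinp : ∀ k i, (inp k i).length ≤ 3)
    (hinpL : ∀ k i, ∀ w ∈ inp k i, w.length ≤ L k) {B : ℕ → Prog}
    (hB : AdvKind.nonuniform.Allows Γ B) {tB : ℕ → ℕ} (htB : PolyIn Γ tB)
    (hBt : ∀ k i, TimeBounded (B k) (inp k i) (S.ctLen (k / 10)) (tB k)) :
    ∃ ε : ℕ → ℝ, NegligibleIn Γ ε ∧ (∀ k, 0 ≤ ε k) ∧
      ∀ k (i : ι k) (j : Fin (n k)) (y : Fin (n k) → BitStr (k / 10)) (f : Fin (n k) → Bool),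
        hybridAdvantage S (B k) (inp k i) (tB k) j y f ≤ ε k := by
  obtain ⟨P, te, hte, hq, hrun⟩ := hV.enc_eff
  have hP : ∀ k, ComputesEnc S P (k / 10) (te (k / 10)) := fun k y m => hrun (k / 10) (y, m)
  let N : ℕ → ℕ := fun k => n k * (2 * (k / 10 + 2) + 1)
  let T : ℕ → ℕ := fun k =>
    hardwiredTime P (N k) (L k) (S.ctLen (k / 10)) (te (k / 10)) (tB k) (k / 10)
  let Z : ℕ → ℕ := fun k => 15 * L k + 4 * N k + 20 + ((querySub P 0 0).size + 30) * (B k).size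
  have hid : PolyIn Γ fun k => k / 10 := IsPoly.id.div_ten.polyIn ha hlow
  have hN : PolyIn Γ N :=
    hn.mul (.add hΓ (.mul (.const hΓ 2) (.add hΓ hid (.const hΓ 2))) (.const hΓ 1))
  have hT : PolyIn Γ T := .hardwiredTime hΓ hN hL (hV.ctLen_poly.div_ten.polyIn ha hlow)
    (hte.div_ten.polyIn ha hlow) htB hid
  have hZ : PolyIn Γ Z := .add hΓ (.add hΓ (.add hΓ (.mul (.const hΓ 15) hL)
    (.mul (.const hΓ 4) hN)) (.const hΓ 20)) (.mul (.const hΓ _) hB)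
  have key : ∀ k, ∃ R : Prog, R.size ≤ Z k + 1 ∧
      TimeBounded R [unary (k / 10)] (S.ctLen (k / 10)) (T k + 1) ∧
      ∀ (i : ι k) (j : Fin (n k)) (y : Fin (n k) → BitStr (k / 10)) (f : Fin (n k) → Bool),
        hybridAdvantage S (B k) (inp k i) (tB k) j y f ≤
          |prOne (S.experiment (k / 10) R (T k + 1) false) -
            prOne (S.experiment (k / 10) R (T k + 1) true)| := by
    intro k
    rcases isEmpty_or_nonempty (ι k × Fin (n k)) with he | hne
    · exact ⟨Prog.skip, by simp [Prog.size], fun O _ =>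
        (Exec.skip.mono (by omega)).haltsWithin, fun i j => (he.false (i, j)).elim⟩
    · obtain ⟨⟨i₀, j₀⟩⟩ := hne
      have : Nonempty (ι k × Fin (n k) × (Fin (n k) → BitStr (k / 10)) × (Fin (n k) → Bool)) :=
        ⟨(i₀, j₀, fun _ _ => false, fun _ => false)⟩
      obtain ⟨⟨i, j, y, f⟩, hmax⟩ := Finite.exists_max
        fun c : ι k × Fin (n k) × (Fin (n k) → BitStr (k / 10)) × (Fin (n k) → Bool) =>
          hybridAdvantage S (B k) (inp k c.1) (tB k) c.2.1 c.2.2.1 c.2.2.2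
      obtain ⟨R, h1, h2, h3⟩ := hardwired_spec hU hq (hP k) (hinp k i) (hinpL k i) (hBt k i) j y f
      refine ⟨R, h1.trans (Nat.le_succ _), h2.mono (Nat.le_succ _), fun i' j' y' f' =>
        (hmax (i', j', y', f')).trans (h3.le.trans (le_of_eq ?_))⟩
      have h4 : ∀ b, S.experiment (k / 10) R (T k + 1) b = S.experiment (k / 10) R (T k) b :=
        fun b => bind_congr_support _ fun x _ =>
          output_of_le (h2 _ (length_of_mem_oracle x b)) (Nat.le_succ _)
      rw [h4, h4]
  choose R hR1 hR2 hR3 using key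
  refine ⟨_, hS.negligibleIn_div_ten hΓ hreg (R := R) (T := fun k => T k + 1) (fun r hr => ?_)
    (.add hΓ hT (.const hΓ 1)) hR2, fun k => abs_nonneg _, hR3⟩
  exact PolyIn.comp_mul_ten_add (f := fun k => (R k).size) hr hreg
    ((PolyIn.add hΓ hZ (.const hΓ 1)).mono hR1)

theorem hybrid_sum_le {B : Prog} {inp : List (List Bool)} {ε : ℝ} (hε : 0 ≤ ε)
    (h : ∀ (j : Fin n) (y : Fin n → BitStr k) (f : Fin n → Bool),
      hybridAdvantage S B inp t j y f ≤ ε) (J : Finset (Fin n)) (a : Fin n → BitStr k) :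
    |(𝔼 y : J → BitStr k, prOne (output (keyOracle S (glue y a)
        fun j => if j ∈ J then false else true) B inp t)) -
      𝔼 y : J → BitStr k, prOne (output (keyOracle S (glue y a)
        fun j => if j ∈ J then true else true) B inp t)| ≤ n * ε := by
  refine (hybrid_le (D := fun y f => prOne (output (keyOracle S y f) B inp t)) h J a).trans ?_
  gcongr
  simpa using J.card_le_univ

theorem length_encodeSeq {n l : ℕ} (p : Fin n → BitStr l) :
    (encodeSeq p).length = n * (2 * l + 1) := by
  simp [encodeSeq_eq, List.length_flatMap, List.map_ofFn, Function.comp_def,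
    length_encodeStr]

theorem multiSemanticSecure_nonuniform {H : HashFamily fun k => k / 10} (hH : H.IsUniversal)
    {a : ℝ} (ha : 0 < a) (hlow : ∀ᶠ k : ℕ in atTop, a * k ≤ Γ k)
    (hup : ∃ g : ℕ → ℝ, g =o[atTop] (fun k : ℕ => (k : ℝ)) ∧ ∀ᶠ k : ℕ in atTop, Γ k ≤ (2 : ℝ) ^ g k)
    (hreg : ∃ c : ℕ, Γ =O[atTop] fun k : ℕ => Γ (k / 10) ^ c) (hV : S.IsValid)
    (hU : S.UniformKeys) (hS : S.Secure AdvKind.nonuniform Γ) :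
    (hashedScheme S H).MultiSemanticSecure AdvKind.nonuniform Γ := by
  have hΓ := tendsto_of_low ha hlow
  intro n hn B t hB ht hBt
  have hn : PolyIn Γ n := hn
  have hid : PolyIn Γ fun k => k := IsPoly.id.polyIn ha hlow
  obtain ⟨ε, hε, hε0, hle⟩ := exists_negligibleIn_hybridAdvantage hΓ ha hlow hreg hV hU hS hn
    (ι := fun k => Fin (n k) → BitStr (H.seedLen k)) (inp := fun k p => [unary k, encodeSeq p])
    (L := fun k => k + n k * (2 * H.seedLen k + 1))
    (.add hΓ hid (.mul hn (.add hΓ (.mul (.const hΓ 2) (hH.seedLen_poly.polyIn ha hlow))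
      (.const hΓ 1)))) (by simp) (by simp [unary, length_encodeSeq]) hB ht hBt
  rw [negligibleAdvantage_iff hΓ]
  refine ((negligibleIn_hashError hΓ hup hn).add (hε.poly_mul hΓ hε0 hn)).mono hΓ
    (Eventually.of_forall fun k => abs_nonneg _) (Eventually.of_forall fun k => ?_)
  refine abs_multiExperiment_le hH (B k) (t k) (abs_expect_le_of_forall fun p => ?_)
  simpa only [expect_glue_keyOracle rfl] using
    hybrid_sum_le (hε0 k) (hle k p) Finset.univ fun _ _ => false

end MILR

end

noncomputable section

namespace MILR

open scoped BigOperators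

variable {Γ : ℕ → ℝ} {S : EncScheme}

/-! ### Security against preprocessing -/

theorem card_le_of_le_theta_pow {k s c : ℕ} (hk : 0 < k)
    (h : (1 / 2 ^ (s + 2 * k) : ℝ) ≤ theta k ^ c) : (c : ℝ) ≤ 2 * (s : ℝ) / (k : ℝ) + 4 := by
  have h1 : (1 / 2 ^ (s + 2 * k) : ℝ) ^ 2 ≤ (1 / 2 ^ k) ^ c := by
    refine (pow_le_pow_left₀ (by positivity) h 2).trans (le_of_eq ?_)
    rw [← pow_mul, mul_comm, pow_mul, theta_sq]
    simp
  rw [div_pow, div_pow, one_pow, one_pow, one_div_le_one_div (by positivity) (by positivity),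
    ← pow_mul, ← pow_mul] at h1
  have h2 : k * c ≤ (s + 2 * k) * 2 := (Nat.pow_le_pow_iff_right (by norm_num : 1 < 2)).1
    (by exact_mod_cast h1)
  have hk' : (0 : ℝ) < k := by exact_mod_cast hk
  rw [div_add' _ _ _ hk'.ne', le_div_iff₀ hk']
  have h3 : (k : ℝ) * c ≤ (s + 2 * k) * 2 := by exact_mod_cast h2
  linarith

theorem sum_toReal_eq_one {α : Type} [Fintype α] (μ : PMF α) : ∑ a, (μ a).toReal = 1 := by
  rw [← ENNReal.toReal_sum fun a _ => PMF.apply_ne_top _ _, ← tsum_fintype (L := .unconditional _),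
    PMF.tsum_coe, ENNReal.toReal_one]

theorem prOne_leakExperiment {H : HashFamily fun k => k / 10} {k n s : ℕ}
    (F : (Fin n → BitStr k) → PMF (BitStr s)) (J : (Fin n → BitStr k) → BitStr s → Finset (Fin n))
    (B : Prog) (t : ℕ) (b : Bool) :
    prOne ((hashedScheme S H).leakExperiment F (fun x z _ => PMF.pure (J x z)) B t b) =
      ∑ z, ∑ x, ((Fintype.card (Fin n → BitStr k) : ℝ)⁻¹ * (F x z).toReal) *
        𝔼 p : Fin n → BitStr (H.seedLen k),
          prOne (output ((hashedScheme S H).oracle x p (J x z) b) B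
            [unary k, List.ofFn z, encodeSeq p] t) := by
  have e : (hashedScheme S H).leakExperiment F (fun x z _ => PMF.pure (J x z)) B t b =
      (PMF.uniformOfFintype (Fin n → BitStr k)).bind fun x => (F x).bind fun z =>
        (PMF.uniformOfFintype (Fin n → BitStr (H.seedLen k))).bind fun p =>
          output ((hashedScheme S H).oracle x p (J x z) b) B
            [unary k, List.ofFn z, encodeSeq p] t := by
    rw [← iid_uniform, ← iid_uniform]
    refine bind_congr_support _ fun x _ => ?_
    simp only [PMF.pure_bind]
    exact PMF.bind_comm _ _ _
  rw [e, prOne_bind_uniform, Fintype.expect_eq_sum_div_card, Finset.sum_comm, Finset.sum_div]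
  refine Finset.sum_congr rfl fun x _ => ?_
  rw [prOne_bind, Finset.sum_div]
  refine Finset.sum_congr rfl fun z _ => ?_
  rw [prOne_bind_uniform, div_eq_inv_mul, mul_assoc]

theorem preprocessingSecure_nonuniform {H : HashFamily fun k => k / 10} (hH : H.IsUniversal)
    {a : ℝ} (ha : 0 < a) (hlow : ∀ᶠ k : ℕ in atTop, a * k ≤ Γ k)
    (hup : ∃ g : ℕ → ℝ, g =o[atTop] (fun k : ℕ => (k : ℝ)) ∧ ∀ᶠ k : ℕ in atTop, Γ k ≤ (2 : ℝ) ^ g k)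
    (hreg : ∃ c : ℕ, Γ =O[atTop] fun k : ℕ => Γ (k / 10) ^ c) (hV : S.IsValid)
    (hU : S.UniformKeys) (hS : S.Secure AdvKind.nonuniform Γ) :
    (hashedScheme S H).PreprocessingSecure AdvKind.nonuniform Γ fun l s => 2 * s / l + 4 := by
  have hΓ := tendsto_of_low ha hlow
  intro n hn s hs F
  have hn : PolyIn Γ n := hn
  have hid : PolyIn Γ fun k => k := IsPoly.id.polyIn ha hlow
  let w : ∀ k, BitStr (s k) → (Fin (n k) → BitStr k) → ℝ := fun k z x =>
    (Fintype.card (Fin (n k) → BitStr k) : ℝ)⁻¹ * (F k x z).toReal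
  have hw0 : ∀ k z x, 0 ≤ w k z x := fun k z x => by positivity
  have hw : ∀ k z x, w k z x ≤
      (Fintype.card (BitStr k) : ℝ)⁻¹ ^ Fintype.card (Fin (n k)) := fun k z x => by
    have h1 := ENNReal.toReal_mono ENNReal.one_ne_top ((F k x).coe_le_one z)
    rw [ENNReal.toReal_one] at h1
    have h2 : (Fintype.card (BitStr k) : ℝ)⁻¹ ^ Fintype.card (Fin (n k)) =
        (Fintype.card (Fin (n k) → BitStr k) : ℝ)⁻¹ := by simp
    rw [h2]
    exact mul_le_of_le_one_right (by positivity) h1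
  choose I hI hbound using fun k z => exists_dense_decomposition (hw0 k z) (hw k z) (theta_pos k)
    (theta_sq k) (ε := 1 / 2 ^ (s k + 2 * k)) (by positivity)
    (by rw [div_le_one (by positivity)]; exact one_le_pow₀ (by norm_num))
  refine ⟨fun k x z _ => PMF.pure (if k = 0 then Finset.univ else (I k z x)ᶜ), ?_, ?_⟩
  · intro k x z p J hJ
    rw [PMF.support_pure, Set.mem_singleton_iff] at hJ
    subst hJ
    split_ifs with hk
    · subst hk
      simp
    · have h1 := card_le_of_le_theta_pow (Nat.pos_of_ne_zero hk) (hI k z x)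
      have h2 := Finset.card_add_card_compl (I k z x)
      rw [Fintype.card_fin] at h2
      have h3 : ((I k z x).card : ℝ) + ((I k z x)ᶜ.card : ℝ) = n k := by exact_mod_cast h2
      linarith
  · intro B t hB ht hBt
    obtain ⟨ε, hε, hε0, hle⟩ := exists_negligibleIn_hybridAdvantage hΓ ha hlow hreg hV hU hS hn
      (ι := fun k => BitStr (s k) × (Fin (n k) → BitStr (H.seedLen k)))
      (inp := fun k i => [unary k, List.ofFn i.1, encodeSeq i.2])
      (L := fun k => k + n k * k + n k * (2 * H.seedLen k + 1))
      (.add hΓ (.add hΓ hid (.mul hn hid)) (.mul hn (.add hΓ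
        (.mul (.const hΓ 2) (hH.seedLen_poly.polyIn ha hlow)) (.const hΓ 1)))) (by simp)
      (fun k i => by
        have := hs k
        simp only [List.mem_cons, List.not_mem_nil, or_false, forall_eq_or_imp, forall_eq, unary,
          List.length_replicate, List.length_ofFn, length_encodeSeq]
        omega) hB ht (fun k i => hBt k i.1 i.2)
    rw [negligibleAdvantage_iff hΓ]
    refine (((negligibleIn_hashError hΓ hup hn).add (hε.poly_mul hΓ hε0 hn)).add
      (negligibleIn_exp hΓ hup (b := 2) (by norm_num))).mono hΓ
      (Eventually.of_forall fun k => abs_nonneg _) ?_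
    filter_upwards [eventually_gt_atTop 0] with k hk
    have hJ : (fun (x : Fin (n k) → BitStr k) (z : BitStr (s k))
        (_ : Fin (n k) → BitStr ((hashedScheme S H).pLen k)) =>
        PMF.pure (if k = 0 then Finset.univ else (I k z x)ᶜ)) =
        fun x z _ => PMF.pure (I k z x)ᶜ := by
      simp only [hk.ne', if_false]
    rw [hJ, prOne_leakExperiment, prOne_leakExperiment, ← Finset.sum_sub_distrib]
    have hδ : 0 ≤ hashError k (n k) + n k * ε k :=
      add_nonneg (Real.sqrt_nonneg _) (mul_nonneg (Nat.cast_nonneg _) (hε0 k))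
    have hz : ∀ z, |∑ x, w k z x * (𝔼 p : Fin (n k) → BitStr (H.seedLen k),
        (prOne (output ((hashedScheme S H).oracle x p (I k z x)ᶜ false) (B k)
          [unary k, List.ofFn z, encodeSeq p] (t k)) -
        prOne (output ((hashedScheme S H).oracle x p (I k z x)ᶜ true) (B k)
          [unary k, List.ofFn z, encodeSeq p] (t k))))| ≤
        (hashError k (n k) + n k * ε k) * ∑ x, w k z x + 1 / 2 ^ (s k + 2 * k) := fun z =>
      hbound k z (fun x I => 𝔼 p : Fin (n k) → BitStr (H.seedLen k),
        (prOne (output ((hashedScheme S H).oracle x p Iᶜ false) (B k)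
          [unary k, List.ofFn z, encodeSeq p] (t k)) -
        prOne (output ((hashedScheme S H).oracle x p Iᶜ true) (B k)
          [unary k, List.ofFn z, encodeSeq p] (t k)))) _ hδ
        (fun x I => abs_expect_le_of_forall fun p => abs_prOne_sub_le _ _)
        fun I a v hv => abs_piece_le hH hv (B k) (t k)
          (fun p => [unary k, List.ofFn z, encodeSeq p])
          (abs_expect_le_of_forall fun p => hybrid_sum_le (hε0 k) (hle k (z, p)) _ _)
    have hmass : ∑ z, ∑ x, w k z x = 1 := by
      rw [Finset.sum_comm]
      simp only [w, ← Finset.mul_sum, sum_toReal_eq_one]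
      simp
    have hrest : ∑ _z : BitStr (s k), (1 / 2 ^ (s k + 2 * k) : ℝ) = (2 : ℝ) ^ (-(2 * (k : ℝ))) := by
      rw [Finset.sum_const, Finset.card_univ, nsmul_eq_mul, Real.rpow_neg (by norm_num),
        show (2 * (k : ℝ)) = ((2 * k : ℕ) : ℝ) by push_cast; ring, Real.rpow_natCast, pow_add]
      simp only [Fintype.card_pi, Fintype.card_bool, Finset.prod_const, Finset.card_univ,
        Fintype.card_fin, Nat.cast_pow, Nat.cast_ofNat]
      field_simp
    calc _ = |∑ z, ∑ x, w k z x * (𝔼 p : Fin (n k) → BitStr (H.seedLen k),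
        (prOne (output ((hashedScheme S H).oracle x p (I k z x)ᶜ false) (B k)
          [unary k, List.ofFn z, encodeSeq p] (t k)) -
        prOne (output ((hashedScheme S H).oracle x p (I k z x)ᶜ true) (B k)
          [unary k, List.ofFn z, encodeSeq p] (t k))))| := by
          congr 1
          refine Finset.sum_congr rfl fun z _ => ?_
          rw [← Finset.sum_sub_distrib]
          refine Finset.sum_congr rfl fun x _ => ?_
          rw [← mul_sub, Finset.expect_sub_distrib]
      _ ≤ ∑ z, ((hashError k (n k) + n k * ε k) * ∑ x, w k z x + 1 / 2 ^ (s k + 2 * k)) :=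
          (Finset.abs_sum_le_sum_abs _ _).trans (Finset.sum_le_sum fun z _ => hz z)
      _ = hashError k (n k) + n k * ε k + (2 : ℝ) ^ (-(2 * (k : ℝ))) := by
          rw [Finset.sum_add_distrib, ← Finset.mul_sum, hmass, hrest, mul_one]

end MILR

end

noncomputable section

namespace MILR

open Prog

variable {O : Oracle}

/-! ### Sampling uniform strings -/

/-- The law of the string obtained by putting `n` random bits in front of `w`. -/
def coinsOnto (n : ℕ) (w : List Bool) : PMF (List Bool) :=
  chain (fun _ w => (PMF.uniformOfFintype Bool).map fun b => b :: w) 0 n w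

theorem coinsOnto_add (a b : ℕ) (w : List Bool) :
    coinsOnto (b + a) w = (coinsOnto b w).bind (coinsOnto a) := by
  induction a with
  | zero =>
    have : coinsOnto 0 = PMF.pure := rfl
    rw [this, PMF.bind_pure, add_zero]
  | succ a ih =>
    rw [← add_assoc, coinsOnto, chain, ← coinsOnto, ih, PMF.bind_bind]
    rfl

theorem coinsOnto_nil (n : ℕ) : coinsOnto n [] = (uniformBits n).map fun x => List.ofFn x := by
  induction n with
  | zero =>
    have h : uniformBits 0 = PMF.pure Fin.elim0 := by
      ext v
      rw [uniformBits, PMF.uniformOfFintype_apply, Subsingleton.elim v Fin.elim0]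
      simp
    rw [h, PMF.pure_map]
    rfl
  | succ n ih =>
    have h : uniformBits (n + 1) = _ :=
      (uniformOfFintype_bind_map (Fin.consEquiv fun _ : Fin (n + 1) => Bool)).symm
    rw [coinsOnto, chain, ← coinsOnto, ih, h, PMF.bind_map, PMF.map_bind]
    simp only [PMF.map, Function.comp_def, PMF.bind_bind, PMF.pure_bind]
    rw [PMF.bind_comm]
    refine bind_congr_support _ fun b _ => bind_congr_support _ fun x _ => ?_
    simp [Fin.consEquiv]

/-- Replaces `m` marks on the stack `a` by one on the stack `b`, or discards what is there. -/
def popMany (a b : ℕ) : ℕ → Prog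
  | 0 => push b true
  | m + 1 => branch a skip skip (seq (pop a) (popMany a b m))

/-- Divides the unary number on the stack `a` by `m` and adds the result to the stack `b`. -/
def divide (a b m : ℕ) : Prog := loop a (popMany a b m)

theorem exec_popMany {a b : ℕ} (hab : a ≠ b) (m x q : ℕ) (s : Store) (ha : s a = unary x)
    (hb : s b = unary q) :
    Exec O (popMany a b m) s (3 * m + 2) (Function.update (Function.update s a (unary (x - m))) b
      (unary (if m ≤ x then q + 1 else q))) := by
  induction m generalizing x s with
  | zero =>
    refine (Exec.push b true).of_eq (by omega) ?_
    rw [Nat.sub_zero, ← ha, Function.update_eq_self]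
    simp [hb, unary, List.replicate_succ]
  | succ m ih =>
    cases x with
    | zero =>
      refine (Runs.branch_nil ha (Exec.skip (O := O))).of_eq (by omega) ?_
      simp [← ha, ← hb]
    | succ x =>
      have h1 := ih x (Function.update s a (unary x)) (by simp) (by simp [hab.symm, hb])
      have h2 : Exec O (pop a) s 1 (Function.update s a (unary x)) :=
        (Exec.pop a).of_eq le_rfl (by simp [ha, unary, List.replicate_succ])
      refine (Runs.branch_true (l := unary x) ha (h2.seq h1)).of_eq (by omega) ?_
      simp

theorem exec_divide {a b m : ℕ} (hab : a ≠ b) (hm : 0 < m) (x q : ℕ) (s : Store)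
    (ha : s a = unary x) (hb : s b = unary q) :
    Exec O (divide a b m) s (x * (3 * m + 3) + 1)
      (Function.update (Function.update s a []) b (unary (q + x / m))) := by
  induction x using Nat.strong_induction_on generalizing q s with
  | _ x ih =>
    rcases Nat.eq_zero_or_pos x with rfl | hx
    · refine (Exec.loop_nil ha).of_eq (by omega) ?_
      have : s a = [] := ha
      simp [← this, ← hb]
    · have hne : s a ≠ [] := by
        simp [ha, unary]
        omega
      have h := ih (x - m) (by omega) (if m ≤ x then q + 1 else q)
        (Function.update (Function.update s a (unary (x - m))) b
          (unary (if m ≤ x then q + 1 else q)))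
        (by simp [Function.update_of_ne hab]) (Function.update_self b _ _)
      have hq : (if m ≤ x then q + 1 else q) + (x - m) / m = q + x / m := by
        split_ifs with hmx
        · obtain ⟨d, rfl⟩ := Nat.exists_eq_add_of_le hmx
          rw [Nat.add_sub_cancel_left, Nat.add_div_left _ hm]
          omega
        · rw [Nat.div_eq_of_lt (by omega), Nat.div_eq_of_lt (by omega)]
      rw [hq] at h
      refine (Exec.loop_cons hne (exec_popMany hab m x q s ha hb) h).of_eq ?_ ?_
      · have : (x - m + 1) * (3 * m + 3) ≤ x * (3 * m + 3) := Nat.mul_le_mul (by omega) le_rfl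
        rw [Nat.add_mul] at this
        omega
      · funext r
        simp only [Function.update_apply]
        split_ifs <;> simp_all

/-- Replaces the unary string of length `k` by `(k / 10) * k` random bits. -/
def sampleMatrix : Prog :=
  seq (copy 0 1 2) (seq (divide 0 3 10) (loop 3 (seq (pop 3) (seq (copy 1 2 4)
    (loop 2 (seq (pop 2) (coin 0)))))))

theorem unary_succ_sub {j k : ℕ} (hj : j < k) : unary (k - j) = true :: unary (k - (j + 1)) := by
  rw [show k - j = (k - (j + 1)) + 1 by omega]
  rfl

theorem runs_coins (k : ℕ) (u c w : List Bool) :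
    Runs O [loop 2 (seq (pop 2) (coin 0))] (load [w, u, unary k, c, []]) (k * (3 + 1) + 1)
      ((coinsOnto k w).map fun w => load [w, u, [], c, []]) := by
  have := Runs.loop_chain (O := O) (r := 2) (P := seq (pop 2) (coin 0)) k 3
    (fun j w => load [w, u, unary (k - j), c, []])
    (fun _ w => (PMF.uniformOfFintype Bool).map fun b => b :: w) (fun _ _ => True)
    (fun j hj w _ => by simp [unary_succ_sub hj]) (fun w _ => by simp [unary])
    (fun j hj w _ => by
      have h1 : Exec O (pop 2) (load [w, u, unary (k - j), c, []]) 1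
          (load [w, u, unary (k - (j + 1)), c, []]) :=
        (Exec.pop 2).of_eq le_rfl (by simp [update_load, unary_succ_sub hj])
      refine (h1.seq_runs (Runs.coin 0)).of_eq le_rfl ?_
      rw [PMF.map_comp]
      congr 1
      funext b
      simp [update_load]) (fun _ _ _ _ _ _ => trivial) w trivial
  simpa [unary, coinsOnto] using this

theorem runs_sampleMatrix (k : ℕ) :
    Runs O [sampleMatrix] (load [unary k]) (k * (20 * k + 20) + 60 * k + 20)
      (((uniformBits (k / 10 * k)).map fun x => List.ofFn x).map fun w =>
        load [w, unary k, [], [], []]) := by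
  have h0 : load [unary k] = load [unary k, [], [], [], []] := by
    rw [← load_append_nil [unary k], ← load_append_nil ([unary k] ++ [[]]),
      ← load_append_nil ([unary k] ++ [[]] ++ [[]]),
      ← load_append_nil ([unary k] ++ [[]] ++ [[]] ++ [[]])]
    rfl
  have e1 : Exec O (copy 0 1 2) (load [unary k, [], [], [], []]) (12 * k + 3)
      (load [unary k, unary k, [], unary 0, []]) :=
    (exec_copy (by simp) (by simp) (by simp) (by simp)).of_eq (by simp [unary])
      (by simp [update_load, unary])
  have e2 : Exec O (divide 0 3 10) (load [unary k, unary k, [], unary 0, []]) (33 * k + 1)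
      (load [[], unary k, [], unary (k / 10), []]) :=
    (exec_divide (m := 10) (show (0 : ℕ) ≠ 3 by simp) (by simp) k 0 _ rfl rfl).of_eq (by omega) (by simp [update_load])
  have e3 := Runs.loop_chain (O := O) (r := 3)
    (P := seq (pop 3) (seq (copy 1 2 4) (loop 2 (seq (pop 2) (coin 0))))) (k / 10) (16 * k + 7)
    (fun j w => load [w, unary k, [], unary (k / 10 - j), []])
    (fun _ w => coinsOnto k w) (fun _ _ => True)
    (fun j hj w _ => by simp [unary_succ_sub hj]) (fun w _ => by simp [unary])
    (fun j hj w _ => by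
      have h1 : Exec O (pop 3) (load [w, unary k, [], unary (k / 10 - j), []]) 1
          (load [w, unary k, [], unary (k / 10 - (j + 1)), []]) :=
        (Exec.pop 3).of_eq le_rfl (by simp [update_load, unary_succ_sub hj])
      have h2 : Exec O (copy 1 2 4) (load [w, unary k, [], unary (k / 10 - (j + 1)), []])
          (12 * k + 3) (load [w, unary k, unary k, unary (k / 10 - (j + 1)), []]) :=
        (exec_copy (by simp) (by simp) (by simp) (by simp)).of_eq (by simp [unary])
          (by simp [update_load])
      exact (h1.seq_runs (h2.seq_runs (runs_coins k _ _ w))).mono (by omega))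
    (fun _ _ _ _ _ _ => trivial) [] trivial
  have hlaw : ∀ m w, chain (fun _ w => coinsOnto k w) 0 m w = coinsOnto (m * k) w := by
    intro m w
    induction m with
    | zero => simp [chain, coinsOnto]
    | succ m ih => rw [chain, ih, Nat.succ_mul, coinsOnto_add]
  rw [hlaw, coinsOnto_nil, Nat.sub_self] at e3
  rw [h0]
  refine (e1.seq_runs (e2.seq_runs e3)).mono ?_
  have h1 : k / 10 * (16 * k + 7 + 1) ≤ k * (20 * k + 20) :=
    Nat.mul_le_mul (Nat.div_le_self k 10) (by omega)
  omega

/-! ### Random matrices as a universal hash family -/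

/-- The inner product modulo `2`. -/
def dot : List Bool → List Bool → Bool
  | a :: r, b :: x => (a && b) ^^ dot r x
  | _, _ => false

theorem dot_update {k : ℕ} (r x : Fin k → Bool) (j : Fin k) (c : Bool) :
    dot (List.ofFn (Function.update r j (r j ^^ c))) (List.ofFn x) =
      (dot (List.ofFn r) (List.ofFn x) ^^ (c && x j)) := by
  induction k with
  | zero => exact j.elim0
  | succ k ih =>
    simp only [List.ofFn_succ, dot]
    refine Fin.cases ?_ (fun j => ?_) j
    · have h : ∀ i : Fin k, Function.update r 0 (r 0 ^^ c) i.succ = r i.succ := fun i => by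
        simp
      simp only [h, Function.update_self]
      cases r 0 <;> cases c <;> cases x 0 <;> simp
    · have h : (fun i : Fin k => Function.update r j.succ (r j.succ ^^ c) i.succ) =
          Function.update (fun i : Fin k => r i.succ) j (r j.succ ^^ c) := by
        funext i
        simp [Function.update_apply]
      rw [h, ih (fun i => r i.succ) (fun i => x i.succ) j,
        Function.update_of_ne (Fin.succ_ne_zero j).symm, Bool.xor_assoc]

/-- The hash family of all matrices. -/
def matrixHash : HashFamily fun k => k / 10 where
  seedLen k := k / 10 * k
  hash _ g x i := dot (List.ofFn fun j => g (finProdFinEquiv (i, j))) (List.ofFn x)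

theorem card_collision_le {m k : ℕ} {x y : Fin k → Bool} (hxy : x ≠ y) :
    Fintype.card {g : Fin (m * k) → Bool // ∀ i : Fin m,
        dot (List.ofFn fun j => g (finProdFinEquiv (i, j))) (List.ofFn x) =
          dot (List.ofFn fun j => g (finProdFinEquiv (i, j))) (List.ofFn y)} * 2 ^ m ≤
      2 ^ (m * k) := by
  obtain ⟨j₀, hj₀⟩ := Function.ne_iff.1 hxy
  let φ : {g : Fin (m * k) → Bool // ∀ i : Fin m,
        dot (List.ofFn fun j => g (finProdFinEquiv (i, j))) (List.ofFn x) =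
          dot (List.ofFn fun j => g (finProdFinEquiv (i, j))) (List.ofFn y)} × (Fin m → Bool) →
      Fin (m * k) → Bool := fun a s =>
    if (finProdFinEquiv.symm s).2 = j₀ then a.1.1 s ^^ a.2 (finProdFinEquiv.symm s).1 else a.1.1 s
  have hrow : ∀ a i, (fun j => φ a (finProdFinEquiv (i, j))) = Function.update
      (fun j => a.1.1 (finProdFinEquiv (i, j))) j₀ (a.1.1 (finProdFinEquiv (i, j₀)) ^^ a.2 i) := by
    intro a i
    funext j
    by_cases hj : j = j₀
    · subst hj
      simp only [φ, Equiv.symm_apply_apply, if_true, Function.update_self]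
    · simp only [φ, Equiv.symm_apply_apply, if_neg hj, Function.update_of_ne hj]
  have hrec : ∀ a i, (dot (List.ofFn fun j => φ a (finProdFinEquiv (i, j))) (List.ofFn x) ^^
      dot (List.ofFn fun j => φ a (finProdFinEquiv (i, j))) (List.ofFn y)) = a.2 i := by
    intro a i
    rw [hrow, dot_update (fun j => a.1.1 (finProdFinEquiv (i, j))) x,
      dot_update (fun j => a.1.1 (finProdFinEquiv (i, j))) y, a.1.2 i]
    revert hj₀
    cases x j₀ <;> cases y j₀ <;> cases a.2 i <;> simp
  have hinj : Function.Injective φ := by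
    intro a b hab
    have h2 : a.2 = b.2 := by
      funext i
      rw [← hrec a i, ← hrec b i, hab]
    refine Prod.ext (Subtype.ext (funext fun s => ?_)) h2
    have := congrFun hab s
    simp only [φ, h2] at this
    split_ifs at this with h
    · exact (Bool.xor_left_inj).1 this
    · exact this
  have := Fintype.card_le_of_injective φ hinj
  simpa [Fintype.card_prod] using this

/-- Multiplies the string on stack `1` by the first row of the matrix on stack `0` and pushes the
result on stack `4`. -/
def mulRow : Prog :=
  seq (loop 1 (seq (branch 1 skip (seq (pop 1) (push 2 false)) (seq (pop 1) (seq (push 2 true)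
      (branch 0 skip skip (branch 3 (push 3 true) (pop 3) (pop 3)))))) (pop 0)))
    (seq (move 2 1) (branch 3 (push 4 false) skip (seq (pop 3) (push 4 true))))

/-- A bit as a stack. -/
def bitStack (b : Bool) : List Bool := if b then [true] else []

theorem exec_mulRow_loop (r x : List Bool) (h : r.length = x.length) (rest tmp out : List Bool)
    (b : Bool) :
    Exec O (loop 1 (seq (branch 1 skip (seq (pop 1) (push 2 false)) (seq (pop 1)
      (seq (push 2 true) (branch 0 skip skip (branch 3 (push 3 true) (pop 3) (pop 3)))))) (pop 0)))
      (load [r ++ rest, x, tmp, bitStack b, out]) (12 * x.length + 1)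
      (load [rest, [], x.reverse ++ tmp, bitStack (b ^^ dot r x), out]) := by
  induction x generalizing r tmp b with
  | nil =>
    obtain rfl := List.length_eq_zero_iff.1 h
    exact (Exec.loop_nil rfl).of_eq (by simp) (by simp [dot])
  | cons c x ih =>
    obtain ⟨a, r, rfl⟩ := List.exists_cons_of_length_eq_add_one h
    have hP : Exec O (seq (branch 1 skip (seq (pop 1) (push 2 false)) (seq (pop 1)
        (seq (push 2 true) (branch 0 skip skip (branch 3 (push 3 true) (pop 3) (pop 3)))))) (pop 0))
        (load [a :: r ++ rest, c :: x, tmp, bitStack b, out]) 11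
        (load [r ++ rest, x, c :: tmp, bitStack (b ^^ (a && c)), out]) := by
      have h2 : Exec O (pop 0) (load [a :: (r ++ rest), x, c :: tmp, bitStack (b ^^ (a && c)), out]) 1
          (load [r ++ rest, x, c :: tmp, bitStack (b ^^ (a && c)), out]) :=
        (Exec.pop 0).of_eq le_rfl (by simp [update_load])
      refine Runs.mono (Exec.seq (t := 9) ?_ h2) (by omega)
      cases c
      · refine (Runs.branch_false (l := x) (by simp) ((Exec.pop 1).seq (Exec.push 2 false))).of_eq
          (by omega) ?_
        simp [update_load]
      · have h3 : Exec O (pop 1) (load [a :: r ++ rest, true :: x, tmp, bitStack b, out]) 1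
            (load [a :: (r ++ rest), x, tmp, bitStack b, out]) :=
          (Exec.pop 1).of_eq le_rfl (by simp [update_load])
        have h4 : Exec O (push 2 true) (load [a :: (r ++ rest), x, tmp, bitStack b, out]) 1
            (load [a :: (r ++ rest), x, true :: tmp, bitStack b, out]) :=
          (Exec.push 2 true).of_eq le_rfl (by simp [update_load])
        refine Runs.mono (Runs.branch_true (l := x) (by simp) (h3.seq (h4.seq (t' := 3) ?_)))
          (by omega)
        cases a
        · exact (Runs.branch_false (l := r ++ rest) (by simp) (Exec.skip (O := O))).of_eq
            (by omega) (by simp)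
        · refine Runs.branch_true (l := r ++ rest) (by simp) ?_
          cases b
          · exact (Runs.branch_nil (by simp [bitStack]) (Exec.push 3 true)).of_eq le_rfl
              (by simp [update_load, bitStack])
          · exact (Runs.branch_true (l := []) (by simp [bitStack]) (Exec.pop 3)).of_eq le_rfl
              (by simp [update_load, bitStack])
    refine (Exec.loop_cons (by simp) hP (ih r (by simpa using h) _ _)).of_eq
      (by simp; omega) ?_
    simp [dot]

theorem exec_mulRow (r x : List Bool) (h : r.length = x.length) (rest out : List Bool) :
    Exec O mulRow (load [r ++ rest, x, [], [], out]) (17 * x.length + 10)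
      (load [rest, x, [], [], dot r x :: out]) := by
  have e1 := exec_mulRow_loop (O := O) r x h rest [] out false
  have e2 : Exec O (move 2 1) (load [rest, [], x.reverse ++ [], bitStack (false ^^ dot r x), out])
      (5 * x.length + 1) (load [rest, x, [], bitStack (dot r x), out]) :=
    (exec_move (by simp)).of_eq (by simp) (by simp [update_load])
  have e3 : Exec O (branch 3 (push 4 false) skip (seq (pop 3) (push 4 true)))
      (load [rest, x, [], bitStack (dot r x), out]) 4 (load [rest, x, [], [], dot r x :: out]) := by
    cases dot r x
    · exact (Runs.branch_nil (by simp [bitStack]) (Exec.push 4 false)).of_eq (by omega)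
        (by simp [update_load, bitStack])
    · exact (Runs.branch_true (l := []) (by simp [bitStack]) ((Exec.pop 3).seq
        (Exec.push 4 true))).of_eq (by omega) (by simp [update_load, bitStack])
  exact Runs.mono (e1.seq (e2.seq e3)) (by omega)

/-- Multiplies the string on stack `1` by the matrix on stack `0`. -/
def mulMatrix : Prog := seq (loop 0 mulRow) (move 4 0)

theorem exec_mulMatrix (rows : List (List Bool)) (x : List Bool)
    (h : ∀ r ∈ rows, r.length = x.length ∧ r ≠ []) :
    Exec O mulMatrix (load [rows.flatten, x, [], [], []])
      (rows.length * (17 * x.length + 11) + 5 * rows.length + 3)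
      (load [rows.map fun r => dot r x, x, [], [], []]) := by
  have key : ∀ (rows : List (List Bool)) (out : List Bool),
      (∀ r ∈ rows, r.length = x.length ∧ r ≠ []) →
      Exec O (loop 0 mulRow) (load [rows.flatten, x, [], [], out])
        (rows.length * (17 * x.length + 11) + 1)
        (load [[], x, [], [], (rows.map fun r => dot r x).reverse ++ out]) := by
    intro rows
    induction rows with
    | nil => exact fun out _ => (Exec.loop_nil rfl).of_eq (by simp) (by simp)
    | cons r rows ih =>
      intro out h
      have hr := h r (by simp)
      refine (Exec.loop_cons ?_ (exec_mulRow r x hr.1 rows.flatten out)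
        (ih _ fun r' hr' => h r' (by simp [hr']))).of_eq ?_ ?_
      · simp [hr.2]
      · simp only [List.length_cons]; ring_nf; omega
      · simp
  refine ((key rows [] h).seq (exec_move (by simp))).of_eq ?_ ?_
  · simp; omega
  · simp [update_load]

theorem matrixHash_isUniversal : matrixHash.IsUniversal := by
  have hseed : IsPoly matrixHash.seedLen := IsPoly.id.div_ten.mul IsPoly.id
  refine ⟨hseed, ?_, ?_, fun k x y hxy => ?_⟩
  · refine ⟨sampleMatrix, fun k => k * (20 * k + 20) + 60 * k + 20,
      ((IsPoly.id.mul (((IsPoly.const 20).mul IsPoly.id).add (.const 20))).add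
        ((IsPoly.const 60).mul IsPoly.id)).add (.const 20), ?_, fun k _ => ?_⟩
    · simp [sampleMatrix, copy, move, divide, popMany, QueryFree]
    · have := runs_sampleMatrix (O := noOracle) k
      refine ⟨this.haltsWithin, this.output_eq.trans ?_⟩
      rw [PMF.map_comp]
      exact PMF.map_id _
  · refine ⟨mulMatrix, fun k => k / 10 * (17 * k + 11) + 5 * (k / 10) + 3, ?_,
      ((IsPoly.id.div_ten.mul (((IsPoly.const 17).mul IsPoly.id).add (.const 11))).add
        ((IsPoly.const 5).mul IsPoly.id.div_ten)).add (.const 3), ?_, fun k i => ?_⟩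
    · simp [mulMatrix, mulRow, move, CoinFree]
    · simp [mulMatrix, mulRow, move, QueryFree]
    · obtain ⟨g, x⟩ := i
      let rows : List (List Bool) := List.ofFn fun i : Fin (k / 10) =>
        List.ofFn fun j : Fin k => g (finProdFinEquiv (i, j))
      have hg : List.ofFn g = rows.flatten := by
        refine (List.ofFn_mul (m := k / 10) (n := k) g).trans ?_
        congr 1
        refine congrArg List.ofFn (funext fun i => congrArg List.ofFn (funext fun j => ?_))
        congr 1
        ext
        simp [finProdFinEquiv]
        ring
      have h0 : load [List.ofFn g, List.ofFn x] = load [rows.flatten, List.ofFn x, [], [], []] := by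
        rw [hg, ← load_append_nil [rows.flatten, List.ofFn x],
          ← load_append_nil ([rows.flatten, List.ofFn x] ++ [[]]),
          ← load_append_nil ([rows.flatten, List.ofFn x] ++ [[]] ++ [[]])]
        rfl
      have h1 := exec_mulMatrix (O := noOracle) rows (List.ofFn x) fun r hr => by
        obtain ⟨i, rfl⟩ := (List.mem_ofFn' _ _).1 hr
        refine ⟨by simp, fun h => ?_⟩
        have h2 := congrArg List.length h
        have h3 := i.2
        simp only [List.length_ofFn, List.length_nil] at h2
        omega
      rw [← h0] at h1
      have h2 : Runs noOracle [mulMatrix] (load [List.ofFn g, List.ofFn x])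
          (k / 10 * (17 * k + 11) + 5 * (k / 10) + 3) (PMF.pure _) :=
        Runs.mono h1 (by simp [rows])
      refine ⟨h2.haltsWithin, h2.output_eq.trans ?_⟩
      rw [PMF.pure_map]
      congr 1
      simp [rows, matrixHash, List.map_ofFn, Function.comp_def]
  · rw [uniformBits, PMF.toOuterMeasure_uniformOfFintype_apply]
    have h := card_collision_le (m := k / 10) hxy
    have hset : Fintype.card {g : BitStr (matrixHash.seedLen k) //
        g ∈ {g | matrixHash.hash k g x = matrixHash.hash k g y}} * 2 ^ (k / 10) ≤
        2 ^ (k / 10 * k) := by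
      refine le_trans (le_of_eq ?_) h
      congr 1
      refine Fintype.card_congr (Equiv.subtypeEquivRight fun g => ?_)
      exact funext_iff
    rw [ENNReal.div_le_iff (by simp) (by simp)]
    rw [← ENNReal.div_eq_inv_mul, ENNReal.le_div_iff_mul_le (by simp) (by simp)]
    have h2 : Fintype.card (BitStr (matrixHash.seedLen k)) = 2 ^ (k / 10 * k) := by
      show Fintype.card (Fin (k / 10 * k) → Bool) = _
      simp
    rw [h2]
    exact_mod_cast hset

end MILR

end

noncomputable section

namespace MILR

open Prog
open scoped BigOperators

variable {O : Oracle} {B E W : Store}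

/-! ### Building blocks of the uniform reduction -/

/-- Multiplies the unary number on the stack `a` by `m` and adds the result to the stack `b`. -/
def multiply (a b m : ℕ) : Prog := loop a (seq (pop a) (pushStr b (unary m)))

theorem unary_append (m n : ℕ) : unary m ++ unary n = unary (m + n) := by
  simp [unary]

theorem reverse_unary (n : ℕ) : (unary n).reverse = unary n := by
  simp [unary]

theorem length_unary (n : ℕ) : (unary n).length = n := by
  simp [unary]

theorem exec_multiply {a b : ℕ} (hab : a ≠ b) (m x q : ℕ) (s : Store)
    (ha : s a = unary x) (hb : s b = unary q) :
    Exec O (multiply a b m) s (x * (2 * m + 4) + 1)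
      (Function.update (Function.update s a []) b (unary (q + m * x))) := by
  induction x generalizing q s with
  | zero =>
    refine (Exec.loop_nil ha).of_eq (by omega) ?_
    have : s a = [] := ha
    simp [← this, ← hb]
  | succ x ih =>
    have h1 : Exec O (seq (pop a) (pushStr b (unary m))) s (2 * m + 3)
        (Function.update (Function.update s a (unary x)) b (unary (m + q))) := by
      refine ((Exec.pop a).seq (exec_pushStr b (unary m) _)).of_eq
        (by rw [length_unary]; omega) ?_
      rw [Function.update_of_ne hab.symm, hb, unary_append, ha]
      rfl
    have h2 := ih (m + q) (Function.update (Function.update s a (unary x)) b (unary (m + q)))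
      (by simp [Function.update_of_ne hab]) (by simp)
    refine (Exec.loop_cons (by simp [ha, unary]) h1 h2).of_eq (by ring_nf; omega) ?_
    rw [show m + q + m * x = q + m * (x + 1) by ring]
    funext r
    simp only [Function.update_apply]
    split_ifs <;> simp_all

/-- Applies `P` to the content of the stack `a` of the third zone and leaves the reversal of the
output on the stack `b`. -/
def applyTo (P : Prog) (a b : ℕ) : Prog :=
  seq (copy (wS a) (eS 0) (wS 7)) (seq (call P) (move (eS 0) (wS b)))

/-- A bound for the number of steps of `applyTo P a b`. -/
def applyTime (P : Prog) (L t : ℕ) : ℕ := callTime P L t + 17 * L + 10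

theorem runs_applyTo {P : Prog} (hP : P.QueryFree) {w : List Bool} {t L a b : ℕ}
    (hh : HaltsWithin noOracle P [w] t) (hw : w.length ≤ L)
    (hL : ∀ v ∈ (output noOracle P [w] t).support, v.length ≤ L) (ha : W a = w) (ha7 : a ≠ 7)
    (h7 : W 7 = []) (hb : W b = []) :
    Runs O [applyTo P a b] (zones B (load [[], []]) W) (applyTime P L t)
      ((output noOracle P [w] t).map fun v =>
        zones B (load [[], []]) (Function.update W b v.reverse)) := by
  have e1 : Exec O (copy (wS a) (eS 0) (wS 7)) (zones B (load [[], []]) W) (12 * L + 3)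
      (zones B (load ([w] ++ [[]])) W) :=
    (exec_copy (by simp) (by simpa using ha7) (by simp) (by simpa using h7)).of_eq
      (by rw [zones_wS, ha]; omega) (by simp [update_load, ha])
  have e2 := runs_call (O := O) (B := B) (W := W) hP hh (by simp) (L := L) (by simpa using hw)
  rw [← load_append_nil [w]] at e2
  have e3 := Runs.seq_map (Q := move (eS 0) (wS b)) (t' := 5 * L + 1) e2
    (g := fun v => zones B (load [[], []]) (Function.update W b v.reverse)) fun v hv =>
      (exec_move (by simp)).of_eq (by simpa using hL v hv) (by simp [update_load, hb])
  exact (e1.seq_runs e3).mono (by simp only [applyTime]; omega)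

/-! ### Sampling an index -/

/-- Draws a uniformly random index with as many bits as the unary number on the stack `4`. -/
def randomIndex : Prog :=
  loop (wS 4) (seq (divide (wS 4) (wS 7) 2) (seq (move (wS 7) (wS 4))
    (seq (multiply (wS 5) (wS 7) 2) (seq (move (wS 7) (wS 5)) (seq (coin (wS 7))
      (branch (wS 7) skip (pop (wS 7)) (seq (pop (wS 7)) (push (wS 5) true))))))))

/-- The law of a random number with `m` bits. -/
def indexLaw (m : ℕ) : PMF ℕ :=
  chain (fun _ i => (PMF.uniformOfFintype Bool).map fun b => 2 * i + b.toNat) 0 m 0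

theorem sum_range_two_mul (m : ℕ) (f : ℕ → ℝ) :
    ∑ i ∈ Finset.range (2 * m), f i = ∑ i ∈ Finset.range m, (f (2 * i) + f (2 * i + 1)) := by
  induction m with
  | zero => simp
  | succ m ih =>
    rw [Finset.sum_range_succ, ← ih, show 2 * (m + 1) = 2 * m + 1 + 1 by ring,
      Finset.sum_range_succ, Finset.sum_range_succ]
    ring

theorem prOne_indexLaw_bind (m : ℕ) (f : ℕ → PMF (List Bool)) :
    prOne ((indexLaw m).bind f) = (2 ^ m)⁻¹ * ∑ i ∈ Finset.range (2 ^ m), prOne (f i) := by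
  induction m generalizing f with
  | zero => simp [indexLaw, chain]
  | succ m ih =>
    rw [indexLaw, chain, ← indexLaw, PMF.bind_bind, ih, pow_succ' (2 : ℕ), pow_succ' (2 : ℝ),
      sum_range_two_mul, mul_inv,
      mul_comm (2 : ℝ)⁻¹, mul_assoc, Finset.mul_sum (a := (2 : ℝ)⁻¹)]
    congr 1
    refine Finset.sum_congr rfl fun i _ => ?_
    rw [PMF.bind_map, prOne_bind_uniform, Fintype.expect_eq_sum_div_card]
    simp
    ring

theorem mem_support_indexStep {i i' : ℕ}
    (h : i' ∈ ((PMF.uniformOfFintype Bool).map fun b => 2 * i + b.toNat).support) :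
    i' ≤ 2 * i + 1 := by
  rw [PMF.mem_support_map_iff] at h
  obtain ⟨b, _, rfl⟩ := h
  have := Bool.toNat_le b
  omega

theorem runs_randomIndex (n : ℕ) (w0 w1 w2 w3 w6 : List Bool) :
    Runs O [randomIndex] (zones B E (load [w0, w1, w2, w3, unary n, [], w6, []]))
      (n * (50 * n + 50) + 1)
      ((indexLaw n.size).map fun i =>
        zones B E (load [w0, w1, w2, w3, [], unary i, w6, []])) := by
  have hdiv : ∀ j, n / 2 ^ j / 2 = n / 2 ^ (j + 1) := fun j => by
    rw [Nat.div_div_eq_div_mul, pow_succ]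
  have hsize : n.size ≤ n := Nat.size_le.2 Nat.lt_two_pow_self
  have h := Runs.loop_chain (O := O) (r := wS 4)
    (P := seq (divide (wS 4) (wS 7) 2) (seq (move (wS 7) (wS 4))
      (seq (multiply (wS 5) (wS 7) 2) (seq (move (wS 7) (wS 5)) (seq (coin (wS 7))
        (branch (wS 7) skip (pop (wS 7)) (seq (pop (wS 7)) (push (wS 5) true))))))))
    n.size (50 * n + 40)
    (fun j i => zones B E (load [w0, w1, w2, w3, unary (n / 2 ^ j), unary i, w6, []]))
    (fun _ i => (PMF.uniformOfFintype Bool).map fun b => 2 * i + b.toNat) (fun j i => i < 2 ^ j)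
    (fun j hj i _ => by
      have : 0 < n / 2 ^ j := Nat.div_pos (Nat.lt_size.1 hj) (by positivity)
      simp only [zones_wS, load_succ, load_zero, unary, ne_eq, List.replicate_eq_nil_iff]
      omega)
    (fun i _ => by
      have : n / 2 ^ n.size = 0 := Nat.div_eq_of_lt n.lt_size_self
      simp [this, unary])
    (fun j hj i hi => by
      have hx : n / 2 ^ j ≤ n := Nat.div_le_self _ _
      have hi : i < n := hi.trans_le (Nat.lt_size.1 hj)
      have e1 : Exec O (divide (wS 4) (wS 7) 2)
          (zones B E (load [w0, w1, w2, w3, unary (n / 2 ^ j), unary i, w6, []])) (9 * n + 1)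
          (zones B E (load [w0, w1, w2, w3, [], unary i, w6, unary (n / 2 ^ (j + 1))])) :=
        (exec_divide (by simp) (by simp) (n / 2 ^ j) 0 _ (by simp) (by simp [unary])).of_eq
          (by omega) (by simp [update_load, hdiv])
      have e2 : Exec O (move (wS 7) (wS 4))
          (zones B E (load [w0, w1, w2, w3, [], unary i, w6, unary (n / 2 ^ (j + 1))]))
          (5 * n + 1)
          (zones B E (load [w0, w1, w2, w3, unary (n / 2 ^ (j + 1)), unary i, w6, []])) :=
        (exec_move (by simp)).of_eq
          (by simpa [length_unary] using Nat.div_le_self _ _)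
          (by simp [update_load, reverse_unary])
      have e3 : Exec O (multiply (wS 5) (wS 7) 2)
          (zones B E (load [w0, w1, w2, w3, unary (n / 2 ^ (j + 1)), unary i, w6, []]))
          (8 * n + 1)
          (zones B E (load [w0, w1, w2, w3, unary (n / 2 ^ (j + 1)), [], w6, unary (2 * i)])) :=
        (exec_multiply (by simp) 2 i 0 _ (by simp) (by simp [unary])).of_eq (by omega)
          (by simp [update_load])
      have e4 : Exec O (move (wS 7) (wS 5))
          (zones B E (load [w0, w1, w2, w3, unary (n / 2 ^ (j + 1)), [], w6, unary (2 * i)]))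
          (10 * n + 1)
          (zones B E (load [w0, w1, w2, w3, unary (n / 2 ^ (j + 1)), unary (2 * i), w6, []])) :=
        (exec_move (by simp)).of_eq (by simp [length_unary]; omega)
          (by simp [update_load, reverse_unary])
      have e5 := Runs.seq_map (Q := branch (wS 7) skip (pop (wS 7))
          (seq (pop (wS 7)) (push (wS 5) true))) (t' := 4) (Runs.coin (O := O) (wS 7)
          (s := zones B E (load [w0, w1, w2, w3, unary (n / 2 ^ (j + 1)), unary (2 * i), w6, []])))
        (g := fun b => zones B E
          (load [w0, w1, w2, w3, unary (n / 2 ^ (j + 1)), unary (2 * i + b.toNat), w6, []]))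
        (fun b _ => by
          cases b
          · exact (Runs.branch_false (l := []) (by simp) (Exec.pop (wS 7))).of_eq (by omega)
              (by simp [update_load])
          · exact (Runs.branch_true (l := []) (by simp) ((Exec.pop (wS 7)).seq
              (Exec.push (wS 5) true))).of_eq le_rfl
              (by simp [update_load, unary, List.replicate_succ]))
      rw [PMF.map_comp]
      exact (e1.seq_runs (e2.seq_runs (e3.seq_runs (e4.seq_runs e5)))).mono (by omega))
    (fun j hj i hi i' hi' => by
      have := mem_support_indexStep hi'
      rw [pow_succ]
      omega) 0 (by simp)
  have h0 : n / 2 ^ n.size = 0 := Nat.div_eq_of_lt n.lt_size_self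
  rw [h0, pow_zero, Nat.div_one] at h
  refine Runs.mono h ?_
  have := Nat.mul_le_mul_right (50 * n + 40 + 1) hsize
  have : n * (50 * n + 40 + 1) ≤ n * (50 * n + 50) := Nat.mul_le_mul_left n (by omega)
  omega

/-! ### Sampling parameters and keys -/

theorem chain_iid {α : Type} (μ : PMF α) (c : ℕ → α → List Bool) (n : ℕ) :
    chain (fun j w => μ.map fun x => c j x ++ w) 0 n [] =
      (iid μ n).map fun v => (List.ofFn fun j : Fin n => c (n - 1 - j) (v j)).flatten := by
  induction n with
  | zero => simp [chain, iid, PMF.pure_map]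
  | succ n ih =>
    rw [chain, ih, iid, PMF.bind_map, PMF.map_bind]
    simp only [PMF.map, Function.comp_def, PMF.bind_bind, PMF.pure_bind]
    rw [PMF.bind_comm]
    refine bind_congr_support _ fun b _ => bind_congr_support _ fun v _ => ?_
    congr 1
    simp only [List.ofFn_succ, Fin.cons_zero, Fin.cons_succ, List.flatten_cons, Fin.val_zero,
      Fin.val_succ, zero_add, Nat.add_sub_cancel, Nat.sub_zero]
    congr 4
    funext j
    rw [show n - 1 - (j : ℕ) = n - (j + 1) by omega]

/-- Pushes encodings of outputs of `P` on the stack `1` of the first zone, one for every mark on the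
stack `4`. -/
def sampleParams (P : Prog) : Prog :=
  loop (wS 4) (seq (pop (wS 4)) (seq (applyTo P 2 5) (writeStr (wS 5) (bS 1))))

theorem runs_sampleParams {P : Prog} (hP : P.QueryFree) {k l n t L : ℕ}
    (hh : HaltsWithin noOracle P [unary k] t)
    (ho : output noOracle P [unary k] t = (uniformBits l).map fun g => List.ofFn g) (hk : k ≤ L)
    (hl : l ≤ L) (w0 w1 w3 w6 : List Bool) :
    Runs O [sampleParams P] (zones (load [[], [], []]) (load [[], []])
        (load [w0, w1, unary k, w3, unary n, [], w6, []]))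
      (n * (applyTime P L t + 7 * L + 10) + 1)
      ((iid (uniformBits l) n).map fun p => zones (load [[], encodeSeq p, []]) (load [[], []])
        (load [w0, w1, unary k, w3, [], [], w6, []])) := by
  have h := Runs.loop_chain (O := O) (r := wS 4)
    (P := seq (pop (wS 4)) (seq (applyTo P 2 5) (writeStr (wS 5) (bS 1))))
    n (applyTime P L t + 7 * L + 6)
    (fun j w => zones (load [[], w, []]) (load [[], []])
        (load [w0, w1, unary k, w3, unary (n - j), [], w6, []]))
    (fun _ w => (uniformBits l).map fun g => encodeStr (List.ofFn g) ++ w) (fun _ _ => True)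
    (fun j hj w _ => by simp [unary_succ_sub hj]) (fun w _ => by simp [unary])
    (fun j hj w _ => by
      have e1 : Exec O (pop (wS 4)) (zones (load [[], w, []]) (load [[], []])
          (load [w0, w1, unary k, w3, unary (n - j), [], w6, []])) 1
          (zones (load [[], w, []]) (load [[], []])
          (load [w0, w1, unary k, w3, unary (n - (j + 1)), [], w6, []])) :=
        (Exec.pop _).of_eq le_rfl (by simp [update_load, unary_succ_sub hj])
      have e2 := runs_applyTo (O := O) (B := load [[], w, []])
        (W := load [w0, w1, unary k, w3, unary (n - (j + 1)), [], w6, []]) (a := 2) (b := 5) hP hh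
        (hk.trans' (length_unary k).le) (fun v hv => by
          rw [ho, PMF.mem_support_map_iff] at hv
          obtain ⟨g, _, rfl⟩ := hv
          simpa using hl) rfl (by simp) rfl rfl
      rw [ho, PMF.map_comp] at e2
      have e3 := Runs.seq_map (Q := writeStr (wS 5) (bS 1)) (t' := 7 * L + 3) e2
        (g := fun g => zones (load [[], encodeStr (List.ofFn g) ++ w, []]) (load [[], []])
          (load [w0, w1, unary k, w3, unary (n - (j + 1)), [], w6, []])) fun g _ =>
          (exec_writeStr (by simp)).of_eq (by simpa using hl) (by simp [update_load])
      rw [PMF.map_comp]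
      exact (e1.seq_runs e3).mono (by omega)) (fun _ _ _ _ _ _ => trivial) [] trivial
  rw [chain_iid _ fun _ g => encodeStr (List.ofFn g), PMF.map_comp] at h
  refine Runs.of_eq h (Nat.add_le_add_right (Nat.mul_le_mul_left n (by omega)) 1) ?_
  congr 1
  funext p
  simp only [Function.comp_def, Nat.sub_self, encodeSeq_eq, List.flatMap_def, List.map_ofFn]
  rfl

/-- The stack that tells the next instances apart from the instance `i`, after `j` instances. -/
def indexStack (i j : ℕ) : List Bool := if j ≤ i then unary (i - j) ++ [false] else []

/-- Pushes the encodings of instances whose keys are outputs of `P` on the stack `0` of the third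
zone, one for every mark on the stack `3`. -/
def sampleTable (P : Prog) : Prog :=
  loop (wS 3) (seq (pop (wS 3)) (seq (applyTo P 1 5) (seq
    (branch (wS 6) (seq (push (wS 5) true) (push (wS 5) false))
      (seq (pop (wS 6)) (seq (push (wS 5) false) (push (wS 5) true)))
      (seq (pop (wS 6)) (seq (push (wS 5) false) (push (wS 5) false))))
    (writeStr (wS 5) (wS 0)))))

theorem exec_flags (i j : ℕ) (key w0 w1 w2 w3 w4 : List Bool) :
    Exec O (branch (wS 6) (seq (push (wS 5) true) (push (wS 5) false))
      (seq (pop (wS 6)) (seq (push (wS 5) false) (push (wS 5) true)))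
      (seq (pop (wS 6)) (seq (push (wS 5) false) (push (wS 5) false))))
      (zones B E (load [w0, w1, w2, w3, w4, key.reverse, indexStack i j, []])) 6
      (zones B E (load [w0, w1, w2, w3, w4,
        (entryStr (key, decide (i < j), decide (j = i))).reverse, indexStack i (j + 1), []])) := by
  rcases lt_trichotomy i j with h | rfl | h
  · refine (Runs.branch_nil (by simp [indexStack, h]) ((Exec.push _ _).seq
      (Exec.push _ _))).of_eq (by omega) ?_
    simp [update_load, indexStack, entryStr, h, h.ne', (h.trans (Nat.lt_succ_self j)).not_ge,
      h.not_ge]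
  · refine (Runs.branch_false (l := []) (by simp [indexStack, unary]) ((Exec.pop _).seq
      ((Exec.push _ _).seq (Exec.push _ _)))).of_eq (by omega) ?_
    simp [update_load, indexStack, entryStr, unary]
  · have h1 : indexStack i j = true :: indexStack i (j + 1) := by
      rw [indexStack, if_pos h.le, indexStack, if_pos (by omega), unary_succ_sub h]
      rfl
    refine (Runs.branch_true (l := indexStack i (j + 1)) (by simp [h1]) ((Exec.pop _).seq
      ((Exec.push _ _).seq (Exec.push _ _)))).of_eq (by omega) ?_
    simp [update_load, h1, entryStr, h.not_gt, h.ne]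

theorem runs_sampleTable {P : Prog} (hP : P.QueryFree) {k n t L : ℕ}
    (hh : HaltsWithin noOracle P [unary k] t)
    (ho : output noOracle P [unary k] t = (uniformBits k).map fun y => List.ofFn y) (hk : k ≤ L)
    (i : ℕ) (w2 : List Bool) :
    Runs O [sampleTable P] (zones B (load [[], []])
        (load [[], unary k, w2, unary n, [], [], unary i ++ [false], []]))
      (n * (applyTime P L t + 7 * L + 40) + 1)
      ((iid (uniformBits k) n).map fun y => zones B (load [[], []])
        (load [tableStr (mkTable y (fun j => decide (i < n - 1 - j))
          fun j => decide (n - 1 - j = i)), unary k, w2, [], [], [], indexStack i n, []])) := by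
  have h := Runs.loop_chain (O := O) (r := wS 3)
    (P := seq (pop (wS 3)) (seq (applyTo P 1 5) (seq
      (branch (wS 6) (seq (push (wS 5) true) (push (wS 5) false))
        (seq (pop (wS 6)) (seq (push (wS 5) false) (push (wS 5) true)))
        (seq (pop (wS 6)) (seq (push (wS 5) false) (push (wS 5) false))))
      (writeStr (wS 5) (wS 0)))))
    n (applyTime P L t + 7 * L + 30)
    (fun j w => zones B (load [[], []])
        (load [w, unary k, w2, unary (n - j), [], [], indexStack i j, []]))
    (fun j w => (uniformBits k).map fun y =>
      encodeStr (entryStr (List.ofFn y, decide (i < j), decide (j = i))) ++ w) (fun _ _ => True)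
    (fun j hj w _ => by simp [unary_succ_sub hj]) (fun w _ => by simp [unary])
    (fun j hj w _ => by
      have e1 : Exec O (pop (wS 3)) (zones B (load [[], []])
          (load [w, unary k, w2, unary (n - j), [], [], indexStack i j, []])) 1
          (zones B (load [[], []])
          (load [w, unary k, w2, unary (n - (j + 1)), [], [], indexStack i j, []])) :=
        (Exec.pop _).of_eq le_rfl (by simp [update_load, unary_succ_sub hj])
      have e2 := runs_applyTo (O := O) (B := B)
        (W := load [w, unary k, w2, unary (n - (j + 1)), [], [], indexStack i j, []])
        (a := 1) (b := 5) hP hh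
        (hk.trans' (length_unary k).le) (fun v hv => by
          rw [ho, PMF.mem_support_map_iff] at hv
          obtain ⟨g, _, rfl⟩ := hv
          simpa using hk) rfl (by simp) rfl rfl
      rw [ho, PMF.map_comp] at e2
      have e3 := Runs.seq_map (Q := seq
          (branch (wS 6) (seq (push (wS 5) true) (push (wS 5) false))
            (seq (pop (wS 6)) (seq (push (wS 5) false) (push (wS 5) true)))
            (seq (pop (wS 6)) (seq (push (wS 5) false) (push (wS 5) false))))
          (writeStr (wS 5) (wS 0))) (t' := 6 + (7 * (L + 2) + 3) + 1) e2
        (g := fun y => zones B (load [[], []])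
          (load [encodeStr (entryStr (List.ofFn y, decide (i < j), decide (j = i))) ++ w, unary k,
            w2, unary (n - (j + 1)), [], [], indexStack i (j + 1), []])) fun y _ => by
          have e4 := exec_flags (O := O) (B := B) (E := load [[], []]) i j (List.ofFn y) w
            (unary k) w2 (unary (n - (j + 1))) []
          simp only [Function.comp_def]
          rw [update_load (by simp)]
          refine e4.seq ((exec_writeStr (a := wS 5) (b := wS 0) (by simp)).of_eq ?_ ?_)
          · simpa [entryStr] using hk
          · simp [update_load]
      rw [PMF.map_comp]
      exact (e1.seq_runs e3).mono (by omega)) (fun _ _ _ _ _ _ => trivial) [] trivial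
  rw [chain_iid _ fun j y => encodeStr (entryStr (List.ofFn y, decide (i < j), decide (j = i))),
    PMF.map_comp] at h
  refine Runs.of_eq h (Nat.add_le_add_right (Nat.mul_le_mul_left n (by omega)) 1) ?_
  congr 1
  funext p
  simp only [Function.comp_def, Nat.sub_self, tableStr, mkTable, List.flatMap_def, List.map_ofFn]
  rfl

end MILR

end

noncomputable section

namespace MILR

open Prog
open scoped BigOperators

variable {O : Oracle} {Γ : ℕ → ℝ}

/-! ### The uniform reduction -/

/-- Computes the security parameter, whose last digit is `r`, and the number of instances. -/
def setup (r : ℕ) (PN : Prog) : Prog :=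
  seq (move (bS 0) (wS 1)) (seq (copy (wS 1) (wS 6) (wS 7)) (seq (pushStr (wS 2) (unary r))
    (seq (multiply (wS 6) (wS 2) 10) (seq (applyTo PN 2 3) (copy (wS 3) (wS 4) (wS 7))))))

theorem exec_setup {PN : Prog} (hq : PN.QueryFree) {r k k' n t L : ℕ} (hk : r + 10 * k' = k)
    (hh : HaltsWithin noOracle PN [unary k] t)
    (ho : output noOracle PN [unary k] t = PMF.pure (unary n)) (hkL : k ≤ L) (hnL : n ≤ L) :
    Exec O (setup r PN) (load [unary k']) (55 * L + 20 + applyTime PN L t)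
      (zones (load [[], [], []]) (load [[], []])
        (load [[], unary k', unary k, unary n, unary n, [], [], []])) := by
  have h0 : load [unary k'] = zones (load [unary k', [], []]) (load [[], []])
      (load [[], [], [], [], [], [], [], []]) := by
    rw [load_one_eq_zones, ← load_append_nil [[], [], [], [], [], []],
      ← load_append_nil ([[], [], [], [], [], []] ++ [[]])]
    rfl
  have e1 : Exec O (move (bS 0) (wS 1)) (load [unary k']) (5 * k' + 1)
      (zones (load [[], [], []]) (load [[], []])
        (load [[], unary k', [], [], [], [], [], []])) := by
    rw [h0]
    exact (exec_move (by simp)).of_eq (by simp [length_unary])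
      (by simp [update_load, reverse_unary])
  have e2 : Exec O (copy (wS 1) (wS 6) (wS 7)) (zones (load [[], [], []]) (load [[], []])
        (load [[], unary k', [], [], [], [], [], []])) (12 * k' + 3)
      (zones (load [[], [], []]) (load [[], []])
        (load [[], unary k', [], [], [], [], unary k', []])) :=
    (exec_copy (by simp) (by simp) (by simp) (by simp)).of_eq (by simp [length_unary])
      (by simp [update_load])
  have e3 : Exec O (pushStr (wS 2) (unary r)) (zones (load [[], [], []]) (load [[], []])
        (load [[], unary k', [], [], [], [], unary k', []])) (2 * r + 1)
      (zones (load [[], [], []]) (load [[], []])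
        (load [[], unary k', unary r, [], [], [], unary k', []])) :=
    (exec_pushStr _ _ _).of_eq (by simp [length_unary]) (by simp [update_load])
  have e4 : Exec O (multiply (wS 6) (wS 2) 10) (zones (load [[], [], []]) (load [[], []])
        (load [[], unary k', unary r, [], [], [], unary k', []])) (k' * 24 + 1)
      (zones (load [[], [], []]) (load [[], []])
        (load [[], unary k', unary k, [], [], [], [], []])) :=
    (exec_multiply (by simp) 10 k' r _ (by simp) (by simp)).of_eq le_rfl
      (by simp [update_load, hk])
  have e5 := runs_applyTo (O := O) (B := load [[], [], []])
    (W := load [[], unary k', unary k, [], [], [], [], []]) (a := 2) (b := 3) (L := L) hq hh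
    (hkL.trans' (length_unary k).le)
    (fun v hv => by
      rw [ho, PMF.support_pure, Set.mem_singleton_iff] at hv
      rw [hv, length_unary]
      exact hnL) rfl (by simp) rfl rfl
  rw [ho, PMF.pure_map, reverse_unary, update_load (by simp)] at e5
  have e6 : Exec O (copy (wS 3) (wS 4) (wS 7)) (zones (load [[], [], []]) (load [[], []])
        (load [[], unary k', unary k, unary n, [], [], [], []])) (12 * n + 3)
      (zones (load [[], [], []]) (load [[], []])
        (load [[], unary k', unary k, unary n, unary n, [], [], []])) :=
    (exec_copy (by simp) (by simp) (by simp) (by simp)).of_eq (by simp [length_unary])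
      (by simp [update_load])
  exact Runs.mono (e1.seq (e2.seq (e3.seq (e4.seq (Exec.seq e5 e6))))) (by omega)

/-- Prepares the stacks for sampling. -/
def prepare : Prog :=
  seq (push (wS 6) false) (seq (move (wS 5) (wS 6)) (copy (wS 3) (wS 4) (wS 7)))

theorem exec_prepare {B E : Store} (n i : ℕ) (w0 w1 w2 : List Bool) :
    Exec O prepare (zones B E (load [w0, w1, w2, unary n, [], unary i, [], []]))
      (5 * i + 12 * n + 10)
      (zones B E (load [w0, w1, w2, unary n, unary n, [], unary i ++ [false], []])) := by
  have e1 : Exec O (push (wS 6) false)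
      (zones B E (load [w0, w1, w2, unary n, [], unary i, [], []])) 1
      (zones B E (load [w0, w1, w2, unary n, [], unary i, [false], []])) :=
    (Exec.push _ _).of_eq le_rfl (by simp [update_load])
  have e2 : Exec O (move (wS 5) (wS 6))
      (zones B E (load [w0, w1, w2, unary n, [], unary i, [false], []])) (5 * i + 1)
      (zones B E (load [w0, w1, w2, unary n, [], [], unary i ++ [false], []])) :=
    (exec_move (by simp)).of_eq (by simp [length_unary]) (by simp [update_load, reverse_unary])
  have e3 : Exec O (copy (wS 3) (wS 4) (wS 7))
      (zones B E (load [w0, w1, w2, unary n, [], [], unary i ++ [false], []])) (12 * n + 3)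
      (zones B E (load [w0, w1, w2, unary n, unary n, [], unary i ++ [false], []])) :=
    (exec_copy (by simp) (by simp) (by simp) (by simp)).of_eq (by simp [length_unary])
      (by simp [update_load])
  exact Runs.mono (e1.seq (e2.seq e3)) (by omega)

/-- Leaves nothing but the input of the adversary and the table of instances. -/
def finish : Prog := seq (clear (wS 1)) (seq (clear (wS 6)) (move (wS 2) (bS 0)))

theorem exec_finish (k k' : ℕ) (w0 w6 v : List Bool) :
    Exec O finish (zones (load [[], v, []]) (load [[], []])
        (load [w0, unary k', unary k, [], [], [], w6, []])) (5 * k + 2 * k' + 2 * w6.length + 5)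
      (zones (load [unary k, v]) (load [[], []]) (load [w0, [], [], [], [], []])) := by
  have h0 : zones (load [unary k, v]) (load [[], []]) (load [w0, [], [], [], [], []]) =
      zones (load [unary k, v, []]) (load [[], []]) (load [w0, [], [], [], [], [], [], []]) := by
    rw [← load_append_nil [unary k, v], ← load_append_nil [w0, [], [], [], [], []],
      ← load_append_nil ([w0, [], [], [], [], []] ++ [[]])]
    rfl
  have e1 : Exec O (clear (wS 1)) (zones (load [[], v, []]) (load [[], []])
        (load [w0, unary k', unary k, [], [], [], w6, []])) (2 * k' + 1)
      (zones (load [[], v, []]) (load [[], []])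
        (load [w0, [], unary k, [], [], [], w6, []])) :=
    (exec_clear _).of_eq (by simp [length_unary]) (by simp [update_load])
  have e2 : Exec O (clear (wS 6)) (zones (load [[], v, []]) (load [[], []])
        (load [w0, [], unary k, [], [], [], w6, []])) (2 * w6.length + 1)
      (zones (load [[], v, []]) (load [[], []])
        (load [w0, [], unary k, [], [], [], [], []])) :=
    (exec_clear _).of_eq (by simp) (by simp [update_load])
  have e3 : Exec O (move (wS 2) (bS 0)) (zones (load [[], v, []]) (load [[], []])
        (load [w0, [], unary k, [], [], [], [], []])) (5 * k + 1)
      (zones (load [unary k, v]) (load [[], []]) (load [w0, [], [], [], [], []])) := by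
    rw [h0]
    exact (exec_move (by simp)).of_eq (by simp [length_unary])
      (by simp [update_load, reverse_unary])
  exact Runs.mono (e1.seq (e2.seq e3)) (by omega)

/-- The uniform reduction for security parameters with last digit `r`, made of programs for the
number of instances, the parameters, the keys, the encryption, and the adversary. -/
def reduction (r : ℕ) (PN PH PG P B : Prog) : Prog :=
  seq (setup r PN) (seq randomIndex (seq prepare (seq (sampleParams PH) (seq (sampleTable PG)
    (seq finish (simulate P B))))))

/-- A bound for the number of steps of the reduction. -/
def reductionTime (PN PH PG P : Prog) (L tN tH tG N M l t tB : ℕ) : ℕ :=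
  L * (50 * L + applyTime PH L tH + applyTime PG L tG + 14 * L + 100) + 100 * L + 100 +
    applyTime PN L tN + simTime P N M l t tB

theorem mem_support_indexLaw {m i : ℕ} (h : i ∈ (indexLaw m).support) : i < 2 ^ m := by
  induction m generalizing i with
  | zero =>
    simp only [indexLaw, chain, PMF.support_pure, Set.mem_singleton_iff] at h
    simp [h]
  | succ m ih =>
    rw [indexLaw, chain, ← indexLaw, PMF.mem_support_bind_iff] at h
    obtain ⟨i', h1, h2⟩ := h
    have h3 := mem_support_indexStep h2
    have h4 := ih h1
    rw [pow_succ]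
    omega

theorem two_pow_size_le (n : ℕ) : 2 ^ n.size ≤ 2 * n + 1 := by
  rcases h : n.size with _ | m
  · omega
  · have : 2 ^ m ≤ n := Nat.lt_size.1 (by omega)
    rw [pow_succ]
    omega

/-- The program `P` halts on the given inputs within `t` steps, and its output has the law `μ`. -/
def RunsOn (P : Prog) (inp : List (List Bool)) (t : ℕ) (μ : PMF (List Bool)) : Prop :=
  HaltsWithin noOracle P inp t ∧ output noOracle P inp t = μ

/-- The table of instances for the hybrid experiment with index `i`. -/
def hybridTable {k n : ℕ} (i : ℕ) (y : Fin n → BitStr k) : List Entry :=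
  mkTable y (fun j => decide (i < n - 1 - j)) fun j => decide (n - 1 - j = i)

theorem runs_reduction {S : EncScheme} {PN PH PG P B : Prog} (hqN : PN.QueryFree)
    (hqH : PH.QueryFree) (hqG : PG.QueryFree) (hqP : P.QueryFree) {r k k' n l L M tN tH tG t tB : ℕ}
    (hk : r + 10 * k' = k) (hN : RunsOn PN [unary k] tN (PMF.pure (unary n)))
    (hH : RunsOn PH [unary k] tH ((uniformBits l).map fun g => List.ofFn g))
    (hG : RunsOn PG [unary k'] tG ((uniformBits k').map fun y => List.ofFn y))
    (hP : ComputesEnc S P k' t)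
    (hB : ∀ p : Fin n → BitStr l, TimeBounded B [unary k, encodeSeq p] (S.ctLen k') tB)
    (hO : ∀ w, ∀ c ∈ (O w).support, c.length ≤ S.ctLen k') (hkL : k ≤ L) (hnL : n ≤ L)
    (hlL : l ≤ L) (hM : k + n * (2 * l + 1) ≤ M) :
    ∃ μ : PMF Store, Runs O [reduction r PN PH PG P B] (load [unary k'])
      (reductionTime PN PH PG P L tN tH tG (n * (2 * (k' + 2) + 1)) M (S.ctLen k') t tB) μ ∧
      (μ.map fun s => s 0) = (indexLaw n.size).bind fun i => (iid (uniformBits l) n).bind fun p =>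
        (iid (uniformBits k') n).bind fun y =>
          output (simOracle O (fun key b => output noOracle P [key, [b]] t) (hybridTable i y)) B
            [unary k, encodeSeq p] tB := by
  have hsim := fun (i : ℕ) (p : Fin n → BitStr l) (y : Fin n → BitStr k') =>
    runs_simulate (O := O) (T := hybridTable i y) (L := M) hqP
      (length_tableStr_mkTable y _ _).le (hP.halts y _ _) (hP.length_le hO y _ _)
      (by
        simp only [List.mem_cons, List.not_mem_nil, or_false, forall_eq_or_imp, forall_eq,
          length_unary, length_encodeSeq]
        omega) (hB p)
  choose μ hμ ho using hsim
  refine ⟨(indexLaw n.size).bind fun i => (iid (uniformBits l) n).bind fun p =>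
    (iid (uniformBits k') n).bind fun y => μ i p y, ?_, ?_⟩
  · have e1 := exec_setup (O := O) hqN hk hN.1 hN.2 hkL hnL
    have e2 := runs_randomIndex (O := O) (B := load [[], [], []]) (E := load [[], []]) n []
      (unary k') (unary k) (unary n) []
    have e3 : ∀ i ∈ (indexLaw n.size).support, Runs O [seq prepare (seq (sampleParams PH)
        (seq (sampleTable PG) (seq finish (simulate P B))))]
        (zones (load [[], [], []]) (load [[], []])
          (load [[], unary k', unary k, unary n, [], unary i, [], []]))
        ((22 * L + 20) + ((L * (applyTime PH L tH + 7 * L + 10) + 1) +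
          ((L * (applyTime PG L tG + 7 * L + 40) + 1) + ((11 * L + 20) +
          simTime P (n * (2 * (k' + 2) + 1)) M (S.ctLen k') t tB + 1) + 1) + 1) + 1)
        ((iid (uniformBits l) n).bind fun p => (iid (uniformBits k') n).bind fun y => μ i p y) := by
      intro i hi
      have hi : i ≤ 2 * n := by
        have := (mem_support_indexLaw hi).trans_le (two_pow_size_le n)
        omega
      refine ((exec_prepare n i _ _ _).of_eq (by omega) rfl).seq_runs
        (Runs.seq (Runs.mono (runs_sampleParams (L := L) hqH hH.1 hH.2 hkL hlL _ _ _ _) (by gcongr))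
          fun p _ => Runs.seq (Runs.mono (runs_sampleTable (L := L) hqG hG.1 hG.2 (by omega) i _)
            (by gcongr)) fun y _ => ?_)
      refine ((exec_finish k k' _ (indexStack i n) _).of_eq ?_ rfl).seq_runs (hμ i p y)
      have : (indexStack i n).length ≤ 2 * n + 1 := by
        rw [indexStack]
        split_ifs
        · rw [List.length_append, length_unary, List.length_singleton]
          omega
        · exact Nat.zero_le _
      omega
    refine Runs.mono (e1.seq_runs (Runs.seq e2 e3)) ?_
    have : n * (50 * n + 50) ≤ L * (50 * L + 50) := by gcongr
    simp only [reductionTime]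
    nlinarith
  · simp only [PMF.map_bind, ho]

end MILR

end

noncomputable section

namespace MILR

open Prog
open scoped BigOperators

variable {Γ : ℕ → ℝ}

/-- The probability that `B` outputs `1` when the messages for all but the last `n - m` instances,
counted from the end, are replaced by `0`. -/
def hybridProb (S : EncScheme) (B : Prog) (k k' n l tB m : ℕ) : ℝ :=
  𝔼 p : Fin n → BitStr l, 𝔼 y : Fin n → BitStr k',
    prOne (output (keyOracle S y fun j => decide (m ≤ n - 1 - j)) B [unary k, encodeSeq p] tB)

theorem hybridProb_zero (S : EncScheme) (B : Prog) (k k' n l tB : ℕ) :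
    hybridProb S B k k' n l tB 0 = 𝔼 p : Fin n → BitStr l, 𝔼 y : Fin n → BitStr k',
      prOne (output (keyOracle S y fun _ => true) B [unary k, encodeSeq p] tB) := by
  simp [hybridProb]

theorem hybridProb_of_le (S : EncScheme) (B : Prog) (k k' l tB : ℕ) {n m : ℕ} (h : n ≤ m) :
    hybridProb S B k k' n l tB m = 𝔼 p : Fin n → BitStr l, 𝔼 y : Fin n → BitStr k',
      prOne (output (keyOracle S y fun _ => false) B [unary k, encodeSeq p] tB) := by
  have : (fun j : Fin n => decide (m ≤ n - 1 - j)) = fun _ => false := by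
    funext j
    have := j.2
    simp only [decide_eq_false_iff_not]
    omega
  rw [hybridProb, this]

theorem expect_hybridTable {S : EncScheme} {P : Prog} {k' t : ℕ} (hP : ComputesEnc S P k' t)
    (B : Prog) (k n l tB i : ℕ) (b : Bool) :
    (𝔼 x : BitStr k', 𝔼 p : Fin n → BitStr l, 𝔼 y : Fin n → BitStr k',
      prOne (output (simOracle (S.oracle k' x b) (fun key b => output noOracle P [key, [b]] t)
        (hybridTable i y)) B [unary k, encodeSeq p] tB)) =
      hybridProb S B k k' n l tB (i + (!b).toNat) := by
  simp only [hybridTable, hP.simOracle_eq]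
  have hf : ∀ j : Fin n, (if decide (n - 1 - (j : ℕ) = i) = true then b
      else decide (i < n - 1 - (j : ℕ))) = decide (i + (!b).toNat ≤ n - 1 - (j : ℕ)) := by
    intro j
    cases b <;> by_cases h : n - 1 - (j : ℕ) = i <;> (simp [h]; try omega)
  simp only [hf, hybridProb]
  rw [Finset.expect_comm]
  refine Finset.expect_congr rfl fun p _ => ?_
  by_cases hi : i < n
  · have hx : ∀ (x : BitStr k') (y : Fin n → BitStr k'),
        (fun j : Fin n => if decide (n - 1 - (j : ℕ) = i) = true then x else y j) =
          Function.update y ⟨n - 1 - i, by omega⟩ x := by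
      intro x y
      funext j
      have := j.2
      simp only [Function.update_apply, decide_eq_true_eq, Fin.ext_iff]
      congr 1
      simp only [eq_iff_iff]
      omega
    simp only [hx]
    rw [Finset.expect_comm]
    exact expect_update (⟨n - 1 - i, by omega⟩ : Fin n) fun y =>
      prOne (output (keyOracle S y fun j => decide (i + (!b).toNat ≤ n - 1 - j)) B
        [unary k, encodeSeq p] tB)
  · have hx : ∀ j : Fin n, ¬ n - 1 - (j : ℕ) = i := fun j => by
      have := j.2
      omega
    simp only [hx, decide_false, Bool.false_eq_true, if_false]
    exact Finset.expect_const Finset.univ_nonempty _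

theorem abs_hybrid_sub_le {S : EncScheme} (hU : S.UniformKeys) {PN PH PG P B : Prog}
    (hqN : PN.QueryFree) (hqH : PH.QueryFree) (hqG : PG.QueryFree) (hqP : P.QueryFree)
    {r k k' n l L M tN tH tG t tB : ℕ}
    (hk : r + 10 * k' = k) (hN : RunsOn PN [unary k] tN (PMF.pure (unary n)))
    (hH : RunsOn PH [unary k] tH ((uniformBits l).map fun g => List.ofFn g))
    (hG : RunsOn PG [unary k'] tG ((uniformBits k').map fun y => List.ofFn y))
    (hP : ComputesEnc S P k' t)
    (hB : ∀ p : Fin n → BitStr l, TimeBounded B [unary k, encodeSeq p] (S.ctLen k') tB)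
    (hkL : k ≤ L) (hnL : n ≤ L) (hlL : l ≤ L) (hM : k + n * (2 * l + 1) ≤ M) {T : ℕ}
    (hT : T = reductionTime PN PH PG P L tN tH tG (n * (2 * (k' + 2) + 1)) M (S.ctLen k') t tB) :
    TimeBounded (reduction r PN PH PG P B) [unary k'] (S.ctLen k') T ∧
    |𝔼 p : Fin n → BitStr l,
      ((𝔼 y : Fin n → BitStr k', prOne (output (keyOracle S y fun _ => false) B
          [unary k, encodeSeq p] tB)) -
        𝔼 y : Fin n → BitStr k', prOne (output (keyOracle S y fun _ => true) B
          [unary k, encodeSeq p] tB))| ≤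
      (2 * n + 1 : ℕ) * |prOne (S.experiment k' (reduction r PN PH PG P B) T false) -
        prOne (S.experiment k' (reduction r PN PH PG P B) T true)| := by
  have hrun := fun (O : Oracle) hO => runs_reduction (O := O) hqN hqH hqG hqP hk hN hH hG hP hB hO
    hkL hnL hlL hM
  rw [← hT] at hrun
  refine ⟨fun O hO => (hrun O hO).choose_spec.1.haltsWithin, ?_⟩
  have hexp : ∀ b, prOne (S.experiment k' (reduction r PN PH PG P B) T b) =
      (2 ^ n.size)⁻¹ * ∑ i ∈ Finset.range (2 ^ n.size),
        hybridProb S B k k' n l tB (i + (!b).toNat) := by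
    intro b
    rw [prOne_experiment hU]
    have h1 : ∀ x, prOne (output (S.oracle k' x b) (reduction r PN PH PG P B) [unary k'] T) =
        (2 ^ n.size)⁻¹ * ∑ i ∈ Finset.range (2 ^ n.size), 𝔼 p : Fin n → BitStr l,
          𝔼 y : Fin n → BitStr k', prOne (output (simOracle (S.oracle k' x b)
            (fun key b => output noOracle P [key, [b]] t) (hybridTable i y)) B
              [unary k, encodeSeq p] tB) := by
      intro x
      obtain ⟨μ, hμ, ho⟩ := hrun (S.oracle k' x b) (length_of_mem_oracle x b)
      rw [hμ.output_eq, ho, prOne_indexLaw_bind]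
      simp only [iid_uniform, prOne_bind_uniform]
    simp only [h1]
    rw [← Finset.mul_expect, Finset.expect_sum_comm]
    simp only [expect_hybridTable hP]
  have hsum : prOne (S.experiment k' (reduction r PN PH PG P B) T false) -
      prOne (S.experiment k' (reduction r PN PH PG P B) T true) = (2 ^ n.size)⁻¹ *
        (hybridProb S B k k' n l tB (2 ^ n.size) - hybridProb S B k k' n l tB 0) := by
    rw [hexp, hexp, ← mul_sub, ← Finset.sum_sub_distrib,
      ← Finset.sum_range_sub (hybridProb S B k k' n l tB)]
    rfl
  have hsz : (2 : ℝ) ^ n.size ≤ (2 * n + 1 : ℕ) := by exact_mod_cast two_pow_size_le n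
  rw [hybridProb_of_le S B k k' l tB n.lt_size_self.le, hybridProb_zero,
    ← Finset.expect_sub_distrib] at hsum
  rw [hsum, abs_mul, abs_of_pos (show (0 : ℝ) < (2 ^ n.size)⁻¹ by positivity), ← mul_assoc]
  refine le_mul_of_one_le_left (abs_nonneg _) ?_
  rw [← div_eq_mul_inv, one_le_div (by positivity)]
  exact hsz

theorem multiSemanticSecure_uniform {S : EncScheme} {H : HashFamily fun k => k / 10}
    (hH : H.IsUniversal) {a : ℝ} (ha : 0 < a) (hlow : ∀ᶠ k : ℕ in atTop, a * k ≤ Γ k)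
    (hup : ∃ g : ℕ → ℝ, g =o[atTop] (fun k : ℕ => (k : ℝ)) ∧ ∀ᶠ k : ℕ in atTop, Γ k ≤ (2 : ℝ) ^ g k)
    (hreg : ∃ c : ℕ, Γ =O[atTop] fun k : ℕ => Γ (k / 10) ^ c) (hV : S.IsValid)
    (hU : S.UniformKeys) (hS : S.Secure AdvKind.uniform Γ) :
    (hashedScheme S H).MultiSemanticSecure AdvKind.uniform Γ := by
  have hΓ := tendsto_of_low ha hlow
  rintro n ⟨hn, PN, tN, -, htN, hqN, hN⟩ B tB ⟨B₀, hB₀⟩ htB hB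
  obtain ⟨PH, tH, htH, hqH, hrunH⟩ := hH.sample_eff
  obtain ⟨PG, tG, htG, hqG, hrunG⟩ := hV.gen_eff
  obtain ⟨P, te, hte, hqP, hrun⟩ := hV.enc_eff
  have hid : PolyIn Γ fun k => k := IsPoly.id.polyIn ha hlow
  have hseed : PolyIn Γ H.seedLen := hH.seedLen_poly.polyIn ha hlow
  let L : ℕ → ℕ := fun k => k + n k + H.seedLen k
  let M : ℕ → ℕ := fun k => k + n k * (2 * H.seedLen k + 1)
  let T : ℕ → ℕ := fun k => reductionTime PN PH PG P (L k) (tN k) (tH k) (tG (k / 10))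
    (n k * (2 * (k / 10 + 2) + 1)) (M k) (S.ctLen (k / 10)) (te (k / 10)) (tB k)
  have hL : PolyIn Γ L := .add hΓ (.add hΓ hid hn) hseed
  have hM : PolyIn Γ M :=
    .add hΓ hid (.mul hn (.add hΓ (.mul (.const hΓ 2) hseed) (.const hΓ 1)))
  have happly : ∀ {Q : Prog} {t : ℕ → ℕ}, PolyIn Γ t → PolyIn Γ fun k => applyTime Q (L k) (t k) :=
    fun ht => .add hΓ (.add hΓ (.callTime hΓ hL ht) (.mul (.const hΓ 17) hL)) (.const hΓ 10)
  have hT : PolyIn Γ T := by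
    refine .add hΓ (.add hΓ (.add hΓ (.add hΓ (.mul hL (.add hΓ (.add hΓ (.add hΓ (.add hΓ
      (.mul (.const hΓ 50) hL) (happly (htH.polyIn ha hlow)))
      (happly (htG.div_ten.polyIn ha hlow))) (.mul (.const hΓ 14) hL)) (.const hΓ 100)))
      (.mul (.const hΓ 100) hL)) (.const hΓ 100)) (happly htN)) ?_
    exact .simTime hΓ (.mul hn (.add hΓ (.mul (.const hΓ 2) (.add hΓ
      (IsPoly.id.div_ten.polyIn ha hlow) (.const hΓ 2))) (.const hΓ 1))) hM
      (hV.ctLen_poly.div_ten.polyIn ha hlow) (hte.div_ten.polyIn ha hlow) htB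
  have key := fun k => abs_hybrid_sub_le hU (r := k % 10) (k := k) (k' := k / 10) (L := L k)
    (M := M k) (T := T k) hqN hqH hqG hqP (Nat.mod_add_div k 10) (hN k ()) (hrunH k ())
    (by
      have := hrunG (k / 10) ()
      simp only [hU (k / 10)] at this
      exact this)
    (fun y m => hrun (k / 10) (y, m)) (hB k) (by simp only [L]; omega) (by simp only [L]; omega)
    (by simp only [L]; omega) le_rfl rfl
  have hadv := hS.negligibleIn_div_ten hΓ hreg
    (R := fun k => reduction (k % 10) PN PH PG P (B k)) (T := T)
    (fun r hr => ⟨reduction r PN PH PG P B₀, fun k => by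
      simp only [hB₀]
      rw [Nat.mul_add_mod, Nat.mod_eq_of_lt hr]⟩) hT fun k => (key k).1
  rw [negligibleAdvantage_iff hΓ]
  refine ((negligibleIn_hashError hΓ hup hn).add (hadv.poly_mul hΓ (fun k => abs_nonneg _)
    (.add hΓ (.mul (.const hΓ 2) hn) (.const hΓ 1)))).mono hΓ
    (Eventually.of_forall fun k => abs_nonneg _) (Eventually.of_forall fun k => ?_)
  exact abs_multiExperiment_le hH (B k) (tB k) (key k).2

end MILR

end

theorem mainTheorem3 (Γ : ℕ → ℝ)
    (hlow : ∃ a : ℝ, 0 < a ∧ ∀ᶠ k : ℕ in Filter.atTop, a * (k : ℝ) ≤ Γ k)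
    (hup : ∃ g : ℕ → ℝ, Asymptotics.IsLittleO Filter.atTop g (fun k : ℕ => (k : ℝ)) ∧
      ∀ᶠ k : ℕ in Filter.atTop, Γ k ≤ (2 : ℝ) ^ g k)
    (hreg : ∃ c : ℕ, Asymptotics.IsBigO Filter.atTop Γ (fun k : ℕ => Γ (k / 10) ^ c)) :
    (∃ H : MILR.HashFamily (fun k => k / 10), H.IsUniversal) ∧
    (∀ (H : MILR.HashFamily (fun k => k / 10)) (S : MILR.EncScheme),
      H.IsUniversal → S.IsValid → S.UniformKeys →
        (MILR.hashedScheme S H).IsValid ∧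
        (∀ kind : MILR.AdvKind, S.Secure kind Γ →
          (MILR.hashedScheme S H).MultiSemanticSecure kind Γ) ∧
        (S.Secure MILR.AdvKind.nonuniform Γ →
          (MILR.hashedScheme S H).Secure MILR.AdvKind.nonuniform Γ
            (fun l s => 2 * s / l + 4))) ∧
    ((∃ S : MILR.EncScheme, S.IsValid ∧ S.UniformKeys ∧ S.Secure MILR.AdvKind.nonuniform Γ) →
      ∃ M : MILR.Scheme, M.IsValid ∧
        M.Secure MILR.AdvKind.nonuniform Γ (fun l s => 2 * s / l + 4)) := by
  obtain ⟨a, ha, hlow⟩ := hlow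
  have key : ∀ (H : MILR.HashFamily (fun k => k / 10)) (S : MILR.EncScheme),
      H.IsUniversal → S.IsValid → S.UniformKeys →
        (MILR.hashedScheme S H).IsValid ∧
        (∀ kind : MILR.AdvKind, S.Secure kind Γ →
          (MILR.hashedScheme S H).MultiSemanticSecure kind Γ) ∧
        (S.Secure MILR.AdvKind.nonuniform Γ →
          (MILR.hashedScheme S H).Secure MILR.AdvKind.nonuniform Γ
            (fun l s => 2 * s / l + 4)) := by
    intro H S hH hV hU
    refine ⟨MILR.hashedScheme_isValid hH hV hU, fun kind hS => ?_, fun hS =>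
      ⟨MILR.multiSemanticSecure_nonuniform hH ha hlow hup hreg hV hU hS,
        MILR.preprocessingSecure_nonuniform hH ha hlow hup hreg hV hU hS⟩⟩
    cases kind with
    | uniform => exact MILR.multiSemanticSecure_uniform hH ha hlow hup hreg hV hU hS
    | nonuniform => exact MILR.multiSemanticSecure_nonuniform hH ha hlow hup hreg hV hU hS
  refine ⟨⟨MILR.matrixHash, MILR.matrixHash_isUniversal⟩, key, ?_⟩
  rintro ⟨S, hV, hU, hS⟩
  have h := key MILR.matrixHash S MILR.matrixHash_isUniversal hV hU
  exact ⟨_, h.1, h.2.2 hS⟩
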